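/- Let $S_1$ and $S_2$ be K3 surfaces, i.e. compact simply connected complex manifolds of complex dimension 2 that carry a nowhere vanishing holomorphic 2-form. Let $\lambda_i$ be any nowhere vanishing holomorphic 2-form on $S_i$ ($i=1,2$), let $X=S_1\times S_2$ with projections $\mathrm{pr}_i\colon X\to S_i$, and put $$\psi=\mathrm{pr}_1^*\lambda_1\wedge\overline{\mathrm{pr}_2^*\lambda_2}.$$ Then: (a) $\psi$ is a smooth form of type $(2,2)$ on $X$. For all holomorphic local coordinates $(z^1,z^2)$ on $S_1$ and $(z^3,z^4)$ on $S_2$ there are nowhere vanishing holomorphic functions $f_1,f_2$ with $\lambda_1=f_1(z^1,z^2)\,dz^1\wedge dz^2$, $\lambda_2=f_2(z^3,z^4)\,dz^3\wedge dz^4$ and $$\psi=f_1(z^1,z^2)\,\overline{f_2(z^3,z^4)}\,dz^1\wedge dz^2\wedge d\bar z^3\wedge d\bar z^4 .$$ (b) $\psi$ is harmonic with respect to every product Hermitian metric: if $g=g_1\oplus g_2$ with $g_i$ a Hermitian metric on $S_i$, then $\triangle\psi=0$, where $\triangle=d\delta+\delta d$ and $\delta=-{*}d{*}$ is the codifferential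 of $g$. (c) $\psi$ is $\bar\partial$-closed and its class in the Dolbeault cohomology $H^{2,2}(X)$ is nonzero; $\psi$ is $d$-closed and its class in the de Rham cohomology $H^4(X,\mathbb{C})$ is nonzero. -/

import Mathlib

open scoped Manifold ContDiff Nat ComplexConjugate
open Module (finrank)

noncomputable section

namespace KForms

/-! ### Multilinear algebra of complex valued real alternating forms -/

section Pointwise

variable {E : Type*} [NormedAddCommGroup E] [NormedSpace ℝ E]

theorem update_castAdd {k l : ℕ} {E : Type*} (m : Fin (k + l) → E) (a : Fin k) (z : E) :
    (fun i => Function.update m (Fin.castAdd l a) z (Fin.castAdd l i))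
        = Function.update (fun i => m (Fin.castAdd l i)) a z ∧
    (fun j => Function.update m (Fin.castAdd l a) z (Fin.natAdd k j))
        = fun j => m (Fin.natAdd k j) := by
  refine ⟨Function.update_comp_eq_of_injective m (Fin.castAdd_injective k l) a z, ?_⟩
  funext j
  rw [Function.update_of_ne]
  intro h
  have := congrArg Fin.val h
  simp at this
  omega

theorem update_natAdd {k l : ℕ} {E : Type*} (m : Fin (k + l) → E) (b : Fin l) (z : E) :
    (fun j => Function.update m (Fin.natAdd k b) z (Fin.natAdd k j))
        = Function.update (fun j => m (Fin.natAdd k j)) b z ∧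
    (fun i => Function.update m (Fin.natAdd k b) z (Fin.castAdd l i))
        = fun i => m (Fin.castAdd l i) := by
  refine ⟨Function.update_comp_eq_of_injective m (Fin.natAdd_injective l k) b z, ?_⟩
  funext j
  rw [Function.update_of_ne]
  intro h
  have := congrArg Fin.val h
  simp at this
  omega

theorem append_update {k l : ℕ} {E : Type*} (w : Fin k → E) (m : Fin l → E) (i : Fin l) (z : E) :
    Fin.append w (Function.update m i z)
      = Function.update (Fin.append w m) (Fin.natAdd k i) z := by
  funext a
  refine Fin.addCases (fun a => ?_) (fun a => ?_) a
  · rw [Fin.append_left, Function.update_of_ne, Fin.append_left]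
    intro h
    have := congrArg Fin.val h
    simp at this
    omega
  · rw [Fin.append_right]
    by_cases ha : a = i
    · subst ha; simp
    · rw [Function.update_of_ne ha, Function.update_of_ne, Fin.append_right]
      intro h
      exact ha (Fin.natAdd_injective l k h)

theorem matrix_update {k : ℕ} {E : Type*} (θ : Fin k → E → ℂ) (m : Fin k → E) (i : Fin k) (z : E) :
    (Matrix.of fun a b => θ a (Function.update m i z b))
      = (Matrix.of fun a b => θ a (m b)).updateCol i (fun a => θ a z) := by
  ext a b
  by_cases hb : b = i
  · subst hb; simp
  · simp [hb]

/-- The tensor product `(v₁, …, v_{k+l}) ↦ α (v₁, …, v_k) * β (v_{k+1}, …, v_{k+l})`. -/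
def tensor {k l : ℕ} (α : E [⋀^Fin k]→L[ℝ] ℂ) (β : E [⋀^Fin l]→L[ℝ] ℂ) :
    ContinuousMultilinearMap ℝ (fun _ : Fin (k + l) => E) ℂ where
  toFun v := α (fun i => v (Fin.castAdd l i)) * β (fun j => v (Fin.natAdd k j))
  map_update_add' := by
    intro _ m i x y
    have hdec : ‹DecidableEq (Fin (k + l))› = instDecidableEqFin _ := Subsingleton.elim _ _
    subst hdec
    refine Fin.addCases (fun a => ?_) (fun b => ?_) i
    · simp only [(update_castAdd m a _).1, (update_castAdd m a _).2, α.map_update_add, add_mul]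
    · simp only [(update_natAdd m b _).1, (update_natAdd m b _).2, β.map_update_add, mul_add]
  map_update_smul' := by
    intro _ m i c x
    have hdec : ‹DecidableEq (Fin (k + l))› = instDecidableEqFin _ := Subsingleton.elim _ _
    subst hdec
    refine Fin.addCases (fun a => ?_) (fun b => ?_) i
    · simp only [(update_castAdd m a _).1, (update_castAdd m a _).2, α.map_update_smul,
        smul_mul_assoc]
    · simp only [(update_natAdd m b _).1, (update_natAdd m b _).2, β.map_update_smul,
        mul_smul_comm]
  cont := by
    refine Continuous.mul (α.cont.comp ?_) (β.cont.comp ?_) <;> fun_prop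

/-- The wedge product, `(α ∧ β)(v) = (1 / (k! l!)) ∑_σ sgn σ α(v_{σ 1}, …) β(v_{σ (k+1)}, …)`. -/
def wedge {k l : ℕ} (α : E [⋀^Fin k]→L[ℝ] ℂ) (β : E [⋀^Fin l]→L[ℝ] ℂ) :
    E [⋀^Fin (k + l)]→L[ℝ] ℂ :=
  ((k ! * l ! : ℕ) : ℂ)⁻¹ • ContinuousMultilinearMap.alternatization (tensor α β)

/-- The wedge product `θ₁ ∧ … ∧ θ_k` of covectors: `(v₁, …, v_k) ↦ det (θ_i (v_j))`. -/
def covectorWedge {k : ℕ} (θ : Fin k → E →L[ℝ] ℂ) : E [⋀^Fin k]→L[ℝ] ℂ where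
  toFun v := Matrix.det (Matrix.of fun i j => θ i (v j))
  map_update_add' := by
    intro _ m i x y
    have hdec : ‹DecidableEq (Fin k)› = instDecidableEqFin _ := Subsingleton.elim _ _
    subst hdec
    have h := matrix_update (fun a => θ a) m i
    rw [h, h, h, ← Matrix.det_updateCol_add]
    congr 2
    funext a
    simp
  map_update_smul' := by
    intro _ m i c x
    have hdec : ‹DecidableEq (Fin k)› = instDecidableEqFin _ := Subsingleton.elim _ _
    subst hdec
    have h := matrix_update (fun a => θ a) m i
    rw [h, h, Complex.real_smul, ← Matrix.det_updateCol_smul]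
    congr 2
    funext a
    simp
  cont := by
    apply Continuous.matrix_det
    fun_prop
  map_eq_zero_of_eq' := by
    intro v i j h hij
    exact Matrix.det_zero_of_column_eq hij (fun a => by simp [h])

/-- Contraction with `w₁, …, w_k` in the first `k` slots: `v ↦ α (w₁, …, w_k, v₁, …, v_l)`. -/
def contract {k l : ℕ} (w : Fin k → E) (α : E [⋀^Fin (k + l)]→L[ℝ] ℂ) :
    E [⋀^Fin l]→L[ℝ] ℂ where
  toFun v := α (Fin.append w v)
  map_update_add' := by
    intro _ m i x y
    have hdec : ‹DecidableEq (Fin l)› = instDecidableEqFin _ := Subsingleton.elim _ _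
    subst hdec
    simp only [append_update, α.map_update_add]
  map_update_smul' := by
    intro _ m i c x
    have hdec : ‹DecidableEq (Fin l)› = instDecidableEqFin _ := Subsingleton.elim _ _
    subst hdec
    simp only [append_update, α.map_update_smul]
  cont := by
    refine α.cont.comp (continuous_pi fun a => ?_)
    refine Fin.addCases (fun a => ?_) (fun a => ?_) a
    · simp only [Fin.append_left]; exact continuous_const
    · simp only [Fin.append_right]; exact continuous_apply a
  map_eq_zero_of_eq' := by
    intro v i j h hij
    refine α.map_eq_zero_of_eq (i := Fin.natAdd k i) (j := Fin.natAdd k j) _ ?_ ?_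
    · simpa using h
    · exact fun h => hij (Fin.natAdd_injective l k h)

end Pointwise

/-! ### Differential forms on complex manifolds

A complex manifold is a manifold modelled on a complex normed space `E` (with holomorphic changes
of charts); `I` is the model with corners of the underlying real manifold, which has no boundary.
`TangentSpace I x` is by definition `E`, the identification being given by the preferred chart at
`x`; since changes of charts are holomorphic, the complex structure of the tangent space is
multiplication by `i` on `E`. -/

section Manifold

variable {E : Type*} [NormedAddCommGroup E] [NormedSpace ℝ E]
  {H : Type*} [TopologicalSpace H] (I : ModelWithCorners ℝ E H)
  {M : Type*} [TopologicalSpace M] [ChartedSpace H M]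

/-- Complex valued `k`-forms (not necessarily continuous) on a manifold `M` modelled on `E`: an
alternating `ℝ`-multilinear form on each tangent space `TangentSpace I x = E`. -/
abbrev CForm (E : Type*) [NormedAddCommGroup E] [NormedSpace ℝ E] (M : Type*) (k : ℕ) :=
  M → E [⋀^Fin k]→L[ℝ] ℂ

/-- The pullback of a form under a map `σ : E' → M` from a normed space, for instance a
parametrization (the inverse of a chart): this is the form written in coordinates. -/
def inCoords {E' : Type*} [NormedAddCommGroup E'] [NormedSpace ℝ E'] {k : ℕ}
    (α : CForm E M k) (σ : E' → M) (y : E') : E' [⋀^Fin k]→L[ℝ] ℂ :=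
  (α (σ y)).compContinuousLinearMap (mfderiv 𝓘(ℝ, E') I σ y : E' →L[ℝ] E)

/-- The pullback of a form along a map of manifolds. -/
def pullback {E' : Type*} [NormedAddCommGroup E'] [NormedSpace ℝ E']
    {H' : Type*} [TopologicalSpace H'] (I' : ModelWithCorners ℝ E' H')
    {N : Type*} [TopologicalSpace N] [ChartedSpace H' N] {k : ℕ}
    (F : N → M) (α : CForm E M k) : CForm E' N k :=
  fun x => (α (F x)).compContinuousLinearMap (mfderiv I' I F x : E' →L[ℝ] E)

/-- The complex conjugate of a form. -/
def conjForm {k : ℕ} (α : CForm E M k) : CForm E M k :=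
  fun x => (Complex.conjCLE : ℂ →L[ℝ] ℂ).compContinuousAlternatingMap (α x)

/-- Smoothness of a form: its expressions in the charts are smooth. -/
def IsSmooth {k : ℕ} (α : CForm E M k) : Prop :=
  ∀ x₀ : M, ContDiffOn ℝ ∞ (inCoords I α (extChartAt I x₀).symm) (extChartAt I x₀).target

/-- The exterior derivative, computed at `x` in the chart at `x`. -/
def extD {k : ℕ} (α : CForm E M k) : CForm E M (k + 1) :=
  fun x => (extDeriv (inCoords I α (extChartAt I x).symm) (extChartAt I x x)).compContinuousLinearMap
    (mfderiv I 𝓘(ℝ, E) (extChartAt I x) x : E →L[ℝ] E)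

variable [NormedSpace ℂ E] [IsScalarTower ℝ ℂ E]

/-- Multiplication by a complex number, as an `ℝ`-linear map. -/
def cmul (E : Type*) [NormedAddCommGroup E] [NormedSpace ℝ E] [NormedSpace ℂ E]
    [IsScalarTower ℝ ℂ E] (c : ℂ) : E →L[ℝ] E :=
  c • ContinuousLinearMap.id ℝ E

/-- Forms of type `(p, q)`: `α (c v₁, …, c v_k) = c ^ p * conj c ^ q * α (v₁, …, v_k)` for all
`c : ℂ`. For `p + q = k` these are exactly the forms that are combinations of
`dz^A ∧ dz̄^B` with `|A| = p` and `|B| = q`. -/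
def IsOfType {k : ℕ} (p q : ℕ) (α : CForm E M k) : Prop :=
  ∀ (x : M) (c : ℂ) (v : Fin k → E), α x (fun i => c • v i) = c ^ p * conj c ^ q * α x v

/-- Holomorphic `k`-forms: forms of type `(k, 0)` whose expressions in the charts are
holomorphic. -/
def IsHolomorphicForm {k : ℕ} (α : CForm E M k) : Prop :=
  IsOfType k 0 α ∧
  ∀ x₀ : M, DifferentiableOn ℂ (inCoords I α (extChartAt I x₀).symm) (extChartAt I x₀).target

/-- The conjugate linear part `v ↦ (L v + i L (i v)) / 2` of an `ℝ`-linear map `L`. -/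
def antilinearPart {G : Type*} [NormedAddCommGroup G] [NormedSpace ℝ G] [NormedSpace ℂ G]
    [IsScalarTower ℝ ℂ G] (L : E →L[ℝ] G) : E →L[ℝ] G :=
  (2⁻¹ : ℂ) • (L + Complex.I • L.comp (cmul E Complex.I))

/-- The operator `∂̄`: the exterior derivative in which the derivatives of the coefficients are
replaced by their conjugate linear parts, i.e.
`∂̄ (f dz^A ∧ dz̄^B) = ∑ j, (∂f/∂z̄ʲ) dz̄ʲ ∧ dz^A ∧ dz̄^B`. -/
def dbar {k : ℕ} (α : CForm E M k) : CForm E M (k + 1) :=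
  fun x => (ContinuousAlternatingMap.alternatizeUncurryFin (antilinearPart
      (fderiv ℝ (inCoords I α (extChartAt I x).symm) (extChartAt I x x)))).compContinuousLinearMap
    (mfderiv I 𝓘(ℝ, E) (extChartAt I x) x : E →L[ℝ] E)

/-! ### Hermitian metrics, the Hodge star and the Laplacian -/

/-- A Hermitian metric, given by its Riemannian metric: a smooth family of inner products on the
tangent spaces that are invariant under multiplication by `i`. -/
structure HermitianMetric (I : ModelWithCorners ℝ E H) (M : Type*) [TopologicalSpace M]
    [ChartedSpace H M] where
  /-- The inner product on the tangent space at a point. -/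
  inner : M → E →L[ℝ] E →L[ℝ] ℝ
  symm : ∀ x v w, inner x v w = inner x w v
  pos : ∀ x v, v ≠ 0 → 0 < inner x v v
  hermitian : ∀ x v w, inner x (Complex.I • v) (Complex.I • w) = inner x v w
  smooth : ∀ x₀ : M, ContDiffOn ℝ ∞
    (fun y : E => (inner ((extChartAt I x₀).symm y)).bilinearComp
      (mfderiv 𝓘(ℝ, E) I (extChartAt I x₀).symm y : E →L[ℝ] E)
      (mfderiv 𝓘(ℝ, E) I (extChartAt I x₀).symm y : E →L[ℝ] E))
    (extChartAt I x₀).target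

theorem exists_unitary_aux {V : Type*} [AddCommGroup V] [Module ℂ V] [FiniteDimensional ℂ V]
    (g : V → V → ℝ) (add : ∀ u v w, g (u + v) w = g u w + g v w)
    (smul : ∀ (c : ℝ) v w, g ((c : ℂ) • v) w = c * g v w)
    (symm : ∀ v w, g v w = g w v) (pos : ∀ v, v ≠ 0 → 0 < g v v)
    (herm : ∀ v w, g (Complex.I • v) (Complex.I • w) = g v w) :
    ∃ u : Fin (finrank ℂ V) → V, ∀ a b,
      g (u a) (u b) = (if a = b then 1 else 0) ∧ g (Complex.I • u a) (u b) = 0 := by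
  have smul_I : ∀ v w, g (Complex.I • v) w = -g v (Complex.I • w) := by
    intro v w
    have h := herm v (Complex.I • w)
    have h2 : Complex.I • Complex.I • w = ((-1 : ℝ) : ℂ) • w := by
      rw [smul_smul, Complex.I_mul_I]; simp
    rw [h2, symm, smul, symm w] at h
    linarith
  have gsmul : ∀ (c : ℂ) v w, g (c • v) w = c.re * g v w + c.im * g (Complex.I • v) w := by
    intro c v w
    have h : c • v = (c.re : ℂ) • v + (c.im : ℂ) • Complex.I • v := by
      rw [smul_smul, ← add_smul, Complex.re_add_im]
    rw [h, add, smul, smul]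
  have gII : ∀ v w, g (Complex.I • Complex.I • v) w = -g v w := by
    intro v w
    have h := smul (-1) v w
    have h2 : Complex.I • Complex.I • v = ((-1 : ℝ) : ℂ) • v := by
      rw [smul_smul, Complex.I_mul_I]; simp
    rw [h2, h]; ring
  let core : InnerProductSpace.Core ℂ V :=
    { inner := fun v w => (g v w : ℂ) + Complex.I * (g (Complex.I • v) w : ℂ)
      conj_inner_symm := by
        intro v w
        apply Complex.ext
        · simp [symm v w]
        · simp only [map_add, map_mul, Complex.conj_ofReal, Complex.conj_I]
          simp [smul_I w v, symm w]
      re_inner_nonneg := by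
        intro v
        by_cases hv : v = 0
        · subst hv
          have h0 := smul 0 (0 : V) 0
          simp at h0
          simp [h0]
        · simpa using (pos v hv).le
      add_left := by
        intro u v w
        simp only [smul_add, add]
        push_cast
        ring
      smul_left := by
        intro v w c
        rw [smul_comm Complex.I c v, gsmul c v w, gsmul c (Complex.I • v) w, gII]
        apply Complex.ext
        · simp
        · simp
      definite := by
        intro v h
        by_contra hv
        have h1 := congrArg Complex.re h
        have h2 := pos v hv
        simp at h1
        linarith }
  let _ := core.toNormedAddCommGroup
  let _ : InnerProductSpace ℂ V := InnerProductSpace.ofCore core.toCore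
  let b := stdOrthonormalBasis ℂ V
  refine ⟨b, fun a a' => ?_⟩
  have h : (g (b a) (b a') : ℂ) + Complex.I * (g (Complex.I • b a) (b a') : ℂ)
      = if a = a' then 1 else 0 := orthonormal_iff_ite.mp b.orthonormal a a'
  have h1 := congrArg Complex.re h
  have h2 := congrArg Complex.im h
  constructor
  · split_ifs at h1 ⊢ with hc <;> simpa using h1
  · split_ifs at h2 <;> simpa using h2

namespace HermitianMetric

variable {I} (g : HermitianMetric I M)

/-- `u` is a unitary frame of the tangent space at `x`. -/
def IsUnitaryFrame (x : M) (u : Fin (finrank ℂ E) → E) : Prop :=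
  ∀ a b, g.inner x (u a) (u b) = (if a = b then 1 else 0) ∧
    g.inner x (Complex.I • u a) (u b) = 0

theorem exists_unitaryFrame [FiniteDimensional ℂ E] (x : M) : ∃ u, g.IsUnitaryFrame x u := by
  refine exists_unitary_aux (fun v w => g.inner x v w) ?_ ?_ (g.symm x) (g.pos x) (g.hermitian x)
  · intro u v w; simp
  · intro c v w
    have h : ((c : ℂ) • v : E) = c • v := algebraMap_smul ℂ c v
    simp [h]

variable [FiniteDimensional ℂ E]

/-- A unitary frame of the tangent space at `x`. -/
def unitaryFrame (x : M) : Fin (finrank ℂ E) → E := (g.exists_unitaryFrame x).choose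

/-- The real orthonormal basis `u₁, i u₁, u₂, i u₂, …`, positively oriented for the orientation
given by the complex structure. -/
def realFrame (x : M) (a : Fin (finrank ℂ E * 2)) : E :=
  if (finProdFinEquiv.symm a).2 = 0 then g.unitaryFrame x (finProdFinEquiv.symm a).1
  else Complex.I • g.unitaryFrame x (finProdFinEquiv.symm a).1

/-- The Riemannian volume form, the wedge product of the basis dual to the real frame. -/
def volForm {m : ℕ} (h : m = finrank ℂ E * 2) : CForm E M m :=
  fun x => covectorWedge fun i => Complex.ofRealCLM.comp (g.inner x (g.realFrame x (Fin.cast h i)))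

/-- The (conjugate linear) Hodge star: with `e₁, e₂, …` the oriented orthonormal frame,
`(⋆α)(v) = (1 / k!) ∑_{i₁, …, i_k} conj (α (e_{i₁}, …, e_{i_k})) vol (e_{i₁}, …, e_{i_k}, v)`,
so that `β ∧ ⋆α = ⟨β, α⟩ vol`. It does not depend on the frame. -/
def hodgeStar {k l : ℕ} (h : k + l = finrank ℂ E * 2) (α : CForm E M k) : CForm E M l :=
  fun x => ((k ! : ℕ) : ℂ)⁻¹ • ∑ a : Fin k → Fin (finrank ℂ E * 2),
    conj (α x fun i => g.realFrame x (a i)) •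
      contract (fun i => g.realFrame x (a i)) (g.volForm h x)

/-- The codifferential `δ = -⋆d⋆` (the real dimension is even). -/
def codiff {k l : ℕ} (h : k + 1 + l = finrank ℂ E * 2) (α : CForm E M (k + 1)) : CForm E M k :=
  -g.hodgeStar (k := l + 1) (l := k) (by omega) (extD I (g.hodgeStar h α))

/-- The Laplacian `Δ = dδ + δd` on forms of degree `k + 1`, where `0 < k + 1 < dim_ℝ M`. -/
def laplacian {k l : ℕ} (h : k + 2 + l = finrank ℂ E * 2) (α : CForm E M (k + 1)) :
    CForm E M (k + 1) :=
  extD I (g.codiff (k := k) (l := l + 1) (by omega) α) +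
    g.codiff (k := k + 1) (l := l) h (extD I α)

end HermitianMetric

/-- `g` is the product of the Hermitian metrics `g₁` and `g₂`. -/
def IsProductMetric {E₁ : Type*} [NormedAddCommGroup E₁] [NormedSpace ℝ E₁] [NormedSpace ℂ E₁]
    [IsScalarTower ℝ ℂ E₁] {H₁ : Type*} [TopologicalSpace H₁] {I₁ : ModelWithCorners ℝ E₁ H₁}
    {M₁ : Type*} [TopologicalSpace M₁] [ChartedSpace H₁ M₁]
    {E₂ : Type*} [NormedAddCommGroup E₂] [NormedSpace ℝ E₂] [NormedSpace ℂ E₂]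
    [IsScalarTower ℝ ℂ E₂] {H₂ : Type*} [TopologicalSpace H₂] {I₂ : ModelWithCorners ℝ E₂ H₂}
    {M₂ : Type*} [TopologicalSpace M₂] [ChartedSpace H₂ M₂]
    (g₁ : HermitianMetric I₁ M₁) (g₂ : HermitianMetric I₂ M₂)
    (g : HermitianMetric (I₁.prod I₂) (M₁ × M₂)) : Prop :=
  ∀ (p : M₁ × M₂) (v w : E₁ × E₂),
    g.inner p v w = g₁.inner p.1 v.1 w.1 + g₂.inner p.2 v.2 w.2

/-! ### de Rham and Dolbeault cohomology -/

section Cohomology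

set_option linter.unusedSectionVars false

variable {I}

theorem IsSmooth.add {k : ℕ} {α β : CForm E M k} (hα : IsSmooth I α) (hβ : IsSmooth I β) :
    IsSmooth I (α + β) := fun x => (hα x).add (hβ x)

theorem IsSmooth.smul {k : ℕ} {α : CForm E M k} (c : ℂ) (hα : IsSmooth I α) :
    IsSmooth I (c • α) := fun x => (hα x).const_smul c

theorem IsSmooth.zero {k : ℕ} : IsSmooth I (0 : CForm E M k) := fun _ =>
  (contDiffOn_const (c := (0 : E [⋀^Fin k]→L[ℝ] ℂ))).congr fun _ _ => rfl

theorem IsOfType.add {k p q : ℕ} {α β : CForm E M k} (hα : IsOfType p q α)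
    (hβ : IsOfType p q β) : IsOfType p q (α + β) := fun x c v => by
  simp [hα x c v, hβ x c v, mul_add]

theorem IsOfType.smul {k p q : ℕ} {α : CForm E M k} (c : ℂ) (hα : IsOfType p q α) :
    IsOfType p q (c • α) := fun x d v => by
  simp [hα x d v, mul_left_comm]

theorem IsOfType.zero {k p q : ℕ} : IsOfType p q (0 : CForm E M k) := fun x c v => by simp

theorem smul_zero_form {k : ℕ} (c : ℂ) : c • (0 : CForm E M k) = 0 := by
  funext x
  ext v
  simp

theorem zero_smul_form {k : ℕ} (α : CForm E M k) : (0 : ℂ) • α = 0 := by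
  funext x
  ext v
  simp

theorem fderiv_smul_form {k : ℕ} (c : ℂ) (α : CForm E M k) (x : M) :
    fderiv ℝ (inCoords I (c • α) (extChartAt I x).symm) (extChartAt I x x)
      = c • fderiv ℝ (inCoords I α (extChartAt I x).symm) (extChartAt I x x) :=
  congrFun (fderiv_const_smul_field (𝕜 := ℝ) (f := inCoords I α (extChartAt I x).symm) c) _

theorem alternatize_smul {k : ℕ} (c : ℂ) (L : E →L[ℝ] E [⋀^Fin k]→L[ℝ] ℂ) (D : E →L[ℝ] E) :
    (ContinuousAlternatingMap.alternatizeUncurryFin (c • L)).compContinuousLinearMap D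
      = c • (ContinuousAlternatingMap.alternatizeUncurryFin L).compContinuousLinearMap D := by
  ext v
  simp [ContinuousAlternatingMap.alternatizeUncurryFin_apply, Finset.mul_sum]

theorem alternatize_add {k : ℕ} (L L' : E →L[ℝ] E [⋀^Fin k]→L[ℝ] ℂ) (D : E →L[ℝ] E) :
    (ContinuousAlternatingMap.alternatizeUncurryFin (L + L')).compContinuousLinearMap D
      = (ContinuousAlternatingMap.alternatizeUncurryFin L).compContinuousLinearMap D
        + (ContinuousAlternatingMap.alternatizeUncurryFin L').compContinuousLinearMap D := by
  ext v
  simp [ContinuousAlternatingMap.alternatizeUncurryFin_add]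

theorem antilinearPart_smul {k : ℕ} (c : ℂ) (L : E →L[ℝ] E [⋀^Fin k]→L[ℝ] ℂ) :
    antilinearPart (c • L) = c • antilinearPart L := by
  ext v w
  simp [antilinearPart]
  ring

theorem antilinearPart_add {k : ℕ} (L L' : E →L[ℝ] E [⋀^Fin k]→L[ℝ] ℂ) :
    antilinearPart (L + L') = antilinearPart L + antilinearPart L' := by
  ext v w
  simp [antilinearPart]
  ring

theorem extD_smul {k : ℕ} (c : ℂ) (α : CForm E M k) : extD I (c • α) = c • extD I α := by
  funext x
  simp only [extD, extDeriv, fderiv_smul_form, Pi.smul_apply]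
  exact alternatize_smul c _ _

theorem dbar_smul {k : ℕ} (c : ℂ) (α : CForm E M k) : dbar I (c • α) = c • dbar I α := by
  funext x
  simp only [dbar, fderiv_smul_form, Pi.smul_apply, antilinearPart_smul]
  exact alternatize_smul c _ _

theorem extD_zero {k : ℕ} : extD I (0 : CForm E M k) = 0 := by
  have h := extD_smul (I := I) 0 (0 : CForm E M k)
  rwa [zero_smul_form, zero_smul_form] at h

theorem dbar_zero {k : ℕ} : dbar I (0 : CForm E M k) = 0 := by
  have h := dbar_smul (I := I) 0 (0 : CForm E M k)
  rwa [zero_smul_form, zero_smul_form] at h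

variable [I.Boundaryless]

theorem IsSmooth.fderiv_add {k : ℕ} {α β : CForm E M k} (hα : IsSmooth I α)
    (hβ : IsSmooth I β) (x : M) :
    fderiv ℝ (inCoords I (α + β) (extChartAt I x).symm) (extChartAt I x x)
      = fderiv ℝ (inCoords I α (extChartAt I x).symm) (extChartAt I x x)
        + fderiv ℝ (inCoords I β (extChartAt I x).symm) (extChartAt I x x) :=
  _root_.fderiv_add
    (((hα x).contDiffAt (extChartAt_target_mem_nhds x)).differentiableAt (by simp))
    (((hβ x).contDiffAt (extChartAt_target_mem_nhds x)).differentiableAt (by simp))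

theorem IsSmooth.extD_add {k : ℕ} {α β : CForm E M k} (hα : IsSmooth I α) (hβ : IsSmooth I β) :
    extD I (α + β) = extD I α + extD I β := by
  funext x
  simp only [extD, extDeriv, hα.fderiv_add hβ x, Pi.add_apply]
  exact alternatize_add _ _ _

theorem IsSmooth.dbar_add {k : ℕ} {α β : CForm E M k} (hα : IsSmooth I α) (hβ : IsSmooth I β) :
    dbar I (α + β) = dbar I α + dbar I β := by
  funext x
  simp only [dbar, hα.fderiv_add hβ x, Pi.add_apply, antilinearPart_add]
  exact alternatize_add _ _ _

variable (I M)

/-- Closed smooth complex valued `k`-forms. -/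
def closedForms (k : ℕ) : Submodule ℂ (CForm E M k) where
  carrier := {α | IsSmooth I α ∧ extD I α = 0}
  add_mem' := fun ha hb => ⟨ha.1.add hb.1, by rw [ha.1.extD_add hb.1, ha.2, hb.2, add_zero]⟩
  zero_mem' := ⟨.zero, extD_zero⟩
  smul_mem' := fun c _ ha => ⟨ha.1.smul c, by rw [extD_smul, ha.2, smul_zero_form]⟩

/-- Exact smooth complex valued forms of degree `k + 1`. -/
def exactForms (k : ℕ) : Submodule ℂ (CForm E M (k + 1)) where
  carrier := {α | ∃ β : CForm E M k, IsSmooth I β ∧ extD I β = α}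
  add_mem' := by
    rintro _ _ ⟨β, hβ, rfl⟩ ⟨γ, hγ, rfl⟩
    exact ⟨β + γ, hβ.add hγ, hβ.extD_add hγ⟩
  zero_mem' := ⟨0, .zero, extD_zero⟩
  smul_mem' := by
    rintro c _ ⟨β, hβ, rfl⟩
    exact ⟨c • β, hβ.smul c, extD_smul c β⟩

/-- de Rham cohomology `H^{k+1}(M, ℂ)`: the space of classes of closed forms modulo exact forms. -/
def DeRham (k : ℕ) : Submodule ℂ (CForm E M (k + 1) ⧸ exactForms I M k) :=
  (closedForms I M (k + 1)).map (exactForms I M k).mkQ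

/-- The cohomology class of a closed form. -/
def DeRham.mk {k : ℕ} (α : closedForms I M (k + 1)) : DeRham I M k :=
  ⟨(exactForms I M k).mkQ α.1, Submodule.mem_map_of_mem α.2⟩

/-- `∂̄`-closed smooth forms of type `(p, q)`. -/
def dbarClosedForms (p q : ℕ) : Submodule ℂ (CForm E M (p + q)) where
  carrier := {α | IsSmooth I α ∧ IsOfType p q α ∧ dbar I α = 0}
  add_mem' := fun ha hb => ⟨ha.1.add hb.1, ha.2.1.add hb.2.1,
    by rw [ha.1.dbar_add hb.1, ha.2.2, hb.2.2, add_zero]⟩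
  zero_mem' := ⟨.zero, .zero, dbar_zero⟩
  smul_mem' := fun c _ ha => ⟨ha.1.smul c, ha.2.1.smul c, by rw [dbar_smul, ha.2.2, smul_zero_form]⟩

/-- Forms `∂̄β` with `β` smooth of type `(p, q)`. -/
def dbarExactForms (p q : ℕ) : Submodule ℂ (CForm E M (p + (q + 1))) where
  carrier := {α | ∃ β : CForm E M (p + q), IsSmooth I β ∧ IsOfType p q β ∧ dbar I β = α}
  add_mem' := by
    rintro _ _ ⟨β, hβ, hβ', rfl⟩ ⟨γ, hγ, hγ', rfl⟩
    exact ⟨β + γ, hβ.add hγ, hβ'.add hγ', hβ.dbar_add hγ⟩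
  zero_mem' := ⟨0, .zero, .zero, dbar_zero⟩
  smul_mem' := by
    rintro c _ ⟨β, hβ, hβ', rfl⟩
    exact ⟨c • β, hβ.smul c, hβ'.smul c, dbar_smul c β⟩

/-- Dolbeault cohomology `H^{p,q+1}(M)`: the space of classes of `∂̄`-closed forms of type
`(p, q + 1)` modulo the forms `∂̄β` with `β` of type `(p, q)`. -/
def Dolbeault (p q : ℕ) : Submodule ℂ (CForm E M (p + (q + 1)) ⧸ dbarExactForms I M p q) :=
  (dbarClosedForms I M p (q + 1)).map (dbarExactForms I M p q).mkQ

/-- The Dolbeault class of a `∂̄`-closed form. -/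
def Dolbeault.mk {p q : ℕ} (α : dbarClosedForms I M p (q + 1)) : Dolbeault I M p q :=
  ⟨(dbarExactForms I M p q).mkQ α.1, Submodule.mem_map_of_mem α.2⟩

end Cohomology

end Manifold

/-! ### K3 surfaces -/

/-- The model space of complex surfaces. -/
abbrev C2 := EuclideanSpace ℂ (Fin 2)

/-- Nowhere vanishing holomorphic 2-forms on a complex surface. -/
def IsNowhereVanishingHolomorphic {S : Type*} [TopologicalSpace S] [ChartedSpace C2 S]
    (α : CForm C2 S 2) : Prop :=
  IsHolomorphicForm 𝓘(ℝ, C2) α ∧ ∀ x, α x ≠ 0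

/-- K3 surfaces: compact simply connected complex surfaces with a nowhere vanishing holomorphic
2-form. -/
structure IsK3Surface (S : Type*) [TopologicalSpace S] [ChartedSpace C2 S] : Prop where
  isManifold : IsManifold 𝓘(ℂ, C2) ω S
  t2 : T2Space S
  compact : CompactSpace S
  simplyConnected : SimplyConnectedSpace S
  exists_form : ∃ α : CForm C2 S 2, IsNowhereVanishingHolomorphic α

/-- The real manifold underlying a product of complex surfaces. -/
abbrev prodModel : ModelWithCorners ℝ (C2 × C2) (ModelProd C2 C2) := 𝓘(ℝ, C2).prod 𝓘(ℝ, C2)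

/-- The form `pr₁^* α ∧ conj (pr₂^* β)` on a product of complex surfaces. -/
def prodForm {S₁ S₂ : Type*} [TopologicalSpace S₁] [ChartedSpace C2 S₁]
    [TopologicalSpace S₂] [ChartedSpace C2 S₂] (α : CForm C2 S₁ 2) (β : CForm C2 S₂ 2) :
    CForm (C2 × C2) (S₁ × S₂) 4 :=
  fun p => wedge (pullback 𝓘(ℝ, C2) prodModel Prod.fst α p)
    (conjForm (pullback 𝓘(ℝ, C2) prodModel Prod.snd β) p)

/-- The differentials `dz¹, dz²` of the coordinates of `ℂ²`. -/
def dz (a : Fin 2) : C2 →L[ℝ] ℂ := (EuclideanSpace.proj a : C2 →L[ℂ] ℂ).restrictScalars ℝ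

/-- The form `dz¹ ∧ dz²` on `ℂ²`. -/
def dz12 : C2 [⋀^Fin 2]→L[ℝ] ℂ := covectorWedge ![dz 0, dz 1]

/-- The form `dz¹ ∧ dz² ∧ dz̄³ ∧ dz̄⁴` on `ℂ² × ℂ²`, where `z¹, z²` are the coordinates of the
first factor and `z³, z⁴` those of the second one. -/
def dz12bar34 : (C2 × C2) [⋀^Fin 4]→L[ℝ] ℂ :=
  covectorWedge ![(dz 0).comp (ContinuousLinearMap.fst ℝ C2 C2),
    (dz 1).comp (ContinuousLinearMap.fst ℝ C2 C2),
    (Complex.conjCLE : ℂ →L[ℝ] ℂ).comp ((dz 0).comp (ContinuousLinearMap.snd ℝ C2 C2)),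
    (Complex.conjCLE : ℂ →L[ℝ] ℂ).comp ((dz 1).comp (ContinuousLinearMap.snd ℝ C2 C2))]

theorem real_dim_prod : 3 + 2 + 3 = finrank ℂ (C2 × C2) * 2 := by
  simp

end KForms

end

open KForms

/-!
Write `λ₁ = f₁ dz¹ ∧ dz²` and `λ₂ = f₂ dz³ ∧ dz⁴` in local coordinates, so that
`ψ = f₁ f̄₂ dz¹ ∧ dz² ∧ dz̄³ ∧ dz̄⁴` (`inCoords_prodForm`). The `fᵢ` are holomorphic in every
holomorphic chart (`differentiableOn_localCoeff`) and hence smooth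
(`contDiffOn_of_differentiableOn`), which gives smoothness and the type of `ψ`. The form is `d`-closed
and `∂̄`-closed because `d (f₁ f̄₂)` is a combination of `dz¹, dz², dz̄³, dz̄⁴`
(`alternatize_smulRight_dz12bar34`, `extD_prodForm`, `dbar_prodForm`).

*Harmonicity.* At a point, `ψ` is a multiple of `τ₁ ∧ τ₂ ∧ τ̄₃ ∧ τ̄₄`, where `τ₁, …, τ₄` is a unitary
coframe adapted to the product. In terms of the covectors `τ_k` and `τ̄_k` the Hodge star is the
evaluation of a determinant, and `⋆ψ = κ ψ̄` with a constant `κ` that depends only on the dimension and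
on which covectors are conjugated (`HermitianMetric.hodgeStar_apply_eq_smul_conj`). The point here
is that two unitary coframes differ by a unitary matrix `U`, and the real volume form only sees
`|det U|² = 1` (`HermitianMetric.det_coframe`). Hence `⋆ψ` is closed together with `ψ`, and
`Δψ = 0` (`laplacian_prodForm`).

*Non-exactness.* If `ψ = dγ`, then `∫ ψ ∧ ψ̄ = ∫ d (γ ∧ ψ̄) = 0`, whereas `ψ ∧ ψ̄` has the positive
density `|f₁|² |f₂|²`, up to a constant. To avoid a general theory of integration of forms, a 4-form is
replaced by the function `u` with `dγ ∧ ψ̄ = u ψ ∧ ψ̄` (`formRatio`), which is integrated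
against this density chart by chart with a partition of unity. The change of variables formula shows
that the integrals do not depend on the chart (`chartIntegral_eq`), Stokes' theorem for compactly
supported forms on a vector space that they vanish for `dγ` with `γ` supported in a chart
(`chartIntegral_formRatio_extD`), and positivity that `u = 1` is impossible
(`not_sum_eq_one_of_chartIntegral_eq_zero`). The same argument applies to `ψ = ∂̄γ` with `γ` of type
`(2, 1)`: `dγ` and `∂̄γ` differ by a form of type `(3, 1)`, whose product with `ψ̄` vanishes
(`mixedCoeff_extD_eq_dbar`).
-/

noncomputable section

namespace KForms

/-! ### Holomorphic functions of several variables are smooth -/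

section Holomorphic

open Metric Set MeasureTheory Topology

variable {V : Type*} [NormedAddCommGroup V] [NormedSpace ℂ V] [FiniteDimensional ℂ V]

/-- A directional derivative of a holomorphic function is holomorphic: on each line it is given by
Cauchy's integral formula, which may be differentiated under the integral sign. -/
theorem differentiableOn_fderiv_apply {f : V → ℂ} {U : Set V} (hU : IsOpen U)
    (hf : DifferentiableOn ℂ f U) (v : V) :
    DifferentiableOn ℂ (fun z => fderiv ℂ f z v) U := by
  intro z₀ hz₀
  apply DifferentiableAt.differentiableWithinAt
  obtain ⟨R, hR, hRU, hRf⟩ : ∃ R > 0, ball z₀ (3 * R) ⊆ U ∧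
      ∀ z ∈ ball z₀ (3 * R), dist (f z) (f z₀) < 1 := by
    have hc : ∀ᶠ z in 𝓝 z₀, z ∈ U ∧ dist (f z) (f z₀) < 1 :=
      (hU.eventually_mem hz₀).and
        ((hf.differentiableAt (hU.mem_nhds hz₀)).continuousAt.eventually (ball_mem_nhds _ one_pos))
    obtain ⟨ε, hε, h⟩ := Metric.mem_nhds_iff.mp hc
    refine ⟨ε / 3, by positivity, fun z hz => (h ?_).1, fun z hz => (h ?_).2⟩ <;>
    · rwa [mul_div_cancel₀ _ (by norm_num : (3 : ℝ) ≠ 0)] at hz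
  set r : ℝ := R / (‖v‖ + 1) with hr
  have hr0 : 0 < r := by positivity
  have hrv : r * ‖v‖ ≤ R := by
    rw [hr, div_mul_eq_mul_div, div_le_iff₀ (by positivity)]
    nlinarith [norm_nonneg v]
  have hmem : ∀ z ∈ ball z₀ R, ∀ ζ : ℂ, ‖ζ‖ ≤ r → z + ζ • v ∈ ball z₀ (2 * R) := by
    intro z hz ζ hζ
    rw [mem_ball, dist_eq_norm] at hz ⊢
    calc ‖z + ζ • v - z₀‖ = ‖(z - z₀) + ζ • v‖ := by congr 1; abel
      _ ≤ ‖z - z₀‖ + ‖ζ‖ * ‖v‖ := (norm_add_le _ _).trans_eq (by rw [norm_smul])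
      _ < R + R := add_lt_add_of_lt_of_le hz
          ((mul_le_mul_of_nonneg_right hζ (norm_nonneg _)).trans hrv)
      _ = 2 * R := by ring
  have h23 : ball z₀ (2 * R) ⊆ ball z₀ (3 * R) := ball_subset_ball (by linarith)
  have hdiff : ∀ z ∈ ball z₀ (2 * R), DifferentiableAt ℂ f z := fun z hz =>
    hf.differentiableAt (hU.mem_nhds (hRU (h23 hz)))
  have hbound : ∀ w ∈ ball z₀ (2 * R), ‖fderiv ℂ f w‖ ≤ 2 / R := by
    intro w hw
    have hsub : ball w R ⊆ ball z₀ (3 * R) := by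
      refine ball_subset_ball' ?_
      rw [mem_ball] at hw
      linarith
    refine Complex.norm_fderiv_le_div_of_mapsTo_ball (hf.mono (hsub.trans hRU)) (fun u hu => ?_) hR
    have h1 := hRf u (hsub hu)
    have h2 := hRf w (h23 hw)
    rw [mem_closedBall]
    calc dist (f u) (f w) ≤ dist (f u) (f z₀) + dist (f w) (f z₀) := dist_triangle_right _ _ _
      _ ≤ 2 := by linarith
  have hnorm : ∀ θ : ℝ, ‖circleMap 0 r θ‖ ≤ r := fun θ => by simp [abs_of_pos hr0]
  -- Cauchy's formula on the line through `z` in direction `v`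
  have hcauchy : ∀ z ∈ ball z₀ R, fderiv ℂ f z v = (2 * Real.pi * Complex.I : ℂ)⁻¹ •
      ∫ θ in (0 : ℝ)..2 * Real.pi, (deriv (circleMap 0 r) θ * ((circleMap 0 r θ - 0) ^ 2)⁻¹) •
        f (z + circleMap 0 r θ • v) := by
    intro z hz
    have hline : ∀ ζ : ℂ, HasFDerivAt (fun ζ : ℂ => z + ζ • v)
        (ContinuousLinearMap.toSpanSingleton ℂ v) ζ := fun ζ =>
      ((ContinuousLinearMap.toSpanSingleton ℂ v).hasFDerivAt).const_add z
    have hopen : IsOpen ((fun ζ : ℂ => z + ζ • v) ⁻¹' ball z₀ (2 * R)) :=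
      isOpen_ball.preimage (by fun_prop)
    have h := Complex.two_pi_I_inv_smul_circleIntegral_sub_sq_inv_smul_of_differentiable
      (f := fun ζ : ℂ => f (z + ζ • v)) hopen (c := 0) (w₀ := 0) (R := r)
      (fun ζ hζ => hmem z hz ζ (by simpa using hζ))
      (fun ζ hζ => ((hdiff _ hζ).comp ζ (hline ζ).differentiableAt).differentiableWithinAt)
      (mem_ball_self hr0)
    have hd : deriv (fun ζ : ℂ => f (z + ζ • v)) 0 = fderiv ℂ f z v := by
      have h0 : HasFDerivAt f (fderiv ℂ f z) (z + (0 : ℂ) • v) := by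
        rw [zero_smul, add_zero]
        exact (hdiff z (by simpa using hmem z hz 0 (by simpa using hr0.le))).hasFDerivAt
      have := (h0.comp (0 : ℂ) (hline 0)).hasDerivAt.deriv
      simpa [Function.comp_def] using this
    rw [← hd, ← h, circleIntegral]
    simp only [smul_eq_mul, mul_assoc]
  let _ : MeasurableSpace V := borel V
  have _ : BorelSpace V := ⟨rfl⟩
  have hcont : Continuous fun θ : ℝ =>
      deriv (circleMap 0 r) θ * ((circleMap 0 r θ - 0) ^ 2)⁻¹ := by
    simp only [deriv_circleMap]
    refine (by fun_prop : Continuous fun θ : ℝ => circleMap 0 r θ * Complex.I).mul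
      (Continuous.inv₀ (by fun_prop) fun θ => ?_)
    simpa using hr0.ne'
  have hFc : ∀ z ∈ ball z₀ R, Continuous fun θ : ℝ =>
      (deriv (circleMap 0 r) θ * ((circleMap 0 r θ - 0) ^ 2)⁻¹) •
        f (z + circleMap 0 r θ • v) := by
    intro z hz
    refine hcont.smul (continuous_iff_continuousAt.mpr fun θ => ?_)
    exact ContinuousAt.comp (g := f) (hdiff _ (hmem z hz _ (hnorm θ))).continuousAt
      (by fun_prop : Continuous fun θ : ℝ => z + circleMap 0 r θ • v).continuousAt
  have key := intervalIntegral.hasFDerivAt_integral_of_dominated_of_fderiv_le (𝕜 := ℂ)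
    (μ := volume) (a := 0) (b := 2 * Real.pi) (x₀ := z₀) (s := ball z₀ R)
    (F := fun z θ => (deriv (circleMap 0 r) θ * ((circleMap 0 r θ - 0) ^ 2)⁻¹) •
        f (z + circleMap 0 r θ • v))
    (F' := fun z θ => (deriv (circleMap 0 r) θ * ((circleMap 0 r θ - 0) ^ 2)⁻¹) •
        fderiv ℂ f (z + circleMap 0 r θ • v))
    (bound := fun θ => ‖deriv (circleMap 0 r) θ * ((circleMap 0 r θ - 0) ^ 2)⁻¹‖ * (2 / R))
    (ball_mem_nhds _ hR)
    (Filter.eventually_of_mem (ball_mem_nhds _ hR) fun z hz =>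
      (hFc z hz).aestronglyMeasurable)
    ((hFc z₀ (mem_ball_self hR)).intervalIntegrable _ _)
    (by
      refine (hcont.measurable.smul ((measurable_fderiv ℂ f).comp ?_)).aestronglyMeasurable
      exact (by fun_prop : Continuous fun θ : ℝ => z₀ + circleMap 0 r θ • v).measurable)
    (Filter.Eventually.of_forall fun θ _ z hz => by
      rw [norm_smul]
      exact mul_le_mul_of_nonneg_left (hbound _ (hmem z hz _ (hnorm θ))) (norm_nonneg _))
    ((by fun_prop : Continuous fun θ =>
      ‖deriv (circleMap 0 r) θ * ((circleMap 0 r θ - 0) ^ 2)⁻¹‖ * (2 / R)).intervalIntegrable _ _)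
    (Filter.Eventually.of_forall fun θ _ z hz => by
      have h1 : HasFDerivAt (fun z : V => z + circleMap 0 r θ • v) (.id ℂ V) z :=
        (hasFDerivAt_id z).add_const _
      have h2 := ((hdiff _ (hmem z hz _ (hnorm θ))).hasFDerivAt).comp z h1
      rw [ContinuousLinearMap.comp_id] at h2
      exact h2.const_smul (deriv (circleMap 0 r) θ * ((circleMap 0 r θ - 0) ^ 2)⁻¹))
  refine DifferentiableAt.congr_of_eventuallyEq (key.differentiableAt.const_smul
    ((2 * Real.pi * Complex.I : ℂ)⁻¹)) ?_
  exact Filter.eventually_of_mem (ball_mem_nhds _ hR) hcauchy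

/-- A holomorphic function on an open subset of a finite dimensional space is smooth. -/
theorem contDiffOn_of_differentiableOn {f : V → ℂ} {U : Set V} (hU : IsOpen U)
    (hf : DifferentiableOn ℂ f U) : ContDiffOn ℂ ∞ f U := by
  rw [contDiffOn_infty]
  intro n
  induction n generalizing f with
  | zero => exact contDiffOn_zero.mpr hf.continuousOn
  | succ n ih =>
    rw [Nat.cast_add, Nat.cast_one, contDiffOn_succ_iff_fderiv_of_isOpen hU]
    refine ⟨hf, by simp, contDiffOn_clm_apply.mpr fun v => ih ?_⟩
    exact differentiableOn_fderiv_apply hU hf v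

end Holomorphic

/-! ### Wedge products of covectors -/

section Wedge

variable {E : Type*} [NormedAddCommGroup E] [NormedSpace ℝ E]

theorem covectorWedge_apply {k : ℕ} (θ : Fin k → E →L[ℝ] ℂ) (v : Fin k → E) :
    covectorWedge θ v = Matrix.det (Matrix.of fun i j => θ i (v j)) := rfl

/-- `θ ∧ (θ₁ ∧ … ∧ θ_k)` is the Laplace expansion of a determinant along its first row. -/
theorem alternatize_smulRight_covectorWedge {k : ℕ} (θ : E →L[ℝ] ℂ) (θs : Fin k → E →L[ℝ] ℂ) :
    ContinuousAlternatingMap.alternatizeUncurryFin (θ.smulRight (covectorWedge θs))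
      = covectorWedge (Fin.cons θ θs : Fin (k + 1) → E →L[ℝ] ℂ) := by
  ext v
  rw [ContinuousAlternatingMap.alternatizeUncurryFin_apply, covectorWedge_apply,
    Matrix.det_succ_row_zero]
  refine Finset.sum_congr rfl fun i _ => ?_
  simp only [ContinuousLinearMap.smulRight_apply, ContinuousAlternatingMap.smul_apply,
    covectorWedge_apply, Matrix.of_apply, Fin.cons_zero, smul_eq_mul, zsmul_eq_mul]
  push_cast
  rw [mul_assoc]
  rfl

theorem covectorWedge_cons_eq_zero {k : ℕ} (θs : Fin k → E →L[ℝ] ℂ) (c : Fin k → ℂ) :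
    covectorWedge (Fin.cons (∑ i, c i • θs i) θs : Fin (k + 1) → E →L[ℝ] ℂ) = 0 := by
  ext v
  rw [covectorWedge_apply]
  refine Matrix.exists_vecMul_eq_zero_iff.mp ⟨Fin.cons (-1) c, fun h => ?_, ?_⟩
  · simpa using congrFun h 0
  · funext j
    simp [Matrix.vecMul, dotProduct, Fin.sum_univ_succ]

theorem wedge_apply {k l : ℕ} (α : E [⋀^Fin k]→L[ℝ] ℂ) (β : E [⋀^Fin l]→L[ℝ] ℂ)
    (v : Fin (k + l) → E) :
    wedge α β v = ((k ! * l ! : ℕ) : ℂ)⁻¹ * ∑ σ : Equiv.Perm (Fin (k + l)),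
      (Equiv.Perm.sign σ : ℂ) * (α (fun i => v (σ (Fin.castAdd l i))) *
        β (fun j => v (σ (Fin.natAdd k j)))) := by
  simp only [wedge, ContinuousAlternatingMap.smul_apply,
    ContinuousMultilinearMap.alternatization_apply_apply, smul_eq_mul]
  congr 1
  refine Finset.sum_congr rfl fun σ _ => ?_
  simp only [Units.smul_def, zsmul_eq_mul]
  rfl

theorem wedge_comp {E' : Type*} [NormedAddCommGroup E'] [NormedSpace ℝ E'] {k l : ℕ}
    (α : E [⋀^Fin k]→L[ℝ] ℂ) (β : E [⋀^Fin l]→L[ℝ] ℂ) (L : E' →L[ℝ] E) :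
    (wedge α β).compContinuousLinearMap L
      = wedge (α.compContinuousLinearMap L) (β.compContinuousLinearMap L) := by
  ext v
  rw [wedge_apply, ContinuousAlternatingMap.compContinuousLinearMap_apply, wedge_apply]
  rfl

theorem wedge_smul_smul {k l : ℕ} (a b : ℂ) (α : E [⋀^Fin k]→L[ℝ] ℂ) (β : E [⋀^Fin l]→L[ℝ] ℂ) :
    wedge (a • α) (b • β) = (a * b) • wedge α β := by
  ext v
  rw [wedge_apply, ContinuousAlternatingMap.smul_apply, wedge_apply, smul_eq_mul]
  simp only [Finset.mul_sum]
  refine Finset.sum_congr rfl fun σ _ => ?_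
  simp only [ContinuousAlternatingMap.smul_apply, smul_eq_mul]
  ring

/-- The product of two `2 × 2` determinants has four terms; the corresponding four sums over
permutations in `α ∧ β` agree up to a relabelling of the arguments. -/
theorem wedge_covectorWedge_two (θ₀ θ₁ η₀ η₁ : E →L[ℝ] ℂ) :
    wedge (covectorWedge ![θ₀, θ₁]) (covectorWedge ![η₀, η₁])
      = covectorWedge ![θ₀, θ₁, η₀, η₁] := by
  ext v
  have hdet : ∀ θ : Fin 4 → E →L[ℝ] ℂ,
      ∑ σ : Equiv.Perm (Fin 4), (Equiv.Perm.sign σ : ℂ) *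
        (θ 0 (v (σ 0)) * θ 1 (v (σ 1)) * θ 2 (v (σ 2)) * θ 3 (v (σ 3))) = covectorWedge θ v := by
    intro θ
    rw [covectorWedge_apply, ← Matrix.det_transpose, Matrix.det_apply']
    refine Finset.sum_congr rfl fun σ _ => ?_
    simp [Fin.prod_univ_four]
  have hswap : ∀ (θ : Fin 4 → E →L[ℝ] ℂ) (i j : Fin 4), i ≠ j →
      covectorWedge (θ ∘ Equiv.swap i j) v = -covectorWedge θ v := by
    intro θ i j hij
    have h := Matrix.det_permute (Equiv.swap i j) (Matrix.of fun i j => θ i (v j))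
    rw [Equiv.Perm.sign_swap hij] at h
    rw [covectorWedge_apply, covectorWedge_apply]
    simpa [Matrix.submatrix] using h
  have h1 := hdet ![θ₀, θ₁, η₀, η₁]
  have h2 := hdet ![θ₁, θ₀, η₀, η₁]
  have h3 := hdet ![θ₀, θ₁, η₁, η₀]
  have h4 := hdet ![θ₁, θ₀, η₁, η₀]
  have e2 : ![θ₁, θ₀, η₀, η₁] = ![θ₀, θ₁, η₀, η₁] ∘ Equiv.swap 0 1 := by
    funext i; fin_cases i <;> rfl
  have e3 : ![θ₀, θ₁, η₁, η₀] = ![θ₀, θ₁, η₀, η₁] ∘ Equiv.swap 2 3 := by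
    funext i; fin_cases i <;> rfl
  have e4 : ![θ₁, θ₀, η₁, η₀] = ![θ₁, θ₀, η₀, η₁] ∘ Equiv.swap 2 3 := by
    funext i; fin_cases i <;> rfl
  have s2 := hswap ![θ₀, θ₁, η₀, η₁] 0 1 (by decide)
  have s3 := hswap ![θ₀, θ₁, η₀, η₁] 2 3 (by decide)
  have s4 := hswap ![θ₁, θ₀, η₀, η₁] 2 3 (by decide)
  rw [← e2] at s2
  rw [← e3] at s3
  rw [← e4, s2] at s4
  rw [s2] at h2
  rw [s3] at h3
  rw [s4] at h4
  have hw : wedge (covectorWedge ![θ₀, θ₁]) (covectorWedge ![η₀, η₁]) v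
      = ((2 ! * 2 ! : ℕ) : ℂ)⁻¹ * ∑ σ : Equiv.Perm (Fin 4), (Equiv.Perm.sign σ : ℂ) *
        ((θ₀ (v (σ 0)) * θ₁ (v (σ 1)) - θ₀ (v (σ 1)) * θ₁ (v (σ 0))) *
          (η₀ (v (σ 2)) * η₁ (v (σ 3)) - η₀ (v (σ 3)) * η₁ (v (σ 2)))) := by
    rw [wedge_apply]
    congr 1
    refine Finset.sum_congr rfl fun σ _ => ?_
    simp only [covectorWedge_apply, Matrix.det_fin_two, Matrix.of_apply]
    rfl
  rw [hw]
  have hsum : ∑ σ : Equiv.Perm (Fin 4), (Equiv.Perm.sign σ : ℂ) *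
        ((θ₀ (v (σ 0)) * θ₁ (v (σ 1)) - θ₀ (v (σ 1)) * θ₁ (v (σ 0))) *
          (η₀ (v (σ 2)) * η₁ (v (σ 3)) - η₀ (v (σ 3)) * η₁ (v (σ 2))))
      = 4 * covectorWedge ![θ₀, θ₁, η₀, η₁] v := by
    have hc := congrArg₂ (· + ·) (congrArg₂ (· - ·) (congrArg₂ (· - ·) h1 h2) h3) h4
    simp only [← Finset.sum_sub_distrib, ← Finset.sum_add_distrib] at hc
    refine Eq.trans (Finset.sum_congr rfl fun σ _ => ?_) (hc.trans (by ring))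
    simp
    ring
  rw [hsum]
  norm_num [Nat.factorial]
  ring

end Wedge

/-! ### Forms of given type -/

section Types

variable {E : Type*} [NormedAddCommGroup E] [NormedSpace ℝ E] [NormedSpace ℂ E]

/-- If `L x v` scales by `s` under multiplication of `x` by `c` and by `t` under multiplication of `v`
by `c`, then its alternatization scales by `s * t`. -/
theorem alternatizeUncurryFin_smul_apply {k : ℕ} {c s t : ℂ} (L : E →L[ℝ] E [⋀^Fin k]→L[ℝ] ℂ)
    (hL : ∀ x v, L (c • x) v = s * L x v)
    (hv : ∀ x (v : Fin k → E), L x (fun i => c • v i) = t * L x v)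
    (v : Fin (k + 1) → E) :
    ContinuousAlternatingMap.alternatizeUncurryFin L (fun i => c • v i)
      = s * t * ContinuousAlternatingMap.alternatizeUncurryFin L v := by
  simp only [ContinuousAlternatingMap.alternatizeUncurryFin_apply, Finset.mul_sum]
  refine Finset.sum_congr rfl fun i _ => ?_
  have : i.removeNth (fun i => c • v i) = fun j => c • i.removeNth v j := rfl
  rw [this, hL, hv]
  simp only [zsmul_eq_mul]
  ring

variable [IsScalarTower ℝ ℂ E]

theorem antilinearPart_apply {G : Type*} [NormedAddCommGroup G] [NormedSpace ℝ G]
    [NormedSpace ℂ G] [IsScalarTower ℝ ℂ G] (L : E →L[ℝ] G) (x : E) :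
    antilinearPart L x = (2⁻¹ : ℂ) • (L x + Complex.I • L (Complex.I • x)) := rfl

theorem antilinearPart_I_smul {G : Type*} [NormedAddCommGroup G] [NormedSpace ℝ G]
    [NormedSpace ℂ G] [IsScalarTower ℝ ℂ G] (L : E →L[ℝ] G) (x : E) :
    antilinearPart L (Complex.I • x) = (-Complex.I) • antilinearPart L x := by
  have h : Complex.I • Complex.I • x = -x := by rw [smul_smul, Complex.I_mul_I, neg_one_smul]
  simp only [antilinearPart_apply, h, map_neg]
  match_scalars
  · linear_combination (2⁻¹ : ℂ) * Complex.I_mul_I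
  · ring

theorem sub_antilinearPart_I_smul {G : Type*} [NormedAddCommGroup G] [NormedSpace ℝ G]
    [NormedSpace ℂ G] [IsScalarTower ℝ ℂ G] (L : E →L[ℝ] G) (x : E) :
    (L - antilinearPart L) (Complex.I • x) = Complex.I • (L - antilinearPart L) x := by
  have h : Complex.I • Complex.I • x = -x := by rw [smul_smul, Complex.I_mul_I, neg_one_smul]
  simp only [sub_apply, antilinearPart_apply, h, map_neg]
  match_scalars
  · linear_combination (2⁻¹ : ℂ) * Complex.I_mul_I
  · ring

end Types

/-! ### Linear algebra of `ℂ²` and `ℂ² × ℂ²` -/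

section C2

/-- The standard basis vectors of `ℂ²`. -/
def stdVec (a : Fin 2) : C2 := EuclideanSpace.single a 1

theorem C2_eq (v : C2) : v = v 0 • stdVec 0 + v 1 • stdVec 1 := by
  ext i
  fin_cases i <;> simp [stdVec]

theorem dz12_apply (v : Fin 2 → C2) : dz12 v = v 0 0 * v 1 1 - v 1 0 * v 0 1 := by
  simp [dz12, covectorWedge_apply, Matrix.det_fin_two, dz]

theorem dz12_stdVec : dz12 ![stdVec 0, stdVec 1] = 1 := by
  simp [dz12_apply, stdVec]

/-- An alternating complex bilinear expression on `ℂ²` is a multiple of `dz¹ ∧ dz²`. -/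
theorem eq_dz12_mul_of_bilinear {f : C2 → C2 → ℂ} (hadd : ∀ u v w, f (u + v) w = f u w + f v w)
    (hsmul : ∀ (c : ℂ) v w, f (c • v) w = c * f v w) (hswap : ∀ v w, f v w = -f w v) (v w : C2) :
    f v w = dz12 ![v, w] * f (stdVec 0) (stdVec 1) := by
  have hself : ∀ v, f v v = 0 := fun v => self_eq_neg.mp (hswap v v)
  have hr : ∀ u v w, f u (v + w) = f u v + f u w := fun u v w => by
    rw [hswap, hadd, hswap u v, hswap u w]; ring
  have hrs : ∀ (c : ℂ) v w, f v (c • w) = c * f v w := fun c v w => by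
    rw [hswap, hsmul, hswap v w]; ring
  conv_lhs => rw [C2_eq v, C2_eq w]
  simp only [hadd, hr, hsmul, hrs, hself, hswap (stdVec 1) (stdVec 0), dz12_apply,
    Matrix.cons_val_zero, Matrix.cons_val_one]
  ring

/-- The complex determinant of an endomorphism of `ℂ²`. -/
def det2 (L : C2 →L[ℝ] C2) : ℂ := dz12 ![L (stdVec 0), L (stdVec 1)]

theorem real_smul_eq {E : Type*} [NormedAddCommGroup E] [NormedSpace ℝ E] [NormedSpace ℂ E]
    [IsScalarTower ℝ ℂ E] (r : ℝ) (v : E) : (r : ℂ) • v = r • v :=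
  algebraMap_smul ℂ r v

/-- Additive functions commuting with real scalars and with `i` commute with complex scalars. -/
theorem smul_of_I_smul {E : Type*} [NormedAddCommGroup E] [NormedSpace ℝ E] [NormedSpace ℂ E]
    [IsScalarTower ℝ ℂ E] {f : E → ℂ} (hadd : ∀ u v, f (u + v) = f u + f v)
    (hreal : ∀ (r : ℝ) v, f (r • v) = r * f v) (hI : ∀ v, f (Complex.I • v) = Complex.I * f v)
    (c : ℂ) (v : E) : f (c • v) = c * f v := by
  have h : c • v = c.re • v + c.im • Complex.I • v := by
    rw [← real_smul_eq, ← real_smul_eq, smul_smul, ← add_smul, Complex.re_add_im]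
  rw [h, hadd, hreal, hreal, hI]
  conv_rhs => rw [← Complex.re_add_im c]
  ring

theorem vec2_update_zero {V : Type*} (a b x : V) : ![x, b] = Function.update ![a, b] 0 x := by
  funext i; fin_cases i <;> rfl

theorem map_swap_two {E : Type*} [NormedAddCommGroup E] [NormedSpace ℝ E]
    (α : E [⋀^Fin 2]→L[ℝ] ℂ) (v w : E) : α ![v, w] = -α ![w, v] := by
  have h := α.toAlternatingMap.map_swap ![w, v] (i := 0) (j := 1) (by decide)
  have e : ![w, v] ∘ Equiv.swap (0 : Fin 2) 1 = ![v, w] := by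
    funext i; fin_cases i <;> rfl
  rw [e] at h
  exact h

/-- A 2-form of type `(2, 0)` is complex bilinear. -/
theorem I_smul_of_type_two_zero {E : Type*} [NormedAddCommGroup E] [NormedSpace ℝ E]
    [NormedSpace ℂ E] {α : E [⋀^Fin 2]→L[ℝ] ℂ}
    (h : ∀ (c : ℂ) (v : Fin 2 → E), α (fun i => c • v i) = c ^ 2 * α v) (v w : E) :
    α ![Complex.I • v, w] = Complex.I * α ![v, w] := by
  have hadd : ∀ u v w, α ![u + v, w] = α ![u, w] + α ![v, w] := fun u v w => by
    rw [vec2_update_zero u w (u + v), α.map_update_add, ← vec2_update_zero, ← vec2_update_zero]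
  have hadd' : ∀ u v w, α ![u, v + w] = α ![u, v] + α ![u, w] := fun u v w => by
    rw [map_swap_two, hadd, map_swap_two _ u v, map_swap_two _ u w]; ring
  have hc : ∀ (c : ℂ) v w, α ![c • v, c • w] = c ^ 2 * α ![v, w] := fun c v w => by
    rw [← h c ![v, w]]
    congr 1
    funext i; fin_cases i <;> rfl
  have hmix : ∀ v w, α ![Complex.I • v, w] + α ![v, Complex.I • w]
      = 2 * Complex.I * α ![v, w] := by
    intro v w
    have h1 := hc (1 + Complex.I) v w
    have h2 := hc Complex.I v w
    simp only [add_smul, one_smul, hadd, hadd'] at h1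
    rw [h2] at h1
    linear_combination h1
  have h1 := hmix (Complex.I • v) w
  have h2 := hc Complex.I v w
  have h3 : α ![Complex.I • Complex.I • v, w] = -α ![v, w] := by
    have h0 : Complex.I • Complex.I • v + v = 0 := by
      rw [smul_smul, Complex.I_mul_I, neg_one_smul, neg_add_cancel]
    have h4 := hadd (Complex.I • Complex.I • v) v w
    have h5 : α ![(0 : E), w] = 0 := α.map_coord_zero 0 rfl
    rw [h0, h5] at h4
    linear_combination -h4
  rw [h2, h3] at h1
  linear_combination (Complex.I / 2) * h1 + α ![Complex.I • v, w] * Complex.I_sq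
    - (Complex.I / 2) * α ![v, w] * Complex.I_sq

/-- On `ℂ²` a form of type `(2, 0)` is a multiple of `dz¹ ∧ dz²`. -/
theorem eq_smul_dz12 {α : C2 [⋀^Fin 2]→L[ℝ] ℂ}
    (h : ∀ (c : ℂ) (v : Fin 2 → C2), α (fun i => c • v i) = c ^ 2 * α v) :
    α = α ![stdVec 0, stdVec 1] • dz12 := by
  have hadd : ∀ u v w, α ![u + v, w] = α ![u, w] + α ![v, w] := fun u v w => by
    rw [vec2_update_zero u w (u + v), α.map_update_add, ← vec2_update_zero, ← vec2_update_zero]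
  have hreal : ∀ (r : ℝ) v w, α ![r • v, w] = r * α ![v, w] := fun r v w => by
    rw [vec2_update_zero v w (r • v), α.map_update_smul, ← vec2_update_zero, Complex.real_smul]
  ext v
  have hv : v = ![v 0, v 1] := by funext i; fin_cases i <;> rfl
  rw [ContinuousAlternatingMap.smul_apply, smul_eq_mul, mul_comm, hv]
  exact eq_dz12_mul_of_bilinear (f := fun v w => α ![v, w]) hadd
    (fun c v w => smul_of_I_smul (f := fun v => α ![v, w]) (fun u v => hadd u v w)
      (fun r v => hreal r v w) (fun v => I_smul_of_type_two_zero h v w) c v) (fun v w => map_swap_two α v w) _ _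

theorem dz12_comp (L : C2 →L[ℝ] C2) (hL : ∀ v, L (Complex.I • v) = Complex.I • L v) :
    dz12.compContinuousLinearMap L = det2 L • dz12 := by
  have hL' : ∀ (c : ℂ) v, L (c • v) = c • L v := by
    intro c v
    ext i
    exact smul_of_I_smul (f := fun v => L v i) (by simp) (by simp) (by simp [hL]) c v
  rw [eq_smul_dz12 (α := dz12.compContinuousLinearMap L)]
  · congr 1
  · intro c v
    simp only [ContinuousAlternatingMap.compContinuousLinearMap_apply, Function.comp_def, hL',
      dz12_apply, PiLp.smul_apply, smul_eq_mul]
    ring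

end C2

/-! ### The pairing of 4-forms with `∂₁ ∧ ∂₂ ∧ ∂̄₃ ∧ ∂̄₄` -/

section Pairing

/-- The complex linear part `v ↦ (f v - i f (i v)) / 2` of a function on `ℂ²`. -/
def linPart (f : C2 → ℂ) (v : C2) : ℂ := 2⁻¹ * (f v - Complex.I * f (Complex.I • v))

/-- The conjugate linear part `v ↦ (f v + i f (i v)) / 2` of a function on `ℂ²`. -/
def antiPart (f : C2 → ℂ) (v : C2) : ℂ := 2⁻¹ * (f v + Complex.I * f (Complex.I • v))

/-- The part of `α ((a, 0), (b, 0), (0, c), (0, d))` that is complex linear in `a` and `b` and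
conjugate linear in `c` and `d`. -/
def mixedPart (α : (C2 × C2) [⋀^Fin 4]→L[ℝ] ℂ) (a b c d : C2) : ℂ :=
  linPart (fun a => linPart (fun b => antiPart (fun c => antiPart (fun d =>
    α ![(a, 0), (b, 0), (0, c), (0, d)]) d) c) b) a

/-- The coefficient of `dz¹ ∧ dz² ∧ dz̄³ ∧ dz̄⁴` in a 4-form, i.e. the value of its complex
multilinear extension at `(∂/∂z¹, ∂/∂z², ∂/∂z̄³, ∂/∂z̄⁴)`. -/
def mixedCoeff (α : (C2 × C2) [⋀^Fin 4]→L[ℝ] ℂ) : ℂ :=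
  mixedPart α (stdVec 0) (stdVec 1) (stdVec 0) (stdVec 1)

section

variable (α : (C2 × C2) [⋀^Fin 4]→L[ℝ] ℂ)

theorem vec4_swap_01 (a b c d : C2) :
    α ![(a, 0), (b, 0), (0, c), (0, d)] = -α ![(b, 0), (a, 0), (0, c), (0, d)] := by
  have h := α.toAlternatingMap.map_swap ![(b, 0), (a, 0), (0, c), (0, d)] (i := 0) (j := 1)
    (by decide)
  have e : ![(b, 0), (a, 0), (0, c), (0, d)] ∘ Equiv.swap (0 : Fin 4) 1
      = (![(a, 0), (b, 0), (0, c), (0, d)] : Fin 4 → C2 × C2) := by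
    funext i; fin_cases i <;> rfl
  rw [e] at h
  exact h

theorem vec4_swap_23 (a b c d : C2) :
    α ![(a, 0), (b, 0), (0, c), (0, d)] = -α ![(a, 0), (b, 0), (0, d), (0, c)] := by
  have h := α.toAlternatingMap.map_swap ![(a, 0), (b, 0), (0, d), (0, c)] (i := 2) (j := 3)
    (by decide)
  have e : ![(a, 0), (b, 0), (0, d), (0, c)] ∘ Equiv.swap (2 : Fin 4) 3
      = (![(a, 0), (b, 0), (0, c), (0, d)] : Fin 4 → C2 × C2) := by
    funext i; fin_cases i <;> rfl
  rw [e] at h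
  exact h

theorem vec4_update_zero {V : Type*} (a b c d x : V) :
    ![x, b, c, d] = Function.update ![a, b, c, d] 0 x := by
  funext i; fin_cases i <;> rfl

theorem vec4_update_two {V : Type*} (a b c d x : V) :
    ![a, b, x, d] = Function.update ![a, b, c, d] 2 x := by
  funext i; fin_cases i <;> rfl

theorem vec4_add_zero (u v b c d : C2) :
    α ![(u + v, 0), (b, 0), (0, c), (0, d)]
      = α ![(u, 0), (b, 0), (0, c), (0, d)] + α ![(v, 0), (b, 0), (0, c), (0, d)] := by
  rw [show ((u + v, 0) : C2 × C2) = (u, 0) + (v, 0) by simp,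
    vec4_update_zero (u, 0) (b, 0) (0, c) (0, d) ((u, 0) + (v, 0)), α.map_update_add,
    ← vec4_update_zero, ← vec4_update_zero]

theorem vec4_smul_zero (r : ℝ) (u b c d : C2) :
    α ![(r • u, 0), (b, 0), (0, c), (0, d)] = r * α ![(u, 0), (b, 0), (0, c), (0, d)] := by
  rw [show ((r • u, 0) : C2 × C2) = r • (u, 0) by simp,
    vec4_update_zero (u, 0) (b, 0) (0, c) (0, d) (r • (u, 0)), α.map_update_smul,
    ← vec4_update_zero, Complex.real_smul]

theorem vec4_add_two (a b u v d : C2) :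
    α ![(a, 0), (b, 0), (0, u + v), (0, d)]
      = α ![(a, 0), (b, 0), (0, u), (0, d)] + α ![(a, 0), (b, 0), (0, v), (0, d)] := by
  rw [show ((0, u + v) : C2 × C2) = (0, u) + (0, v) by simp,
    vec4_update_two (a, 0) (b, 0) (0, u) (0, d) ((0, u) + (0, v)), α.map_update_add,
    ← vec4_update_two, ← vec4_update_two]

theorem vec4_smul_two (r : ℝ) (a b c d : C2) :
    α ![(a, 0), (b, 0), (0, r • c), (0, d)] = r * α ![(a, 0), (b, 0), (0, c), (0, d)] := by
  rw [show ((0, r • c) : C2 × C2) = r • (0, c) by simp,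
    vec4_update_two (a, 0) (b, 0) (0, c) (0, d) (r • (0, c)), α.map_update_smul,
    ← vec4_update_two, Complex.real_smul]

theorem I_smul_I_smul {E : Type*} [AddCommGroup E] [Module ℂ E] (v : E) :
    Complex.I • Complex.I • v = -v := by
  rw [smul_smul, Complex.I_mul_I, neg_one_smul]

theorem vec4_neg_zero (a b c d : C2) :
    α ![(-a, 0), (b, 0), (0, c), (0, d)] = -α ![(a, 0), (b, 0), (0, c), (0, d)] := by
  simpa using vec4_smul_zero α (-1) a b c d

theorem vec4_neg_two (a b c d : C2) :
    α ![(a, 0), (b, 0), (0, -c), (0, d)] = -α ![(a, 0), (b, 0), (0, c), (0, d)] := by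
  simpa using vec4_smul_two α (-1) a b c d

/-- Being complex bilinear in `a, b` and conjugate bilinear in `c, d`, the mixed part is determined
by one value. -/
theorem mixedPart_eq_mul (a b c d : C2) :
    mixedPart α a b c d = dz12 ![a, b] * conj (dz12 ![c, d]) * mixedCoeff α := by
  have h1 : ∀ a b c d, mixedPart α a b c d
      = dz12 ![a, b] * mixedPart α (stdVec 0) (stdVec 1) c d := by
    intro a b c d
    refine eq_dz12_mul_of_bilinear (f := fun a b => mixedPart α a b c d) ?_ ?_ ?_ a b
    · intro u v w
      simp only [mixedPart, linPart, antiPart, smul_add, vec4_add_zero]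
      ring
    · intro k v w
      refine smul_of_I_smul (f := fun v => mixedPart α v w c d) ?_ ?_ ?_ k v
      · intro u v
        simp only [mixedPart, linPart, antiPart, smul_add, vec4_add_zero]
        ring
      · intro r v
        simp only [mixedPart, linPart, antiPart, smul_comm Complex.I r v, vec4_smul_zero]
        ring
      · intro v
        simp only [mixedPart, linPart, I_smul_I_smul]
        simp only [antiPart, vec4_neg_zero]
        have hI2 := Complex.I_sq
        grind
    · intro v w
      simp only [mixedPart, linPart, antiPart, vec4_swap_01 α v, vec4_swap_01 α (Complex.I • v)]
      ring
  have h2 : ∀ a b c d, conj (mixedPart α a b c d)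
      = dz12 ![c, d] * conj (mixedPart α a b (stdVec 0) (stdVec 1)) := by
    intro a b c d
    refine eq_dz12_mul_of_bilinear (f := fun c d => conj (mixedPart α a b c d)) ?_ ?_ ?_ c d
    · intro u v w
      rw [← map_add]
      congr 1
      simp only [mixedPart, linPart, antiPart, smul_add, vec4_add_two]
      ring
    · intro k v w
      refine smul_of_I_smul (f := fun v => conj (mixedPart α a b v w)) ?_ ?_ ?_ k v
      · intro u v
        rw [← map_add]
        congr 1
        simp only [mixedPart, linPart, antiPart, smul_add, vec4_add_two]
        ring
      · intro r v
        conv_rhs => rw [← Complex.conj_ofReal, ← map_mul]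
        congr 1
        simp only [mixedPart, linPart, antiPart, smul_comm Complex.I r v, vec4_smul_two]
        ring
      · intro v
        have hI : Complex.I = conj (-Complex.I) := by simp
        conv_rhs => rw [hI]
        rw [← map_mul]
        congr 1
        simp only [mixedPart, linPart, antiPart, I_smul_I_smul, vec4_neg_two]
        have hI2 := Complex.I_sq
        grind
    · intro v w
      rw [← map_neg]
      congr 1
      simp only [mixedPart, linPart, antiPart, vec4_swap_23 α _ _ v,
        vec4_swap_23 α _ _ (Complex.I • v)]
      ring
  have h3 : mixedPart α (stdVec 0) (stdVec 1) c d = conj (dz12 ![c, d]) * mixedCoeff α := by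
    have h := congrArg conj (h2 (stdVec 0) (stdVec 1) c d)
    simpa [mixedCoeff] using h
  rw [h1, h3, mul_assoc]

end

/-- A pair of endomorphisms of `ℂ²` acts on the mixed coefficient by its determinants. -/
theorem mixedCoeff_comp (α : (C2 × C2) [⋀^Fin 4]→L[ℝ] ℂ) {L : C2 × C2 →L[ℝ] C2 × C2}
    {L₁ L₂ : C2 →L[ℝ] C2} (h₁ : ∀ v, L₁ (Complex.I • v) = Complex.I • L₁ v)
    (h₂ : ∀ v, L₂ (Complex.I • v) = Complex.I • L₂ v) (hL : ∀ v, L v = (L₁ v.1, L₂ v.2)) :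
    mixedCoeff (α.compContinuousLinearMap L) = det2 L₁ * conj (det2 L₂) * mixedCoeff α := by
  have h : ∀ a b c d, α.compContinuousLinearMap L ![(a, 0), (b, 0), (0, c), (0, d)]
      = α ![(L₁ a, 0), (L₁ b, 0), (0, L₂ c), (0, L₂ d)] := by
    intro a b c d
    rw [ContinuousAlternatingMap.compContinuousLinearMap_apply]
    congr 1
    funext i
    fin_cases i <;> simp [hL]
  rw [det2, det2, ← mixedPart_eq_mul]
  simp only [mixedCoeff, mixedPart, linPart, antiPart, h, h₁, h₂]

theorem mixedCoeff_smul (c : ℂ) (α : (C2 × C2) [⋀^Fin 4]→L[ℝ] ℂ) :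
    mixedCoeff (c • α) = c * mixedCoeff α := by
  simp only [mixedCoeff, mixedPart, linPart, antiPart, ContinuousAlternatingMap.smul_apply,
    smul_eq_mul]
  ring

theorem mixedCoeff_add (α β : (C2 × C2) [⋀^Fin 4]→L[ℝ] ℂ) :
    mixedCoeff (α + β) = mixedCoeff α + mixedCoeff β := by
  simp only [mixedCoeff, mixedPart, linPart, antiPart, ContinuousAlternatingMap.add_apply]
  ring

theorem dz12bar34_apply (a b c d : C2) :
    dz12bar34 ![(a, 0), (b, 0), (0, c), (0, d)] = dz12 ![a, b] * conj (dz12 ![c, d]) := by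
  rw [dz12bar34, covectorWedge_apply, dz12_apply, dz12_apply]
  simp [Matrix.det_succ_row_zero, Fin.sum_univ_succ, dz, Fin.succAbove]
  ring

theorem mixedCoeff_dz12bar34 : mixedCoeff dz12bar34 = 1 := by
  simp only [mixedCoeff, mixedPart, linPart, antiPart, dz12bar34_apply, dz12_apply,
    PiLp.smul_apply, Matrix.cons_val_zero, Matrix.cons_val_one, stdVec, smul_eq_mul]
  simp
  have hI2 := Complex.I_sq
  grind

/-- If `θ` is a combination of `dz̄¹, dz̄², dz³, dz⁴`, then `θ ∧ β` has no component
`dz¹ ∧ dz² ∧ dz̄³ ∧ dz̄⁴`. -/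
theorem mixedCoeff_alternatize_smulRight (θ : C2 × C2 →L[ℝ] ℂ) (β : (C2 × C2) [⋀^Fin 3]→L[ℝ] ℂ)
    (h₁ : ∀ v, θ (Complex.I • v, 0) = -Complex.I * θ (v, 0))
    (h₂ : ∀ v, θ (0, Complex.I • v) = Complex.I * θ (0, v)) :
    mixedCoeff (ContinuousAlternatingMap.alternatizeUncurryFin (θ.smulRight β)) = 0 := by
  have h : ∀ a b c d : C2, ContinuousAlternatingMap.alternatizeUncurryFin (θ.smulRight β)
        ![(a, 0), (b, 0), (0, c), (0, d)]
      = θ (a, 0) * β ![(b, 0), (0, c), (0, d)] - θ (b, 0) * β ![(a, 0), (0, c), (0, d)]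
        + θ (0, c) * β ![(a, 0), (b, 0), (0, d)] - θ (0, d) * β ![(a, 0), (b, 0), (0, c)] := by
    intro a b c d
    have e0 : (0 : Fin 4).removeNth ![((a, 0) : C2 × C2), (b, 0), (0, c), (0, d)]
      = ![(b, 0), (0, c), (0, d)] := by funext i; fin_cases i <;> rfl
    have e1 : (1 : Fin 4).removeNth ![((a, 0) : C2 × C2), (b, 0), (0, c), (0, d)]
      = ![(a, 0), (0, c), (0, d)] := by funext i; fin_cases i <;> rfl
    have e2 : (2 : Fin 4).removeNth ![((a, 0) : C2 × C2), (b, 0), (0, c), (0, d)]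
      = ![(a, 0), (b, 0), (0, d)] := by funext i; fin_cases i <;> rfl
    have e3 : (3 : Fin 4).removeNth ![((a, 0) : C2 × C2), (b, 0), (0, c), (0, d)]
      = ![(a, 0), (b, 0), (0, c)] := by funext i; fin_cases i <;> rfl
    rw [ContinuousAlternatingMap.alternatizeUncurryFin_apply, Fin.sum_univ_four, e0, e1, e2, e3]
    simp
    ring
  simp only [mixedCoeff, mixedPart, linPart, antiPart, h, h₁, h₂]
  have hI2 := Complex.I_sq
  grind

end Pairing

/-! ### Complex surfaces as real manifolds -/

section Surface

open Set Topology

theorem contDiffGroupoid_complex_le_real :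
    contDiffGroupoid ω 𝓘(ℂ, C2) ≤ contDiffGroupoid ∞ 𝓘(ℝ, C2) := by
  rw [contDiffGroupoid, contDiffGroupoid]
  apply groupoid_of_pregroupoid_le
  intro f s hfs
  exact (ContDiffOn.restrict_scalars ℝ hfs).of_le le_top

variable {S : Type*} [TopologicalSpace S] [ChartedSpace C2 S]

theorem isManifold_real (h : IsManifold 𝓘(ℂ, C2) ω S) : IsManifold 𝓘(ℝ, C2) ∞ S where
  toHasGroupoid := hasGroupoid_of_le h.toHasGroupoid contDiffGroupoid_complex_le_real

theorem mem_maximalAtlas_real {e : OpenPartialHomeomorph S C2}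
    (he : e ∈ IsManifold.maximalAtlas 𝓘(ℂ, C2) ω S) :
    e ∈ IsManifold.maximalAtlas 𝓘(ℝ, C2) ∞ S := fun e' he' =>
  ⟨contDiffGroupoid_complex_le_real (he e' he').1, contDiffGroupoid_complex_le_real (he e' he').2⟩

theorem contDiffOn_transition [IsManifold 𝓘(ℂ, C2) ω S] {e e' : OpenPartialHomeomorph S C2}
    (he : e ∈ IsManifold.maximalAtlas 𝓘(ℂ, C2) ω S)
    (he' : e' ∈ IsManifold.maximalAtlas 𝓘(ℂ, C2) ω S) :
    ContDiffOn ℂ ω (e' ∘ e.symm) (e.symm.trans e').source := by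
  have h := (contDiffGroupoid ω 𝓘(ℂ, C2)).compatible_of_mem_maximalAtlas he he'
  rw [contDiffGroupoid, mem_groupoid_of_pregroupoid] at h
  simpa [contDiffPregroupoid] using h.1

/-- The derivative of the inverse of a chart of a surface, in the identification of the tangent
spaces of the surface with `ℂ²`. -/
def symmDeriv (e : OpenPartialHomeomorph S C2) (z : C2) : C2 →L[ℝ] C2 :=
  mfderiv 𝓘(ℝ, C2) 𝓘(ℝ, C2) e.symm z

theorem mdifferentiableAt_symm [IsManifold 𝓘(ℂ, C2) ω S] {e : OpenPartialHomeomorph S C2}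
    (he : e ∈ IsManifold.maximalAtlas 𝓘(ℂ, C2) ω S) {z : C2} (hz : z ∈ e.target) :
    MDifferentiableAt 𝓘(ℝ, C2) 𝓘(ℝ, C2) e.symm z :=
  have := isManifold_real ‹IsManifold 𝓘(ℂ, C2) ω S›
  ((contMDiffOn_symm_of_mem_maximalAtlas (mem_maximalAtlas_real he)).contMDiffAt
    (e.open_target.mem_nhds hz)).mdifferentiableAt (by simp)

theorem contDiffAt_transition [IsManifold 𝓘(ℂ, C2) ω S] {e e' : OpenPartialHomeomorph S C2}
    (he : e ∈ IsManifold.maximalAtlas 𝓘(ℂ, C2) ω S)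
    (he' : e' ∈ IsManifold.maximalAtlas 𝓘(ℂ, C2) ω S) {z : C2} (hz : z ∈ e.target)
    (hz' : e.symm z ∈ e'.source) : ContDiffAt ℂ ω (e' ∘ e.symm) z :=
  (contDiffOn_transition he he').contDiffAt
    ((e.symm.trans _).open_source.mem_nhds (by simp [hz, hz']))

/-- The tangent space at `e.symm z` is identified with `ℂ²` by the preferred chart, so that
`symmDeriv e z` is the derivative of a transition map, which is complex linear. -/
theorem symmDeriv_eq [IsManifold 𝓘(ℂ, C2) ω S] {e : OpenPartialHomeomorph S C2}
    (he : e ∈ IsManifold.maximalAtlas 𝓘(ℂ, C2) ω S) {z : C2} (hz : z ∈ e.target) :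
    symmDeriv e z = (fderiv ℂ (chartAt C2 (e.symm z) ∘ e.symm) z).restrictScalars ℝ := by
  have hT : DifferentiableAt ℂ (chartAt C2 (e.symm z) ∘ e.symm) z :=
    (contDiffAt_transition he (IsManifold.chart_mem_maximalAtlas (e.symm z)) hz
      (mem_chart_source C2 _)).differentiableAt (by simp)
  refine (mdifferentiableAt_symm he hz).mfderiv.trans ?_
  simp only [writtenInExtChartAt, mfld_simps, fderivWithin_univ]
  exact hT.fderiv_restrictScalars ℝ

theorem symmDeriv_smul [IsManifold 𝓘(ℂ, C2) ω S] {e : OpenPartialHomeomorph S C2}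
    (he : e ∈ IsManifold.maximalAtlas 𝓘(ℂ, C2) ω S) {z : C2} (hz : z ∈ e.target) (c : ℂ) (v : C2) :
    symmDeriv e z (c • v) = c • symmDeriv e z v := by
  rw [symmDeriv_eq he hz]
  simp

theorem symmDeriv_surjective [IsManifold 𝓘(ℂ, C2) ω S] {e : OpenPartialHomeomorph S C2}
    (he : e ∈ IsManifold.maximalAtlas 𝓘(ℂ, C2) ω S) {z : C2} (hz : z ∈ e.target) :
    Function.Surjective (symmDeriv e z) := by
  have := isManifold_real ‹IsManifold 𝓘(ℂ, C2) ω S›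
  have h := mem_maximalAtlas_real he
  have hm : e.symm.MDifferentiable 𝓘(ℝ, C2) 𝓘(ℝ, C2) :=
    ⟨(contMDiffOn_symm_of_mem_maximalAtlas h).mdifferentiableOn (by simp),
      (contMDiffOn_of_mem_maximalAtlas h).mdifferentiableOn (by simp)⟩
  exact hm.mfderiv_surjective hz

end Surface

/-! ### Change of coordinates -/

section Coordinates

open Set Topology

variable {E : Type*} [NormedAddCommGroup E] [NormedSpace ℝ E]
  {H : Type*} [TopologicalSpace H] (I : ModelWithCorners ℝ E H)
  {M : Type*} [TopologicalSpace M] [ChartedSpace H M]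

theorem inCoords_comp {E' E'' : Type*} [NormedAddCommGroup E'] [NormedSpace ℝ E']
    [NormedAddCommGroup E''] [NormedSpace ℝ E''] {k : ℕ} (α : CForm E M k) {σ : E' → M}
    {T : E'' → E'} {y : E''} (hσ : MDifferentiableAt 𝓘(ℝ, E') I σ (T y))
    (hT : DifferentiableAt ℝ T y) :
    inCoords I α (σ ∘ T) y = (inCoords I α σ (T y)).compContinuousLinearMap (fderiv ℝ T y) := by
  rw [inCoords, mfderiv_comp y hσ hT.mdifferentiableAt, mfderiv_eq_fderiv]
  rfl

theorem inCoords_congr {E' : Type*} [NormedAddCommGroup E'] [NormedSpace ℝ E'] {k : ℕ}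
    (α : CForm E M k) {σ τ : E' → M} {y : E'} (h : σ =ᶠ[𝓝 y] τ) :
    inCoords I α σ y = inCoords I α τ y := by
  rw [inCoords, inCoords, h.mfderiv_eq, h.self_of_nhds]

variable [I.Boundaryless] [IsManifold I ∞ M]

theorem mdifferentiableAt_extChartAt_symm' {a : M} {y : E} (hy : y ∈ (extChartAt I a).target) :
    MDifferentiableAt 𝓘(ℝ, E) I (extChartAt I a).symm y :=
  ((contMDiffOn_extChartAt_symm (I := I) (n := ∞) a).contMDiffAt
    ((isOpen_extChartAt_target a).mem_nhds hy)).mdifferentiableAt (by simp)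

/-- The transition map between two preferred charts is smooth. -/
theorem contDiffAt_extChartAt_comp_symm {a b : M} {y : E} (hy : y ∈ (extChartAt I a).target)
    (hb : (extChartAt I a).symm y ∈ (chartAt H b).source) :
    ContDiffAt ℝ ∞ (extChartAt I b ∘ (extChartAt I a).symm) y := by
  rw [← contMDiffAt_iff_contDiffAt]
  exact (contMDiffAt_extChartAt' hb).comp y
    ((contMDiffOn_extChartAt_symm (I := I) (n := ∞) a).contMDiffAt
      ((isOpen_extChartAt_target a).mem_nhds hy))

theorem inCoords_extChartAt_symm_eventuallyEq {k : ℕ} (α : CForm E M k) {a b : M} {y : E}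
    (hy : y ∈ (extChartAt I a).target) (hb : (extChartAt I a).symm y ∈ (chartAt H b).source) :
    inCoords I α (extChartAt I a).symm =ᶠ[𝓝 y] fun y' =>
      (inCoords I α (extChartAt I b).symm
        ((extChartAt I b ∘ (extChartAt I a).symm) y')).compContinuousLinearMap
          (fderiv ℝ (extChartAt I b ∘ (extChartAt I a).symm) y') := by
  have hcont : ContinuousAt (extChartAt I a).symm y := continuousAt_extChartAt_symm'' hy
  have hev : ∀ᶠ y' in 𝓝 y, y' ∈ (extChartAt I a).target ∧
      (extChartAt I a).symm y' ∈ (chartAt H b).source :=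
    ((isOpen_extChartAt_target a).eventually_mem hy).and
      (hcont.eventually ((chartAt H b).open_source.eventually_mem hb))
  filter_upwards [eventually_eventually_nhds.mpr hev] with y' hy'
  have h0 := hy'.self_of_nhds
  have hs : (extChartAt I a).symm y' ∈ (extChartAt I b).source := by
    rw [extChartAt_source]; exact h0.2
  rw [← inCoords_comp I α (T := extChartAt I b ∘ (extChartAt I a).symm)
    (mdifferentiableAt_extChartAt_symm' I ((extChartAt I b).map_source hs))
    ((contDiffAt_extChartAt_comp_symm I h0.1 h0.2).differentiableAt (by simp))]
  refine inCoords_congr I α ?_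
  filter_upwards [hy'] with y'' h2
  refine ((extChartAt I b).left_inv ?_).symm
  rw [extChartAt_source]; exact h2.2

/-- The exterior derivative at a point is computed in the preferred chart at this point; naturality
of `d` under the transition map gives its expression in any other preferred chart. -/
theorem inCoords_extD {k : ℕ} {α : CForm E M k} (hα : IsSmooth I α) {a : M} {y : E}
    (hy : y ∈ (extChartAt I a).target) :
    inCoords I (extD I α) (extChartAt I a).symm y
      = extDeriv (inCoords I α (extChartAt I a).symm) y := by
  set b := (extChartAt I a).symm y with hb
  have hbs : (extChartAt I a).symm y ∈ (chartAt H b).source := mem_chart_source H b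
  have hT := contDiffAt_extChartAt_comp_symm I hy hbs
  have hdiff : DifferentiableAt ℝ (inCoords I α (extChartAt I b).symm)
      ((extChartAt I b ∘ (extChartAt I a).symm) y) :=
    ((hα b).contDiffAt (extChartAt_target_mem_nhds b)).differentiableAt (by simp)
  rw [(inCoords_extChartAt_symm_eventuallyEq I α hy hbs).extDeriv_eq,
    extDeriv_pullback hdiff hT (by
      rw [minSmoothness_of_isRCLikeNormedField]
      exact WithTop.coe_le_coe.mpr (le_top : (2 : ℕ∞) ≤ ⊤))]
  have hm : mfderiv 𝓘(ℝ, E) 𝓘(ℝ, E) (extChartAt I b ∘ (extChartAt I a).symm) y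
      = (mfderiv I 𝓘(ℝ, E) (extChartAt I b) b).comp
        (mfderiv 𝓘(ℝ, E) I (extChartAt I a).symm y) :=
    mfderiv_comp y (mdifferentiableAt_extChartAt hbs) (mdifferentiableAt_extChartAt_symm' I hy)
  rw [mfderiv_eq_fderiv] at hm
  rw [hm]
  rfl

end Coordinates

/-! ### Holomorphic 2-forms on surfaces in local coordinates -/

section LocalCoeff

open Set Topology

variable {S : Type*} [TopologicalSpace S] [ChartedSpace C2 S]

/-- The coefficient `f` in the expression `f dz¹ ∧ dz²` of a 2-form in the chart `e`. -/
def localCoeff (α : CForm C2 S 2) (e : OpenPartialHomeomorph S C2) (z : C2) : ℂ :=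
  inCoords 𝓘(ℝ, C2) α e.symm z ![stdVec 0, stdVec 1]

theorem coe_extChartAt_symm (x : S) :
    ((extChartAt 𝓘(ℝ, C2) x).symm : C2 → S) = (chartAt C2 x).symm := by
  simp only [mfld_simps]

theorem coe_extChartAt (x : S) : (extChartAt 𝓘(ℝ, C2) x : S → C2) = chartAt C2 x := by
  simp only [mfld_simps]

theorem extChartAt_target' (x : S) :
    (extChartAt 𝓘(ℝ, C2) x).target = (chartAt C2 x).target := by
  simp only [mfld_simps]

variable [IsManifold 𝓘(ℂ, C2) ω S] {e e' : OpenPartialHomeomorph S C2} {α : CForm C2 S 2}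

theorem inCoords_eq_localCoeff (he : e ∈ IsManifold.maximalAtlas 𝓘(ℂ, C2) ω S)
    (hα : IsOfType 2 0 α) {z : C2} (hz : z ∈ e.target) :
    inCoords 𝓘(ℝ, C2) α e.symm z = localCoeff α e z • dz12 := by
  refine eq_smul_dz12 fun c v => ?_
  have h := hα (e.symm z) c (fun i => symmDeriv e z (v i))
  have h2 : inCoords 𝓘(ℝ, C2) α e.symm z (fun i => c • v i)
      = α (e.symm z) (fun i => symmDeriv e z (c • v i)) := rfl
  simp only [h2, symmDeriv_smul he hz, h, pow_zero, mul_one]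
  rfl

theorem localCoeff_ne_zero (he : e ∈ IsManifold.maximalAtlas 𝓘(ℂ, C2) ω S)
    (hα : IsNowhereVanishingHolomorphic α) {z : C2} (hz : z ∈ e.target) :
    localCoeff α e z ≠ 0 := by
  intro h0
  have h := inCoords_eq_localCoeff he hα.1.1 hz
  rw [h0] at h
  apply hα.2 (e.symm z)
  ext v
  choose w hw using fun i => symmDeriv_surjective he hz (v i)
  have h2 : inCoords 𝓘(ℝ, C2) α e.symm z w = α (e.symm z) (fun i => symmDeriv e z (w i)) := rfl
  simp only [hw] at h2
  rw [← h2, h]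
  exact zero_mul _

/-- The change of variables formula for the coefficient of a 2-form of type `(2, 0)`. -/
theorem localCoeff_transition (he : e ∈ IsManifold.maximalAtlas 𝓘(ℂ, C2) ω S)
    (he' : e' ∈ IsManifold.maximalAtlas 𝓘(ℂ, C2) ω S)
    (hα : IsOfType 2 0 α) {z : C2} (hz : z ∈ e.target) (hz' : e.symm z ∈ e'.source) :
    localCoeff α e z
      = det2 ((fderiv ℂ (e' ∘ e.symm) z).restrictScalars ℝ) * localCoeff α e' (e' (e.symm z)) := by
  have hT : DifferentiableAt ℂ (e' ∘ e.symm) z :=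
    (contDiffAt_transition he he' hz hz').differentiableAt (by simp)
  have heq : e.symm =ᶠ[𝓝 z] e'.symm ∘ (e' ∘ e.symm) := by
    filter_upwards [(e.symm.trans e').open_source.mem_nhds (by simp [hz, hz'])] with y hy
    simp only [mfld_simps] at hy
    exact (e'.left_inv hy.2).symm
  have h1 : inCoords 𝓘(ℝ, C2) α e.symm z = _ := inCoords_congr _ α heq
  rw [inCoords_comp _ α (T := e' ∘ e.symm) (mdifferentiableAt_symm he' (e'.map_source hz'))
    (hT.restrictScalars ℝ), Function.comp_apply,
    inCoords_eq_localCoeff he' hα (e'.map_source hz'), hT.fderiv_restrictScalars ℝ] at h1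
  rw [localCoeff, h1]
  have h2 := congrArg (fun β => localCoeff α e' (e' (e.symm z)) * β ![stdVec 0, stdVec 1])
    (dz12_comp ((fderiv ℂ (e' ∘ e.symm) z).restrictScalars ℝ) (by simp))
  simp only [ContinuousAlternatingMap.smul_apply, dz12_stdVec, smul_eq_mul, mul_one] at h2
  rw [mul_comm (det2 _), ← h2]
  rfl

/-- Holomorphy of a form refers to the preferred charts only; the coefficient in another chart differs
by the Jacobian determinant of the transition map, which is holomorphic. -/
theorem differentiableOn_localCoeff (he : e ∈ IsManifold.maximalAtlas 𝓘(ℂ, C2) ω S)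
    (hα : IsHolomorphicForm 𝓘(ℝ, C2) α) : DifferentiableOn ℂ (localCoeff α e) e.target := by
  intro z hz
  apply DifferentiableAt.differentiableWithinAt
  set c := chartAt C2 (e.symm z) with hc
  have hcz : e.symm z ∈ c.source := mem_chart_source C2 _
  have hcm : c ∈ IsManifold.maximalAtlas 𝓘(ℂ, C2) ω S := IsManifold.chart_mem_maximalAtlas _
  have hT := contDiffAt_transition he hcm hz hcz
  have hdet : DifferentiableAt ℂ
      (fun y => det2 ((fderiv ℂ (c ∘ e.symm) y).restrictScalars ℝ)) z := by
    have hd : DifferentiableAt ℂ (fderiv ℂ (c ∘ e.symm)) z :=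
      (hT.fderiv_right (m := 1) le_top).differentiableAt one_ne_zero
    have hcoord : ∀ i j, DifferentiableAt ℂ
        (fun y => (fderiv ℂ (c ∘ e.symm) y (stdVec i)) j) z := fun i j =>
      ((EuclideanSpace.proj j : C2 →L[ℂ] ℂ).differentiableAt).comp z
        (hd.clm_apply (differentiableAt_const _))
    simp only [det2, dz12_apply, Matrix.cons_val_zero, Matrix.cons_val_one,
      ContinuousLinearMap.coe_restrictScalars']
    exact ((hcoord 0 0).mul (hcoord 1 1)).sub ((hcoord 1 0).mul (hcoord 0 1))
  have hcoef : DifferentiableAt ℂ (localCoeff α c) (c (e.symm z)) := by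
    have h := hα.2 (e.symm z)
    rw [extChartAt_target', coe_extChartAt_symm] at h
    have h2 := h.differentiableAt (c.open_target.mem_nhds (c.map_source hcz))
    have hev : IsBoundedLinearMap ℂ fun β : C2 [⋀^Fin 2]→L[ℝ] ℂ => β ![stdVec 0, stdVec 1] := by
      refine IsLinearMap.with_bound ⟨fun _ _ => rfl, fun _ _ => rfl⟩
        (∏ i, ‖(![stdVec 0, stdVec 1] : Fin 2 → C2) i‖) fun β => ?_
      rw [mul_comm]
      exact β.le_opNorm _
    exact hev.differentiableAt.comp _ h2
  refine DifferentiableAt.congr_of_eventuallyEq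
    (hdet.mul (hcoef.comp z (hT.differentiableAt (by simp)))) ?_
  filter_upwards [(e.symm.trans c).open_source.mem_nhds (by simp [hz, hcz])] with y hy
  simp only [mfld_simps] at hy
  exact localCoeff_transition he hcm hα.1 hy.1 hy.2

theorem contDiffOn_localCoeff (he : e ∈ IsManifold.maximalAtlas 𝓘(ℂ, C2) ω S)
    (hα : IsHolomorphicForm 𝓘(ℝ, C2) α) : ContDiffOn ℂ ∞ (localCoeff α e) e.target :=
  contDiffOn_of_differentiableOn e.open_target (differentiableOn_localCoeff he hα)

end LocalCoeff

/-! ### The form on the product -/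

section ProdForm

open Set Topology

theorem wedge_fst_conj_snd (t₀ t₁ s₀ s₁ : C2 →L[ℝ] ℂ) :
    wedge ((covectorWedge ![t₀, t₁]).compContinuousLinearMap (ContinuousLinearMap.fst ℝ C2 C2))
      ((Complex.conjCLE : ℂ →L[ℝ] ℂ).compContinuousAlternatingMap
        ((covectorWedge ![s₀, s₁]).compContinuousLinearMap (ContinuousLinearMap.snd ℝ C2 C2)))
      = covectorWedge ![t₀.comp (ContinuousLinearMap.fst ℝ C2 C2),
          t₁.comp (ContinuousLinearMap.fst ℝ C2 C2),
          (Complex.conjCLE : ℂ →L[ℝ] ℂ).comp (s₀.comp (ContinuousLinearMap.snd ℝ C2 C2)),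
          (Complex.conjCLE : ℂ →L[ℝ] ℂ).comp (s₁.comp (ContinuousLinearMap.snd ℝ C2 C2))] := by
  have h : (Complex.conjCLE : ℂ →L[ℝ] ℂ).compContinuousAlternatingMap
      ((covectorWedge ![s₀, s₁]).compContinuousLinearMap (ContinuousLinearMap.snd ℝ C2 C2))
      = covectorWedge ![
          (Complex.conjCLE : ℂ →L[ℝ] ℂ).comp (s₀.comp (ContinuousLinearMap.snd ℝ C2 C2)),
          (Complex.conjCLE : ℂ →L[ℝ] ℂ).comp (s₁.comp (ContinuousLinearMap.snd ℝ C2 C2))] := by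
    ext v
    simp [covectorWedge_apply, Matrix.det_fin_two]
  have h' : (covectorWedge ![t₀, t₁]).compContinuousLinearMap (ContinuousLinearMap.fst ℝ C2 C2)
      = covectorWedge ![t₀.comp (ContinuousLinearMap.fst ℝ C2 C2),
          t₁.comp (ContinuousLinearMap.fst ℝ C2 C2)] := by
    ext v
    simp [covectorWedge_apply, Matrix.det_fin_two]
  rw [h, h', wedge_covectorWedge_two]

theorem wedge_dz12 : wedge (dz12.compContinuousLinearMap (ContinuousLinearMap.fst ℝ C2 C2))
    ((Complex.conjCLE : ℂ →L[ℝ] ℂ).compContinuousAlternatingMap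
      (dz12.compContinuousLinearMap (ContinuousLinearMap.snd ℝ C2 C2))) = dz12bar34 :=
  wedge_fst_conj_snd _ _ _ _

variable {S₁ : Type*} [TopologicalSpace S₁] [ChartedSpace C2 S₁]
  {S₂ : Type*} [TopologicalSpace S₂] [ChartedSpace C2 S₂]

theorem prodForm_eq (α : CForm C2 S₁ 2) (β : CForm C2 S₂ 2) (p : S₁ × S₂) :
    prodForm α β p
      = wedge ((α p.1).compContinuousLinearMap (ContinuousLinearMap.fst ℝ C2 C2))
        ((Complex.conjCLE : ℂ →L[ℝ] ℂ).compContinuousAlternatingMap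
          ((β p.2).compContinuousLinearMap (ContinuousLinearMap.snd ℝ C2 C2))) := by
  simp only [prodForm, pullback, conjForm]
  rw [mfderiv_fst, mfderiv_snd]
  rfl

theorem mfderiv_prod_symm {σ : C2 → S₁} {τ : C2 → S₂} {z w : C2}
    (hσ : MDifferentiableAt 𝓘(ℝ, C2) 𝓘(ℝ, C2) σ z) (hτ : MDifferentiableAt 𝓘(ℝ, C2) 𝓘(ℝ, C2) τ w)
    (v : C2 × C2) :
    (mfderiv 𝓘(ℝ, C2 × C2) prodModel (fun y : C2 × C2 => (σ y.1, τ y.2)) (z, w)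
      : C2 × C2 →L[ℝ] C2 × C2) v
      = ((mfderiv 𝓘(ℝ, C2) 𝓘(ℝ, C2) σ z : C2 →L[ℝ] C2) v.1,
        (mfderiv 𝓘(ℝ, C2) 𝓘(ℝ, C2) τ w : C2 →L[ℝ] C2) v.2) := by
  have h1 : HasMFDerivAt 𝓘(ℝ, C2 × C2) 𝓘(ℝ, C2) (Prod.fst : C2 × C2 → C2) (z, w)
      (ContinuousLinearMap.fst ℝ C2 C2) := hasFDerivAt_fst.hasMFDerivAt
  have h2 : HasMFDerivAt 𝓘(ℝ, C2 × C2) 𝓘(ℝ, C2) (Prod.snd : C2 × C2 → C2) (z, w)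
      (ContinuousLinearMap.snd ℝ C2 C2) := hasFDerivAt_snd.hasMFDerivAt
  have h := (HasMFDerivAt.comp (z, w) (hσ.hasMFDerivAt (x := z)) h1).prodMk
    (HasMFDerivAt.comp (z, w) (hτ.hasMFDerivAt (x := w)) h2)
  have h3 := h.mfderiv
  exact congrArg (fun L : C2 × C2 →L[ℝ] C2 × C2 => L v) h3

theorem inCoords_prodForm {σ : C2 → S₁} {τ : C2 → S₂} {z w : C2}
    (hσ : MDifferentiableAt 𝓘(ℝ, C2) 𝓘(ℝ, C2) σ z) (hτ : MDifferentiableAt 𝓘(ℝ, C2) 𝓘(ℝ, C2) τ w)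
    {α : CForm C2 S₁ 2} {β : CForm C2 S₂ 2} {a b : ℂ}
    (hα : inCoords 𝓘(ℝ, C2) α σ z = a • dz12) (hβ : inCoords 𝓘(ℝ, C2) β τ w = b • dz12) :
    inCoords prodModel (prodForm α β) (fun y => (σ y.1, τ y.2)) (z, w)
      = (a * conj b) • dz12bar34 := by
  obtain ⟨L, hL⟩ : ∃ L : C2 × C2 →L[ℝ] C2 × C2,
      L = mfderiv 𝓘(ℝ, C2 × C2) prodModel (fun y : C2 × C2 => (σ y.1, τ y.2)) (z, w) := ⟨_, rfl⟩
  have hLv : ∀ v, L v = ((mfderiv 𝓘(ℝ, C2) 𝓘(ℝ, C2) σ z : C2 →L[ℝ] C2) v.1,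
        (mfderiv 𝓘(ℝ, C2) 𝓘(ℝ, C2) τ w : C2 →L[ℝ] C2) v.2) := fun v => by
    rw [hL]; exact mfderiv_prod_symm hσ hτ v
  have h0 : inCoords prodModel (prodForm α β) (fun y => (σ y.1, τ y.2)) (z, w)
      = (prodForm α β (σ z, τ w)).compContinuousLinearMap L := by rw [hL]; rfl
  rw [h0, prodForm_eq, wedge_comp, ← wedge_dz12, ← wedge_smul_smul]
  congr 1
  · have h := congrArg
      (fun γ => γ.compContinuousLinearMap (ContinuousLinearMap.fst ℝ C2 C2)) hα
    refine Eq.trans ?_ h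
    ext v
    exact congrArg (α (σ z)) (funext fun i => congrArg Prod.fst (hLv (v i)))
  · have h := congrArg (fun γ => (Complex.conjCLE : ℂ →L[ℝ] ℂ).compContinuousAlternatingMap
      (γ.compContinuousLinearMap (ContinuousLinearMap.snd ℝ C2 C2))) hβ
    refine Eq.trans ?_ (h.trans ?_)
    · ext v
      exact congrArg (fun u => conj (β (τ w) u)) (funext fun i => congrArg Prod.snd (hLv (v i)))
    · ext v
      simp

end ProdForm

/-! ### Closedness of the product form -/

section Closed

open Set Topology

/-- The covectors `dz¹, dz², dz̄³, dz̄⁴` on `ℂ² × ℂ²`. -/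
def mixedCovectors : Fin 4 → C2 × C2 →L[ℝ] ℂ :=
  ![(dz 0).comp (ContinuousLinearMap.fst ℝ C2 C2),
    (dz 1).comp (ContinuousLinearMap.fst ℝ C2 C2),
    (Complex.conjCLE : ℂ →L[ℝ] ℂ).comp ((dz 0).comp (ContinuousLinearMap.snd ℝ C2 C2)),
    (Complex.conjCLE : ℂ →L[ℝ] ℂ).comp ((dz 1).comp (ContinuousLinearMap.snd ℝ C2 C2))]

theorem dz12bar34_eq : dz12bar34 = covectorWedge mixedCovectors := rfl

theorem dz12bar34_smul (c : ℂ) (v : Fin 4 → C2 × C2) :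
    dz12bar34 (fun i => c • v i) = c ^ 2 * conj c ^ 2 * dz12bar34 v := by
  rw [dz12bar34_eq, covectorWedge_apply, covectorWedge_apply]
  have h := Matrix.det_mul_column ![c, c, conj c, conj c]
    (Matrix.of fun i j => mixedCovectors i (v j))
  have h2 : (∏ i, ![c, c, conj c, conj c] i) = c ^ 2 * conj c ^ 2 := by
    simp [Fin.prod_univ_four]; ring
  rw [← h2, ← h]
  congr 1
  ext i j
  fin_cases i <;> simp [mixedCovectors, dz]

/-- A covector of the type of `d (f ḡ)`, with `f` and `g` holomorphic on the two factors, is a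
combination of `dz¹, dz², dz̄³, dz̄⁴`. -/
theorem covector_eq_sum (θ : C2 × C2 →L[ℝ] ℂ)
    (h₁ : ∀ v, θ (Complex.I • v, 0) = Complex.I * θ (v, 0))
    (h₂ : ∀ v, θ (0, Complex.I • v) = -Complex.I * θ (0, v)) :
    ∃ c : Fin 4 → ℂ, θ = ∑ i, c i • mixedCovectors i := by
  have e₁ : ∀ (c : ℂ) (v : C2), θ (c • v, 0) = c * θ (v, 0) := fun c v =>
    smul_of_I_smul (f := fun v => θ (v, 0))
      (fun u v => by rw [← map_add]; simp)
      (fun r v => by rw [← Complex.real_smul, ← map_smul]; simp) h₁ c v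
  have e₂ : ∀ (c : ℂ) (v : C2), conj (θ (0, c • v)) = c * conj (θ (0, v)) := fun c v =>
    smul_of_I_smul (f := fun v => conj (θ (0, v)))
      (fun u v => by rw [← map_add, ← map_add]; simp)
      (fun r v => by
        conv_rhs => rw [← Complex.conj_ofReal, ← map_mul, ← Complex.real_smul, ← map_smul]
        simp)
      (fun v => by rw [h₂]; simp) c v
  have e₃ : ∀ (c : ℂ) (v : C2), θ (0, c • v) = conj c * θ (0, v) := fun c v => by
    have h := congrArg conj (e₂ c v)
    simpa using h
  refine ⟨![θ (stdVec 0, 0), θ (stdVec 1, 0), θ (0, stdVec 0), θ (0, stdVec 1)], ?_⟩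
  refine ContinuousLinearMap.ext fun v => ?_
  have hv : v = (v.1 0 • stdVec 0, 0) + (v.1 1 • stdVec 1, 0) + (0, v.2 0 • stdVec 0)
      + (0, v.2 1 • stdVec 1) := by
    ext1
    · simpa using C2_eq v.1
    · simpa using C2_eq v.2
  conv_lhs => rw [hv]
  simp only [map_add, e₁, e₃]
  simp [Fin.sum_univ_four, mixedCovectors, dz]
  ring

/-- `θ ∧ dz¹ ∧ dz² ∧ dz̄³ ∧ dz̄⁴ = 0` if `θ` is a combination of `dz¹, dz², dz̄³, dz̄⁴`. -/
theorem alternatize_smulRight_dz12bar34 (θ : C2 × C2 →L[ℝ] ℂ)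
    (h₁ : ∀ v, θ (Complex.I • v, 0) = Complex.I * θ (v, 0))
    (h₂ : ∀ v, θ (0, Complex.I • v) = -Complex.I * θ (0, v)) :
    ContinuousAlternatingMap.alternatizeUncurryFin (θ.smulRight dz12bar34) = 0 := by
  obtain ⟨c, rfl⟩ := covector_eq_sum θ h₁ h₂
  rw [dz12bar34_eq, alternatize_smulRight_covectorWedge]
  exact covectorWedge_cons_eq_zero mixedCovectors c

variable {f g : C2 → ℂ} {y : C2 × C2}

/-- The differential of `f ḡ` is complex linear on the first factor and conjugate linear on the
second one. -/
theorem hasFDerivAt_mul_conj (hf : DifferentiableAt ℂ f y.1) (hg : DifferentiableAt ℂ g y.2) :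
    ∃ θ : C2 × C2 →L[ℝ] ℂ, HasFDerivAt (fun y : C2 × C2 => f y.1 * conj (g y.2)) θ y ∧
      (∀ v, θ (Complex.I • v, 0) = Complex.I * θ (v, 0)) ∧
      ∀ v, θ (0, Complex.I • v) = -Complex.I * θ (0, v) := by
  have h1 : HasFDerivAt (fun y : C2 × C2 => f y.1) _ y :=
    (hf.hasFDerivAt.restrictScalars ℝ).comp y hasFDerivAt_fst
  have h2 : HasFDerivAt (fun y : C2 × C2 => conj (g y.2)) _ y :=
    ((Complex.conjCLE : ℂ →L[ℝ] ℂ).hasFDerivAt).comp y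
      ((hg.hasFDerivAt.restrictScalars ℝ).comp y hasFDerivAt_snd)
  refine ⟨_, h1.mul h2, fun v => ?_, fun v => ?_⟩
  · simp
    ring
  · simp
    ring

theorem extDeriv_mul_conj_smul_dz12bar34 (hf : DifferentiableAt ℂ f y.1)
    (hg : DifferentiableAt ℂ g y.2) :
    extDeriv (fun y : C2 × C2 => (f y.1 * conj (g y.2)) • dz12bar34) y = 0 := by
  obtain ⟨θ, hθ, h₁, h₂⟩ := hasFDerivAt_mul_conj hf hg
  rw [extDeriv, (hθ.smul_const dz12bar34).fderiv]
  exact alternatize_smulRight_dz12bar34 θ h₁ h₂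

end Closed

section ProdForm

open Set Topology

variable {S₁ : Type*} [TopologicalSpace S₁] [ChartedSpace C2 S₁]
  {S₂ : Type*} [TopologicalSpace S₂] [ChartedSpace C2 S₂]

theorem coe_extChartAt_prod_symm (a : S₁ × S₂) :
    ((extChartAt prodModel a).symm : C2 × C2 → S₁ × S₂)
      = fun y => ((chartAt C2 a.1).symm y.1, (chartAt C2 a.2).symm y.2) := by
  rw [extChartAt_prod, PartialEquiv.prod_symm, PartialEquiv.prod_coe, coe_extChartAt_symm,
    coe_extChartAt_symm]

theorem extChartAt_prod_target (a : S₁ × S₂) :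
    (extChartAt prodModel a).target = (chartAt C2 a.1).target ×ˢ (chartAt C2 a.2).target := by
  rw [extChartAt_prod, PartialEquiv.prod_target, extChartAt_target', extChartAt_target']

variable {α : CForm C2 S₁ 2} {β : CForm C2 S₂ 2}

/-- The value of the product form at a point, for the tangent space `ℂ² × ℂ²` given by the
preferred charts. -/
theorem prodForm_eq_smul (hα : IsOfType 2 0 α) (hβ : IsOfType 2 0 β) (p : S₁ × S₂) :
    prodForm α β p = (α p.1 ![stdVec 0, stdVec 1] * conj (β p.2 ![stdVec 0, stdVec 1]))
      • dz12bar34 := by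
  have h1 := eq_smul_dz12 (α := α p.1) fun c v => by simpa using hα p.1 c v
  have h2 := eq_smul_dz12 (α := β p.2) fun c v => by simpa using hβ p.2 c v
  rw [prodForm_eq, ← wedge_dz12, ← wedge_smul_smul]
  congr 1
  · conv_lhs => rw [h1]
    rfl
  · conv_lhs => rw [h2]
    ext v
    simp

theorem isOfType_prodForm (hα : IsOfType 2 0 α) (hβ : IsOfType 2 0 β) :
    IsOfType 2 2 (prodForm α β) := by
  intro p c v
  rw [prodForm_eq_smul hα hβ]
  simp only [ContinuousAlternatingMap.smul_apply, dz12bar34_smul, smul_eq_mul]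
  ring

variable [IsManifold 𝓘(ℂ, C2) ω S₁] [IsManifold 𝓘(ℂ, C2) ω S₂]

theorem inCoords_prodForm_chart (hα : IsOfType 2 0 α) (hβ : IsOfType 2 0 β) {a : S₁ × S₂}
    {y : C2 × C2} (hy : y ∈ (extChartAt prodModel a).target) :
    inCoords prodModel (prodForm α β) (extChartAt prodModel a).symm y
      = (localCoeff α (chartAt C2 a.1) y.1 * conj (localCoeff β (chartAt C2 a.2) y.2))
        • dz12bar34 := by
  rw [extChartAt_prod_target] at hy
  rw [coe_extChartAt_prod_symm]
  have h1 := IsManifold.chart_mem_maximalAtlas (I := 𝓘(ℂ, C2)) (n := ω) a.1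
  have h2 := IsManifold.chart_mem_maximalAtlas (I := 𝓘(ℂ, C2)) (n := ω) a.2
  exact inCoords_prodForm (mdifferentiableAt_symm h1 hy.1) (mdifferentiableAt_symm h2 hy.2)
    (inCoords_eq_localCoeff h1 hα hy.1) (inCoords_eq_localCoeff h2 hβ hy.2)

theorem contDiffOn_prodCoeff (hα : IsHolomorphicForm 𝓘(ℝ, C2) α)
    (hβ : IsHolomorphicForm 𝓘(ℝ, C2) β) (a : S₁ × S₂) :
    ContDiffOn ℝ ∞ (fun y : C2 × C2 => localCoeff α (chartAt C2 a.1) y.1 *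
      conj (localCoeff β (chartAt C2 a.2) y.2)) (extChartAt prodModel a).target := by
  rw [extChartAt_prod_target]
  have h1 := IsManifold.chart_mem_maximalAtlas (I := 𝓘(ℂ, C2)) (n := ω) a.1
  have h2 := IsManifold.chart_mem_maximalAtlas (I := 𝓘(ℂ, C2)) (n := ω) a.2
  refine ContDiffOn.mul ?_ ?_
  · exact ((contDiffOn_localCoeff h1 hα).restrict_scalars ℝ).comp contDiff_fst.contDiffOn
      fun y hy => hy.1
  · exact Complex.conjCLE.contDiff.comp_contDiffOn
      (((contDiffOn_localCoeff h2 hβ).restrict_scalars ℝ).comp contDiff_snd.contDiffOn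
        fun y hy => hy.2)

theorem isSmooth_prodForm (hα : IsHolomorphicForm 𝓘(ℝ, C2) α)
    (hβ : IsHolomorphicForm 𝓘(ℝ, C2) β) : IsSmooth prodModel (prodForm α β) := by
  intro a
  refine ((contDiffOn_prodCoeff hα hβ a).smul
    (contDiffOn_const (c := dz12bar34))).congr fun y hy => ?_
  exact inCoords_prodForm_chart hα.1 hβ.1 hy

theorem fderiv_conj_form {E : Type*} [NormedAddCommGroup E] [NormedSpace ℝ E] {k : ℕ}
    {b : E → E [⋀^Fin k]→L[ℝ] ℂ} {y : E} (hb : DifferentiableAt ℝ b y) (x : E) (v : Fin k → E) :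
    fderiv ℝ (fun y => (Complex.conjCLE : ℂ →L[ℝ] ℂ).compContinuousAlternatingMap (b y)) y x v
      = conj (fderiv ℝ b y x v) := by
  have h := ((ContinuousLinearMap.compContinuousAlternatingMapCLM ℝ E ℂ ℂ (Fin k)
    (Complex.conjCLE : ℂ →L[ℝ] ℂ)).hasFDerivAt (x := b y)).comp y hb.hasFDerivAt
  have h2 := h.fderiv
  exact congrArg (fun L : E →L[ℝ] E [⋀^Fin k]→L[ℝ] ℂ => L x v) h2

theorem extD_conjForm {E : Type*} [NormedAddCommGroup E] [NormedSpace ℝ E]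
    {H : Type*} [TopologicalSpace H] {I : ModelWithCorners ℝ E H} [I.Boundaryless]
    {M : Type*} [TopologicalSpace M] [ChartedSpace H M] {k : ℕ} {α : CForm E M k}
    (hα : IsSmooth I α) : extD I (conjForm α) = conjForm (extD I α) := by
  funext x
  ext v
  have hd : DifferentiableAt ℝ (inCoords I α (extChartAt I x).symm) (extChartAt I x x) :=
    ((hα x).contDiffAt (extChartAt_target_mem_nhds x)).differentiableAt (by simp)
  have h : ∀ w, extDeriv (inCoords I (conjForm α) (extChartAt I x).symm) (extChartAt I x x) w
      = conj (extDeriv (inCoords I α (extChartAt I x).symm) (extChartAt I x x) w) := by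
    intro w
    simp only [extDeriv, ContinuousAlternatingMap.alternatizeUncurryFin_apply]
    rw [map_sum]
    refine Finset.sum_congr rfl fun i _ => ?_
    rw [zsmul_eq_mul, zsmul_eq_mul, map_mul, map_intCast, ← fderiv_conj_form hd]
    rfl
  exact h _

theorem extD_prodForm (hα : IsHolomorphicForm 𝓘(ℝ, C2) α)
    (hβ : IsHolomorphicForm 𝓘(ℝ, C2) β) : extD prodModel (prodForm α β) = 0 := by
  funext p
  have h1 := IsManifold.chart_mem_maximalAtlas (I := 𝓘(ℂ, C2)) (n := ω) p.1
  have h2 := IsManifold.chart_mem_maximalAtlas (I := 𝓘(ℂ, C2)) (n := ω) p.2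
  have hev : inCoords prodModel (prodForm α β) (extChartAt prodModel p).symm
      =ᶠ[𝓝 (extChartAt prodModel p p)] fun y => (localCoeff α (chartAt C2 p.1) y.1 *
        conj (localCoeff β (chartAt C2 p.2) y.2)) • dz12bar34 := by
    filter_upwards [extChartAt_target_mem_nhds (I := prodModel) p] with y hy
    exact inCoords_prodForm_chart hα.1 hβ.1 hy
  have hmem := mem_extChartAt_target (I := prodModel) p
  rw [extChartAt_prod_target] at hmem
  have h0 : extDeriv (inCoords prodModel (prodForm α β) (extChartAt prodModel p).symm)
      (extChartAt prodModel p p) = 0 := by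
    rw [hev.extDeriv_eq]
    exact extDeriv_mul_conj_smul_dz12bar34
      ((differentiableOn_localCoeff h1 hα).differentiableAt
        ((chartAt C2 p.1).open_target.mem_nhds hmem.1))
      ((differentiableOn_localCoeff h2 hβ).differentiableAt
        ((chartAt C2 p.2).open_target.mem_nhds hmem.2))
  rw [extD, h0]
  rfl

end ProdForm

/-! ### The operator `∂̄` on the product -/

section Dbar

open Set Topology

theorem antilinearPart_smulRight (θ : C2 × C2 →L[ℝ] ℂ) (γ : (C2 × C2) [⋀^Fin 4]→L[ℝ] ℂ) :
    antilinearPart (θ.smulRight γ) = (antilinearPart θ).smulRight γ := by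
  refine ContinuousLinearMap.ext fun v => ContinuousAlternatingMap.ext fun w => ?_
  simp [antilinearPart_apply]
  ring

variable {S₁ : Type*} [TopologicalSpace S₁] [ChartedSpace C2 S₁]
  {S₂ : Type*} [TopologicalSpace S₂] [ChartedSpace C2 S₂]
  [IsManifold 𝓘(ℂ, C2) ω S₁] [IsManifold 𝓘(ℂ, C2) ω S₂]

/-- Like `d (f₁ f̄₂)`, its conjugate linear part is a combination of `dz¹, dz², dz̄³, dz̄⁴`. -/
theorem dbar_prodForm {α : CForm C2 S₁ 2} {β : CForm C2 S₂ 2}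
    (hα : IsHolomorphicForm 𝓘(ℝ, C2) α)
    (hβ : IsHolomorphicForm 𝓘(ℝ, C2) β) : dbar prodModel (prodForm α β) = 0 := by
  funext p
  have h1 := IsManifold.chart_mem_maximalAtlas (I := 𝓘(ℂ, C2)) (n := ω) p.1
  have h2 := IsManifold.chart_mem_maximalAtlas (I := 𝓘(ℂ, C2)) (n := ω) p.2
  have hev : inCoords prodModel (prodForm α β) (extChartAt prodModel p).symm
      =ᶠ[𝓝 (extChartAt prodModel p p)] fun y => (localCoeff α (chartAt C2 p.1) y.1 *
        conj (localCoeff β (chartAt C2 p.2) y.2)) • dz12bar34 := by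
    filter_upwards [extChartAt_target_mem_nhds (I := prodModel) p] with y hy
    exact inCoords_prodForm_chart hα.1 hβ.1 hy
  have hmem := mem_extChartAt_target (I := prodModel) p
  rw [extChartAt_prod_target] at hmem
  obtain ⟨θ, hθ, e₁, e₂⟩ := hasFDerivAt_mul_conj (y := extChartAt prodModel p p)
      ((differentiableOn_localCoeff h1 hα).differentiableAt
        ((chartAt C2 p.1).open_target.mem_nhds hmem.1))
      ((differentiableOn_localCoeff h2 hβ).differentiableAt
        ((chartAt C2 p.2).open_target.mem_nhds hmem.2))
  have h0 : ContinuousAlternatingMap.alternatizeUncurryFin (antilinearPart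
      (fderiv ℝ (inCoords prodModel (prodForm α β) (extChartAt prodModel p).symm)
        (extChartAt prodModel p p))) = 0 := by
    rw [hev.fderiv_eq, (hθ.smul_const dz12bar34).fderiv, antilinearPart_smulRight]
    refine alternatize_smulRight_dz12bar34 _ (fun v => ?_) fun v => ?_
    · have := antilinearPart_I_smul θ (v, 0)
      have h3 : antilinearPart θ (v, 0) = 0 := by
        have : Complex.I • ((v, 0) : C2 × C2) = (Complex.I • v, 0) := by simp
        rw [antilinearPart_apply, this, e₁, smul_eq_mul, smul_eq_mul]
        linear_combination 2⁻¹ * θ (v, 0) * Complex.I_sq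
      have h4 : Complex.I • ((v, 0) : C2 × C2) = (Complex.I • v, 0) := by simp
      rw [← h4, this, h3]
      simp
    · have := antilinearPart_I_smul θ (0, v)
      have h4 : Complex.I • ((0, v) : C2 × C2) = (0, Complex.I • v) := by simp
      rw [← h4, this, smul_eq_mul]
  rw [dbar, h0]
  rfl

theorem inCoords_type_smul {k : ℕ} {β : CForm (C2 × C2) (S₁ × S₂) k} {r s : ℕ}
    (hβ : IsOfType r s β) {a : S₁ × S₂} {y : C2 × C2}
    (hy : y ∈ (extChartAt prodModel a).target) (c : ℂ) (v : Fin k → C2 × C2) :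
    inCoords prodModel β (extChartAt prodModel a).symm y (fun i => c • v i)
      = c ^ r * conj c ^ s * inCoords prodModel β (extChartAt prodModel a).symm y v := by
  rw [extChartAt_prod_target] at hy
  have h1 := IsManifold.chart_mem_maximalAtlas (I := 𝓘(ℂ, C2)) (n := ω) a.1
  have h2 := IsManifold.chart_mem_maximalAtlas (I := 𝓘(ℂ, C2)) (n := ω) a.2
  obtain ⟨L, hL⟩ : ∃ L : C2 × C2 →L[ℝ] C2 × C2,
      L = mfderiv 𝓘(ℝ, C2 × C2) prodModel (extChartAt prodModel a).symm y := ⟨_, rfl⟩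
  have hLv : ∀ v, L v = (symmDeriv (chartAt C2 a.1) y.1 v.1, symmDeriv (chartAt C2 a.2) y.2 v.2) :=
    fun v => by
      rw [hL, coe_extChartAt_prod_symm]
      exact mfderiv_prod_symm (mdifferentiableAt_symm h1 hy.1) (mdifferentiableAt_symm h2 hy.2) v
  have hc : ∀ v, L (c • v) = c • L v := fun v => by
    rw [hLv, hLv, Prod.smul_fst, Prod.smul_snd, symmDeriv_smul h1 hy.1, symmDeriv_smul h2 hy.2]
    rfl
  have h : ∀ v : Fin k → C2 × C2, inCoords prodModel β (extChartAt prodModel a).symm y v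
      = β ((extChartAt prodModel a).symm y) fun i => L (v i) := fun v => by rw [hL]; rfl
  rw [h, h, ← hβ]
  simp only [hc]

/-- A form changing sign under multiplication of its arguments by `i` has no component
`dz¹ ∧ dz² ∧ dz̄³ ∧ dz̄⁴`, which is invariant. -/
theorem mixedCoeff_eq_zero_of_I_smul {γ : (C2 × C2) [⋀^Fin 4]→L[ℝ] ℂ}
    (h : ∀ v : Fin 4 → C2 × C2, γ (fun i => Complex.I • v i) = -γ v) : mixedCoeff γ = 0 := by
  have h1 := mixedCoeff_comp γ (L := cmul (C2 × C2) Complex.I) (L₁ := cmul C2 Complex.I)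
    (L₂ := cmul C2 Complex.I) (fun v => rfl) (fun v => rfl) (fun v => rfl)
  have h2 : γ.compContinuousLinearMap (cmul (C2 × C2) Complex.I) = (-1 : ℂ) • γ := by
    ext v
    rw [ContinuousAlternatingMap.smul_apply, neg_one_smul, ← h]
    rfl
  have h3 : det2 (cmul C2 Complex.I) = -1 := by
    simp [det2, dz12_apply, cmul, stdVec]
  rw [h2, mixedCoeff_smul, h3] at h1
  simp at h1
  exact self_eq_neg.mp h1.symm

/-- For `β` of type `(2, 1)` the forms `dβ` and `∂̄β` differ by a form of type `(3, 1)`, which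
changes sign under multiplication of its arguments by `i`. -/
theorem mixedCoeff_extD_eq_dbar {β : CForm (C2 × C2) (S₁ × S₂) 3} (hβ : IsSmooth prodModel β)
    (hβ' : IsOfType 2 1 β) (p : S₁ × S₂) :
    mixedCoeff (extD prodModel β p) = mixedCoeff (dbar prodModel β p) := by
  have := isManifold_real ‹IsManifold 𝓘(ℂ, C2) ω S₁›
  have := isManifold_real ‹IsManifold 𝓘(ℂ, C2) ω S₂›
  set b := inCoords prodModel β (extChartAt prodModel p).symm with hb
  set y := extChartAt prodModel p p with hy
  set L := fderiv ℝ b y with hL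
  have hid : mfderiv prodModel 𝓘(ℝ, C2 × C2) (extChartAt prodModel p) p
      = ContinuousLinearMap.id ℝ (C2 × C2) := mfderiv_extChartAt_self
  have hcomp : ∀ γ : (C2 × C2) [⋀^Fin 4]→L[ℝ] ℂ,
      γ.compContinuousLinearMap (ContinuousLinearMap.id ℝ (C2 × C2)) = γ := fun γ => rfl
  have h1 : extD prodModel β p = ContinuousAlternatingMap.alternatizeUncurryFin L :=
    (congrArg (fun D => (ContinuousAlternatingMap.alternatizeUncurryFin L).compContinuousLinearMap D)
      hid)
  have h2 : dbar prodModel β p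
      = ContinuousAlternatingMap.alternatizeUncurryFin (antilinearPart L) :=
    (congrArg (fun D => (ContinuousAlternatingMap.alternatizeUncurryFin
      (antilinearPart L)).compContinuousLinearMap D) hid)
  have hd : DifferentiableAt ℝ b y :=
    ((hβ p).contDiffAt (extChartAt_target_mem_nhds p)).differentiableAt (by simp)
  have hLt : ∀ u (v : Fin 3 → C2 × C2), L u (fun i => Complex.I • v i) = Complex.I * L u v := by
    intro u v
    have hev : (fun y' => b y' fun i => Complex.I • v i) =ᶠ[𝓝 y] fun y' => Complex.I * b y' v := by
      filter_upwards [extChartAt_target_mem_nhds (I := prodModel) p] with y' hy'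
      rw [hb, inCoords_type_smul hβ' hy']
      simp
    have hf := hev.fderiv_eq (𝕜 := ℝ)
    have h3 := fderiv_continuousAlternatingMap_apply_const_apply hd (fun i => Complex.I • v i) u
    have hdv : DifferentiableAt ℝ (fun y' => b y' v) y := by
      exact hd.continuousAlternatingMap_apply_const v
    rw [hf, fderiv_const_mul hdv, smul_apply,
      fderiv_continuousAlternatingMap_apply_const_apply hd] at h3
    exact h3.symm
  have hsub : mixedCoeff (ContinuousAlternatingMap.alternatizeUncurryFin
      (L - antilinearPart L)) = 0 := by
    refine mixedCoeff_eq_zero_of_I_smul fun v => ?_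
    rw [alternatizeUncurryFin_smul_apply (s := Complex.I) (t := Complex.I)]
    · rw [Complex.I_mul_I, neg_one_mul]
    · intro x v
      rw [sub_antilinearPart_I_smul]
      rfl
    · intro x v
      simp only [sub_apply, antilinearPart_apply, ContinuousAlternatingMap.sub_apply,
        ContinuousAlternatingMap.smul_apply, ContinuousAlternatingMap.add_apply, hLt, smul_eq_mul]
      ring
  rw [h1, h2]
  have h4 : ContinuousAlternatingMap.alternatizeUncurryFin L
      = ContinuousAlternatingMap.alternatizeUncurryFin (L - antilinearPart L)
        + ContinuousAlternatingMap.alternatizeUncurryFin (antilinearPart L) := by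
    rw [← ContinuousAlternatingMap.alternatizeUncurryFin_add, sub_add_cancel]
  rw [h4, mixedCoeff_add, hsub, zero_add]

end Dbar

/-! ### Integration of densities on a compact manifold -/

section Density

open Set Topology MeasureTheory

variable {E : Type*} [NormedAddCommGroup E] [NormedSpace ℝ E]
  [MeasurableSpace E] [BorelSpace E] (μ : Measure E) [μ.IsAddHaarMeasure]
  {H : Type*} [TopologicalSpace H] (I : ModelWithCorners ℝ E H) [I.Boundaryless]
  {M : Type*} [TopologicalSpace M] [ChartedSpace H M]

/-- A positive continuous density on a manifold: a positive function `w a` on the image of the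
preferred chart at each point `a`, transforming by the absolute value of the Jacobian. The values of
`w a` outside of the image of the chart are irrelevant. -/
structure IsDensity (w : M → E → ℝ) : Prop where
  continuousOn : ∀ a, ContinuousOn (w a) (extChartAt I a).target
  pos : ∀ a, ∀ y ∈ (extChartAt I a).target, 0 < w a y
  transition : ∀ a b, ∀ y ∈ (extChartAt I a).target,
    (extChartAt I a).symm y ∈ (chartAt H b).source →
    w a y = |(fderiv ℝ (extChartAt I b ∘ (extChartAt I a).symm) y).det| *
      w b (extChartAt I b ((extChartAt I a).symm y))

/-- The integral of a function over the domain of the chart at `a`, with respect to a density. -/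
def chartIntegral (w : M → E → ℝ) (a : M) (F : M → ℂ) : ℂ :=
  ∫ y in (extChartAt I a).target, w a y • F ((extChartAt I a).symm y) ∂μ

variable {I} {w : M → E → ℝ}

theorem integrableOn_chart (hw : IsDensity I w) [CompactSpace M] {a : M} {F : M → ℂ}
    (hF : Continuous F) (hs : tsupport F ⊆ (chartAt H a).source) :
    IntegrableOn (fun y => w a y • F ((extChartAt I a).symm y)) (extChartAt I a).target μ := by
  have hs' : tsupport F ⊆ (extChartAt I a).source := by rwa [extChartAt_source]
  have hsub : extChartAt I a '' tsupport F ⊆ (extChartAt I a).target := by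
    rintro _ ⟨x, hx, rfl⟩
    exact (extChartAt I a).map_source (hs' hx)
  have hK : IsCompact (extChartAt I a '' tsupport F) :=
    (isClosed_tsupport F).isCompact.image_of_continuousOn
      ((continuousOn_extChartAt a).mono hs')
  have hc : ContinuousOn (fun y => w a y • F ((extChartAt I a).symm y)) (extChartAt I a).target :=
    (hw.continuousOn a).smul (hF.comp_continuousOn (continuousOn_extChartAt_symm a))
  refine ((hc.mono hsub).integrableOn_compact hK).of_forall_sdiff_eq_zero
    (isOpen_extChartAt_target a).measurableSet fun y hy => ?_
  have : F ((extChartAt I a).symm y) = 0 := by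
    by_contra h
    exact hy.2 ⟨_, subset_tsupport F h, (extChartAt I a).right_inv hy.1⟩
  rw [this, smul_zero]

variable [FiniteDimensional ℝ E]

/-- The integral does not depend on the chart. -/
theorem chartIntegral_eq (hw : IsDensity I w) [IsManifold I ∞ M] {a b : M} {F : M → ℂ}
    (ha : ∀ x, F x ≠ 0 → x ∈ (chartAt H a).source) (hb : ∀ x, F x ≠ 0 → x ∈ (chartAt H b).source) :
    chartIntegral μ I w a F = chartIntegral μ I w b F := by
  set T := extChartAt I b ∘ (extChartAt I a).symm with hT
  have key : ∀ a b : M, IsOpen ((extChartAt I a).target ∩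
      (extChartAt I a).symm ⁻¹' (chartAt H b).source) := fun a b =>
    (continuousOn_extChartAt_symm a).isOpen_inter_preimage (isOpen_extChartAt_target a)
      (chartAt H b).open_source
  have hrestrict : ∀ a b : M, (∀ x, F x ≠ 0 → x ∈ (chartAt H b).source) →
      chartIntegral μ I w a F = ∫ y in (extChartAt I a).target ∩
        (extChartAt I a).symm ⁻¹' (chartAt H b).source, w a y • F ((extChartAt I a).symm y) ∂μ := by
    intro a b h
    refine (setIntegral_eq_of_subset_of_forall_sdiff_eq_zero
      (isOpen_extChartAt_target a).measurableSet inter_subset_left fun y hy => ?_)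
    have : F ((extChartAt I a).symm y) = 0 := by
      by_contra h0
      exact hy.2 ⟨hy.1, h _ h0⟩
    rw [this, smul_zero]
  have himage : T '' ((extChartAt I a).target ∩ (extChartAt I a).symm ⁻¹' (chartAt H b).source)
      = (extChartAt I b).target ∩ (extChartAt I b).symm ⁻¹' (chartAt H a).source := by
    ext z
    constructor
    · rintro ⟨y, ⟨hy, hyb⟩, rfl⟩
      have hyb' : (extChartAt I a).symm y ∈ (extChartAt I b).source := by
        rwa [extChartAt_source]
      refine ⟨(extChartAt I b).map_source hyb', ?_⟩
      rw [mem_preimage, hT, Function.comp_apply, (extChartAt I b).left_inv hyb',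
        ← extChartAt_source I]
      exact (extChartAt I a).map_target hy
    · rintro ⟨hz, hza⟩
      have hza' : (extChartAt I b).symm z ∈ (extChartAt I a).source := by
        rwa [extChartAt_source]
      refine ⟨extChartAt I a ((extChartAt I b).symm z), ⟨(extChartAt I a).map_source hza', ?_⟩, ?_⟩
      · rw [mem_preimage, (extChartAt I a).left_inv hza', ← extChartAt_source I]
        exact (extChartAt I b).map_target hz
      · rw [hT, Function.comp_apply, (extChartAt I a).left_inv hza', (extChartAt I b).right_inv hz]
  have hinj : InjOn T ((extChartAt I a).target ∩
      (extChartAt I a).symm ⁻¹' (chartAt H b).source) := by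
    rintro y ⟨hy, hyb⟩ z ⟨hz, hzb⟩ h
    rw [mem_preimage, ← extChartAt_source I] at hyb hzb
    exact (extChartAt I a).symm.injOn hy hz ((extChartAt I b).injOn hyb hzb h)
  rw [hrestrict a b hb, hrestrict b a ha, ← himage,
    integral_image_eq_integral_abs_det_fderiv_smul μ (key a b).measurableSet
      (f' := fun y => fderiv ℝ T y) (fun y hy =>
        ((contDiffAt_extChartAt_comp_symm I hy.1 hy.2).differentiableAt
          (by simp)).hasFDerivAt.hasFDerivWithinAt) hinj]
  refine setIntegral_congr_fun (key a b).measurableSet fun y hy => ?_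
  have hyb : (extChartAt I a).symm y ∈ (extChartAt I b).source := by
    rw [extChartAt_source]; exact hy.2
  simp only [hT, Function.comp_apply, (extChartAt I b).left_inv hyb]
  rw [smul_smul, hw.transition a b y hy.1 hy.2]

/-- On a compact manifold with a positive density, the function `1` is not a sum of functions
supported in charts with vanishing integrals. With a partition of unity `ρ`, otherwise
`∑ j, ∫ ρ j = ∑ i, ∑ j, ∫ ρ j * F i = ∑ i, ∫ F i = 0`, where each integral is taken in a chart
containing the support. -/
theorem not_sum_eq_one_of_chartIntegral_eq_zero (hw : IsDensity I w) [IsManifold I ∞ M]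
    [CompactSpace M] [Nonempty M] {ι : Type*} [Fintype ι] (a : ι → M) (ρ : ι → M → ℝ)
    (hρc : ∀ i, Continuous (ρ i)) (hρ0 : ∀ i x, 0 ≤ ρ i x) (hρ1 : ∀ x, ∑ i, ρ i x = 1)
    (hρs : ∀ i, tsupport (ρ i) ⊆ (chartAt H (a i)).source)
    (F : ι → M → ℂ) (hFc : ∀ i, Continuous (F i))
    (hFs : ∀ i, tsupport (F i) ⊆ (chartAt H (a i)).source)
    (hF0 : ∀ i, chartIntegral μ I w (a i) (F i) = 0) : ¬ ∀ x, ∑ i, F i x = 1 := by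
  intro hF1
  have hsuppF : ∀ i j, tsupport (fun x => (ρ j x : ℂ) * F i x) ⊆ tsupport (F i) := fun i j =>
    closure_mono fun x hx => right_ne_zero_of_mul hx
  have hsuppρ : ∀ i j, tsupport (fun x => (ρ j x : ℂ) * F i x) ⊆ tsupport (ρ j) := fun i j =>
    closure_mono fun x hx => by simpa using left_ne_zero_of_mul hx
  have hcont : ∀ i j, Continuous (fun x => (ρ j x : ℂ) * F i x) := fun i j =>
    (Complex.continuous_ofReal.comp (hρc j)).mul (hFc i)
  have h1 : ∀ j, chartIntegral μ I w (a j) (fun x => (ρ j x : ℂ))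
      = ∑ i, chartIntegral μ I w (a j) (fun x => (ρ j x : ℂ) * F i x) := by
    intro j
    simp only [chartIntegral]
    rw [← integral_finsetSum _ fun i _ =>
      integrableOn_chart μ hw (hcont i j) ((hsuppρ i j).trans (hρs j))]
    congr 1
    funext y
    rw [← Finset.smul_sum, ← Finset.mul_sum, hF1, mul_one]
  have h2 : ∀ i, chartIntegral μ I w (a i) (F i)
      = ∑ j, chartIntegral μ I w (a i) (fun x => (ρ j x : ℂ) * F i x) := by
    intro i
    simp only [chartIntegral]
    rw [← integral_finsetSum _ fun j _ =>
      integrableOn_chart μ hw (hcont i j) ((hsuppF i j).trans (hFs i))]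
    congr 1
    funext y
    rw [← Finset.smul_sum, ← Finset.sum_mul, ← Complex.ofReal_sum, hρ1, Complex.ofReal_one, one_mul]
  have h3 : ∑ j, chartIntegral μ I w (a j) (fun x => (ρ j x : ℂ)) = 0 := by
    simp only [h1]
    rw [Finset.sum_comm]
    refine Finset.sum_eq_zero fun i _ => ?_
    rw [← hF0 i, h2]
    refine Finset.sum_congr rfl fun j _ => chartIntegral_eq μ hw ?_ ?_
    · exact fun x hx => hρs j (hsuppρ i j (subset_tsupport _ hx))
    · exact fun x hx => hFs i (hsuppF i j (subset_tsupport _ hx))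
  -- the integrals of the functions `ρ j` are nonnegative, and one of them is positive
  set J : ι → ℝ := fun j => ∫ y in (extChartAt I (a j)).target,
    w (a j) y * ρ j ((extChartAt I (a j)).symm y) ∂μ with hJ
  have h4 : ∀ j, chartIntegral μ I w (a j) (fun x => (ρ j x : ℂ)) = (J j : ℂ) := by
    intro j
    rw [chartIntegral, hJ, ← integral_complex_ofReal]
    congr 1
    funext y
    simp
  have hnn : ∀ j, ∀ y ∈ (extChartAt I (a j)).target,
      0 ≤ w (a j) y * ρ j ((extChartAt I (a j)).symm y) := fun j y hy =>
    mul_nonneg (hw.pos _ y hy).le (hρ0 _ _)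
  have hJ0 : ∀ j, 0 ≤ J j := fun j =>
    setIntegral_nonneg (isOpen_extChartAt_target (a j)).measurableSet (hnn j)
  obtain ⟨x₀⟩ := ‹Nonempty M›
  obtain ⟨j, hj⟩ : ∃ j, ρ j x₀ ≠ 0 := by
    by_contra h
    push Not at h
    have := hρ1 x₀
    simp [h] at this
  have hint : IntegrableOn (fun y => w (a j) y * ρ j ((extChartAt I (a j)).symm y))
      (extChartAt I (a j)).target μ := by
    have h := integrableOn_chart μ hw (a := a j) (F := fun x => (ρ j x : ℂ))
      (Complex.continuous_ofReal.comp (hρc j))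
      ((closure_mono fun x hx => by simpa using hx).trans (hρs j))
    have h5 := h.re
    refine h5.congr (Filter.Eventually.of_forall fun y => ?_)
    simp
  have hx₀ : x₀ ∈ (extChartAt I (a j)).source := by
    rw [extChartAt_source]; exact hρs j (subset_tsupport _ hj)
  have hJpos : 0 < J j := by
    rw [hJ, setIntegral_pos_iff_support_of_nonneg_ae
      ((ae_restrict_iff' (isOpen_extChartAt_target (a j)).measurableSet).mpr
        (Filter.Eventually.of_forall (hnn j))) hint]
    have hopen : IsOpen ((extChartAt I (a j)).target ∩
        (fun y => w (a j) y * ρ j ((extChartAt I (a j)).symm y)) ⁻¹' {0}ᶜ) := by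
      refine ContinuousOn.isOpen_inter_preimage ?_ (isOpen_extChartAt_target (a j))
        isOpen_compl_singleton
      exact (hw.continuousOn _).mul ((hρc j).comp_continuousOn (continuousOn_extChartAt_symm _))
    rw [inter_comm]
    refine hopen.measure_pos μ ⟨extChartAt I (a j) x₀, (extChartAt I (a j)).map_source hx₀, ?_⟩
    have hne := (hw.pos (a j) _ ((extChartAt I (a j)).map_source hx₀)).ne'
    rw [mem_preimage, (extChartAt I (a j)).left_inv hx₀]
    exact mul_ne_zero hne hj
  have h5 : (0 : ℝ) < ∑ j, J j := Finset.sum_pos' (fun j _ => hJ0 j) ⟨j, Finset.mem_univ j, hJpos⟩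
  simp only [h4, ← Complex.ofReal_sum] at h3
  exact h5.ne' (by exact_mod_cast h3)

/-- **Stokes' theorem** for compactly supported forms on a vector space, contracted with constant
vectors. -/
theorem integral_extDeriv_eq_zero {k : ℕ} {b : E → E [⋀^Fin k]→L[ℝ] ℂ} (hb : ContDiff ℝ 1 b)
    (hs : HasCompactSupport b) (m : Fin (k + 1) → E) :
    Integrable (fun y => extDeriv b y m) μ ∧ ∫ y, extDeriv b y m ∂μ = 0 := by
  have hd : Differentiable ℝ b := hb.differentiable one_ne_zero
  have hterm : ∀ i : Fin (k + 1), Integrable (fun y => fderiv ℝ b y (m i) (i.removeNth m)) μ ∧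
      ∫ y, fderiv ℝ b y (m i) (i.removeNth m) ∂μ = 0 := by
    intro i
    set c : E → ℂ := fun y => b y (i.removeNth m) with hc
    have hcd : ContDiff ℝ 1 c :=
      (ContinuousAlternatingMap.apply ℝ E ℂ (i.removeNth m)).contDiff.comp hb
    have hcs : HasCompactSupport c :=
      hs.comp_left (g := fun β : E [⋀^Fin k]→L[ℝ] ℂ => β (i.removeNth m)) rfl
    have he : ∀ y, fderiv ℝ b y (m i) (i.removeNth m) = fderiv ℝ c y (m i) := fun y =>
      (fderiv_continuousAlternatingMap_apply_const_apply (hd y) _ _).symm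
    simp only [he]
    have hfc : Continuous fun y => fderiv ℝ c y (m i) :=
      (hcd.continuous_fderiv one_ne_zero).clm_apply continuous_const
    have hfs : HasCompactSupport fun y => fderiv ℝ c y (m i) :=
      (hcs.fderiv (𝕜 := ℝ)).comp_left (g := fun L : E →L[ℝ] ℂ => L (m i)) rfl
    have hint := hfc.integrable_of_hasCompactSupport (μ := μ) hfs
    refine ⟨hint, ?_⟩
    have h := integral_smul_fderiv_eq_neg_fderiv_smul_of_integrable (μ := μ) (𝕜 := ℝ)
      (f := fun _ => (1 : ℝ)) (g := c) (v := m i) (by simp) (by simpa using hint)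
      (by simpa using hcd.continuous.integrable_of_hasCompactSupport hcs)
      (by fun_prop) (fun x _ => hcd.differentiable one_ne_zero x)
    simpa using h
  simp only [extDeriv, ContinuousAlternatingMap.alternatizeUncurryFin_apply, zsmul_eq_mul]
  refine ⟨integrable_finsetSum _ fun i _ => (hterm i).1.const_mul _, ?_⟩
  rw [integral_finsetSum _ fun i _ => (hterm i).1.const_mul _]
  refine Finset.sum_eq_zero fun i _ => ?_
  rw [integral_const_mul, (hterm i).2, mul_zero]

end Density

/-! ### The density `|f₁|² |f₂|²` and the integral over the product -/

section Jacobian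

theorem det2_apply (L : C2 →L[ℝ] C2) :
    det2 L = L (stdVec 0) 0 * L (stdVec 1) 1 - L (stdVec 1) 0 * L (stdVec 0) 1 := by
  simp [det2, dz12_apply]

/-- The real Jacobian of a complex linear map is the squared modulus of its determinant. -/
theorem det_restrictScalars_C2 (L : C2 →L[ℂ] C2) :
    LinearMap.det ((L : C2 →ₗ[ℂ] C2).restrictScalars ℝ) = ‖det2 (L.restrictScalars ℝ)‖ ^ 2 := by
  rw [LinearMap.det_restrictScalars, Algebra.norm_complex_apply, Complex.normSq_eq_norm_sq]
  congr 2
  rw [← LinearMap.det_toMatrix (EuclideanSpace.basisFun (Fin 2) ℂ).toBasis, Matrix.det_fin_two,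
    det2_apply]
  simp [LinearMap.toMatrix_apply, stdVec]

theorem det_prodMap_C2 {L : C2 × C2 →L[ℝ] C2 × C2} {L₁ L₂ : C2 →L[ℂ] C2}
    (hL : ∀ v, L v = (L₁ v.1, L₂ v.2)) :
    L.det = ‖det2 (L₁.restrictScalars ℝ)‖ ^ 2 * ‖det2 (L₂.restrictScalars ℝ)‖ ^ 2 := by
  rw [← det_restrictScalars_C2, ← det_restrictScalars_C2, ← LinearMap.det_prodMap]
  have h : (L : C2 × C2 →ₗ[ℝ] C2 × C2)
      = ((L₁ : C2 →ₗ[ℂ] C2).restrictScalars ℝ).prodMap ((L₂ : C2 →ₗ[ℂ] C2).restrictScalars ℝ) :=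
    LinearMap.ext hL
  rw [← h]

end Jacobian

section Integral

open Set Topology MeasureTheory

variable {S₁ : Type*} [TopologicalSpace S₁] [ChartedSpace C2 S₁]
  {S₂ : Type*} [TopologicalSpace S₂] [ChartedSpace C2 S₂]

/-- The density on `S₁ × S₂` given in local coordinates by `|f₁|² |f₂|²`, where `f₁` and `f₂` are
the coefficients of `α` and `β`. -/
def prodDensity (α : CForm C2 S₁ 2) (β : CForm C2 S₂ 2) (a : S₁ × S₂) (y : C2 × C2) : ℝ :=
  ‖localCoeff α (chartAt C2 a.1) y.1‖ ^ 2 * ‖localCoeff β (chartAt C2 a.2) y.2‖ ^ 2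

variable {α : CForm C2 S₁ 2} {β : CForm C2 S₂ 2}

/-- The function `u` with `γ ∧ ψ̄ = u ψ ∧ ψ̄`, where `ψ` is the product form of `α` and `β`: the
wedge product with `ψ̄` only sees the component `dz¹ ∧ dz² ∧ dz̄³ ∧ dz̄⁴`. -/
def formRatio (α : CForm C2 S₁ 2) (β : CForm C2 S₂ 2) (γ : CForm (C2 × C2) (S₁ × S₂) 4)
    (p : S₁ × S₂) : ℂ :=
  mixedCoeff (γ p) / mixedCoeff (prodForm α β p)

theorem IsNowhereVanishingHolomorphic.apply_stdVec_ne_zero {S : Type*} [TopologicalSpace S]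
    [ChartedSpace C2 S] {α : CForm C2 S 2} (hα : IsNowhereVanishingHolomorphic α) (x : S) :
    α x ![stdVec 0, stdVec 1] ≠ 0 := by
  intro h0
  apply hα.2 x
  rw [eq_smul_dz12 (α := α x) fun c v => by simpa using hα.1.1 x c v, h0]
  ext v
  exact zero_mul _

theorem mixedCoeff_prodForm_ne_zero (hα : IsNowhereVanishingHolomorphic α)
    (hβ : IsNowhereVanishingHolomorphic β) (p : S₁ × S₂) : mixedCoeff (prodForm α β p) ≠ 0 := by
  rw [prodForm_eq_smul hα.1.1 hβ.1.1, mixedCoeff_smul, mixedCoeff_dz12bar34, mul_one]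
  exact mul_ne_zero (hα.apply_stdVec_ne_zero p.1) (by simpa using hβ.apply_stdVec_ne_zero p.2)

variable [IsManifold 𝓘(ℂ, C2) ω S₁] [IsManifold 𝓘(ℂ, C2) ω S₂]

theorem isDensity_prodDensity (hα : IsNowhereVanishingHolomorphic α)
    (hβ : IsNowhereVanishingHolomorphic β) : IsDensity prodModel (prodDensity α β) := by
  have h1 := fun x : S₁ => IsManifold.chart_mem_maximalAtlas (I := 𝓘(ℂ, C2)) (n := ω) x
  have h2 := fun x : S₂ => IsManifold.chart_mem_maximalAtlas (I := 𝓘(ℂ, C2)) (n := ω) x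
  refine ⟨fun a => ?_, fun a y hy => ?_, fun a b y hy hb => ?_⟩
  · rw [extChartAt_prod_target]
    refine ContinuousOn.mul (ContinuousOn.pow (ContinuousOn.norm ?_) 2)
      (ContinuousOn.pow (ContinuousOn.norm ?_) 2)
    · exact (differentiableOn_localCoeff (h1 a.1) hα.1).continuousOn.comp
        continuousOn_fst fun y hy => hy.1
    · exact (differentiableOn_localCoeff (h2 a.2) hβ.1).continuousOn.comp
        continuousOn_snd fun y hy => hy.2
  · rw [extChartAt_prod_target] at hy
    have := norm_pos_iff.mpr (localCoeff_ne_zero (h1 a.1) hα hy.1)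
    have := norm_pos_iff.mpr (localCoeff_ne_zero (h2 a.2) hβ hy.2)
    unfold prodDensity
    positivity
  · rw [extChartAt_prod_target] at hy
    rw [coe_extChartAt_prod_symm] at hb ⊢
    have hb1 : (chartAt C2 a.1).symm y.1 ∈ (chartAt C2 b.1).source := hb.1
    have hb2 : (chartAt C2 a.2).symm y.2 ∈ (chartAt C2 b.2).source := hb.2
    have hcoe : (extChartAt prodModel b : S₁ × S₂ → C2 × C2)
        = fun p => (chartAt C2 b.1 p.1, chartAt C2 b.2 p.2) := by
      rw [extChartAt_prod, PartialEquiv.prod_coe, coe_extChartAt, coe_extChartAt]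
    have hd1 : DifferentiableAt ℂ (chartAt C2 b.1 ∘ (chartAt C2 a.1).symm) y.1 :=
      (contDiffAt_transition (h1 a.1) (h1 b.1) hy.1 hb1).differentiableAt (by simp)
    have hd2 : DifferentiableAt ℂ (chartAt C2 b.2 ∘ (chartAt C2 a.2).symm) y.2 :=
      (contDiffAt_transition (h2 a.2) (h2 b.2) hy.2 hb2).differentiableAt (by simp)
    have hderiv : HasFDerivAt (extChartAt prodModel b ∘
        fun y : C2 × C2 => ((chartAt C2 a.1).symm y.1, (chartAt C2 a.2).symm y.2))
        ((((fderiv ℂ (chartAt C2 b.1 ∘ (chartAt C2 a.1).symm) y.1).restrictScalars ℝ).comp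
          (ContinuousLinearMap.fst ℝ C2 C2)).prod
          (((fderiv ℂ (chartAt C2 b.2 ∘ (chartAt C2 a.2).symm) y.2).restrictScalars ℝ).comp
          (ContinuousLinearMap.snd ℝ C2 C2))) y := by
      rw [hcoe]
      exact ((hd1.hasFDerivAt.restrictScalars ℝ).comp y hasFDerivAt_fst).prodMk
        ((hd2.hasFDerivAt.restrictScalars ℝ).comp y hasFDerivAt_snd)
    rw [hderiv.fderiv, det_prodMap_C2 (L₁ := fderiv ℂ (chartAt C2 b.1 ∘ (chartAt C2 a.1).symm) y.1)
      (L₂ := fderiv ℂ (chartAt C2 b.2 ∘ (chartAt C2 a.2).symm) y.2) (fun v => rfl), hcoe]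
    unfold prodDensity
    rw [localCoeff_transition (h1 a.1) (h1 b.1) hα.1.1 hy.1 hb1,
      localCoeff_transition (h2 a.2) (h2 b.2) hβ.1.1 hy.2 hb2, norm_mul, norm_mul,
      abs_of_nonneg (by positivity)]
    ring

theorem formRatio_chart (hα : IsNowhereVanishingHolomorphic α)
    (hβ : IsNowhereVanishingHolomorphic β) (γ : CForm (C2 × C2) (S₁ × S₂) 4) {a : S₁ × S₂}
    {y : C2 × C2} (hy : y ∈ (extChartAt prodModel a).target) :
    formRatio α β γ ((extChartAt prodModel a).symm y)
      = mixedCoeff (inCoords prodModel γ (extChartAt prodModel a).symm y) /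
        (localCoeff α (chartAt C2 a.1) y.1 * conj (localCoeff β (chartAt C2 a.2) y.2)) := by
  have hψ := inCoords_prodForm_chart hα.1.1 hβ.1.1 hy
  rw [extChartAt_prod_target] at hy
  have h1 := IsManifold.chart_mem_maximalAtlas (I := 𝓘(ℂ, C2)) (n := ω) a.1
  have h2 := IsManifold.chart_mem_maximalAtlas (I := 𝓘(ℂ, C2)) (n := ω) a.2
  have hcomp : ∀ γ : CForm (C2 × C2) (S₁ × S₂) 4,
      mixedCoeff (inCoords prodModel γ (extChartAt prodModel a).symm y)
      = det2 (symmDeriv (chartAt C2 a.1) y.1) * conj (det2 (symmDeriv (chartAt C2 a.2) y.2)) *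
        mixedCoeff (γ ((extChartAt prodModel a).symm y)) := fun γ => by
    refine mixedCoeff_comp (γ ((extChartAt prodModel a).symm y)) (symmDeriv_smul h1 hy.1 _)
      (symmDeriv_smul h2 hy.2 _) fun v => ?_
    rw [coe_extChartAt_prod_symm]
    exact mfderiv_prod_symm (mdifferentiableAt_symm h1 hy.1) (mdifferentiableAt_symm h2 hy.2) v
  have hψ' := hcomp (prodForm α β)
  rw [hψ, mixedCoeff_smul, mixedCoeff_dz12bar34, mul_one] at hψ'
  have hne : localCoeff α (chartAt C2 a.1) y.1 * conj (localCoeff β (chartAt C2 a.2) y.2) ≠ 0 :=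
    mul_ne_zero (localCoeff_ne_zero h1 hα hy.1) (by simpa using localCoeff_ne_zero h2 hβ hy.2)
  rw [hψ'] at hne ⊢
  rw [hcomp γ, formRatio, mul_div_mul_left _ _ (left_ne_zero_of_mul hne)]

theorem continuous_mixedCoeff : Continuous mixedCoeff := by
  have h : ∀ v : Fin 4 → C2 × C2, Continuous fun γ : (C2 × C2) [⋀^Fin 4]→L[ℝ] ℂ => γ v := fun v =>
    (ContinuousAlternatingMap.apply ℝ (C2 × C2) ℂ v).continuous
  unfold mixedCoeff mixedPart linPart antiPart
  fun_prop

theorem continuousOn_extDeriv {E : Type*} [NormedAddCommGroup E] [NormedSpace ℝ E] {k : ℕ}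
    {b : E → E [⋀^Fin k]→L[ℝ] ℂ} {U : Set E} (hU : IsOpen U) (hb : ContDiffOn ℝ ∞ b U) :
    ContinuousOn (extDeriv b) U :=
  (ContinuousAlternatingMap.alternatizeUncurryFinCLM ℝ E ℂ).continuous.comp_continuousOn
    (hb.continuousOn_fderiv_of_isOpen hU (by simp))

theorem continuous_formRatio_extD (hα : IsNowhereVanishingHolomorphic α)
    (hβ : IsNowhereVanishingHolomorphic β) {γ : CForm (C2 × C2) (S₁ × S₂) 3}
    (hγ : IsSmooth prodModel γ) : Continuous (formRatio α β (extD prodModel γ)) := by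
  have := isManifold_real ‹IsManifold 𝓘(ℂ, C2) ω S₁›
  have := isManifold_real ‹IsManifold 𝓘(ℂ, C2) ω S₂›
  rw [continuous_iff_continuousAt]
  intro p
  have hev : formRatio α β (extD prodModel γ) =ᶠ[𝓝 p] fun x =>
      mixedCoeff (extDeriv (inCoords prodModel γ (extChartAt prodModel p).symm)
        (extChartAt prodModel p x)) /
        (localCoeff α (chartAt C2 p.1) (extChartAt prodModel p x).1 *
          conj (localCoeff β (chartAt C2 p.2) (extChartAt prodModel p x).2)) := by
    filter_upwards [extChartAt_source_mem_nhds (I := prodModel) p] with x hx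
    have h := formRatio_chart hα hβ (extD prodModel γ) ((extChartAt prodModel p).map_source hx)
    rw [(extChartAt prodModel p).left_inv hx, inCoords_extD prodModel hγ
      ((extChartAt prodModel p).map_source hx)] at h
    exact h
  refine ContinuousAt.congr ?_ hev.symm
  have hc := continuousAt_extChartAt (I := prodModel) p
  have hmem := extChartAt_target_mem_nhds (I := prodModel) p
  refine ContinuousAt.div ?_ ?_ ?_
  · exact continuous_mixedCoeff.continuousAt.comp
      (ContinuousAt.comp (f := extChartAt prodModel p)
        ((continuousOn_extDeriv (isOpen_extChartAt_target p) (hγ p)).continuousAt hmem) hc)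
  · exact ContinuousAt.comp (f := extChartAt prodModel p)
      (g := fun y : C2 × C2 => localCoeff α (chartAt C2 p.1) y.1 *
        conj (localCoeff β (chartAt C2 p.2) y.2))
      ((contDiffOn_prodCoeff hα.1 hβ.1 p).continuousOn.continuousAt hmem) hc
  · have hy := mem_extChartAt_target (I := prodModel) p
    rw [extChartAt_prod_target] at hy
    have h1 := IsManifold.chart_mem_maximalAtlas (I := 𝓘(ℂ, C2)) (n := ω) p.1
    have h2 := IsManifold.chart_mem_maximalAtlas (I := 𝓘(ℂ, C2)) (n := ω) p.2
    exact mul_ne_zero (localCoeff_ne_zero h1 hα hy.1) (by simpa using localCoeff_ne_zero h2 hβ hy.2)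

end Integral

/-! ### Non-exactness of the product form -/

section Locality

open Set Topology

variable {E : Type*} [NormedAddCommGroup E] [NormedSpace ℝ E]
  {H : Type*} [TopologicalSpace H] {I : ModelWithCorners ℝ E H}
  {M : Type*} [TopologicalSpace M] [ChartedSpace H M] {k : ℕ}

theorem IsSmooth.real_smul [IsManifold I ∞ M] {ρ : M → ℝ} (hρ : ContMDiff I 𝓘(ℝ) ∞ ρ)
    {γ : CForm E M k} (hγ : IsSmooth I γ) : IsSmooth I fun x => ρ x • γ x := by
  intro a
  have h : ContDiffOn ℝ ∞ (fun y => ρ ((extChartAt I a).symm y)) (extChartAt I a).target :=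
    (hρ.comp_contMDiffOn (contMDiffOn_extChartAt_symm a)).contDiffOn
  exact h.smul (hγ a)

theorem extDeriv_const_zero (y : E) : extDeriv (fun _ => (0 : E [⋀^Fin k]→L[ℝ] ℂ)) y = 0 := by
  ext v
  simp [extDeriv, ContinuousAlternatingMap.alternatizeUncurryFin_apply]

theorem extD_eq_zero_of_notMem_tsupport {γ : CForm E M k} {x : M} (hx : x ∉ tsupport γ) :
    extD I γ x = 0 := by
  have hev : inCoords I γ (extChartAt I x).symm =ᶠ[𝓝 (extChartAt I x x)] fun _ => 0 := by
    have hc : ContinuousAt (extChartAt I x).symm (extChartAt I x x) :=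
      continuousAt_extChartAt_symm x
    have hn : (tsupport γ)ᶜ ∈ 𝓝 ((extChartAt I x).symm (extChartAt I x x)) := by
      rw [extChartAt_to_inv]
      exact (isClosed_tsupport γ).isOpen_compl.mem_nhds hx
    filter_upwards [hc hn] with y hy
    rw [inCoords, image_eq_zero_of_notMem_tsupport hy]
    rfl
  rw [extD, hev.extDeriv_eq, extDeriv_const_zero]
  rfl

variable [NormedSpace ℂ E] [IsScalarTower ℝ ℂ E]

theorem IsSmooth.sum {ι : Type*} {s : Finset ι} {γ : ι → CForm E M k}
    (hγ : ∀ i, IsSmooth I (γ i)) : IsSmooth I (∑ i ∈ s, γ i) := by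
  classical
  induction s using Finset.induction_on with
  | empty => rw [Finset.sum_empty]; exact .zero
  | insert i s hi ih => rw [Finset.sum_insert hi]; exact (hγ i).add ih

theorem extD_sum [I.Boundaryless] {ι : Type*} {s : Finset ι} {γ : ι → CForm E M k}
    (hγ : ∀ i, IsSmooth I (γ i)) : extD I (∑ i ∈ s, γ i) = ∑ i ∈ s, extD I (γ i) := by
  classical
  induction s using Finset.induction_on with
  | empty => rw [Finset.sum_empty, Finset.sum_empty, extD_zero]
  | insert i s hi ih => rw [Finset.sum_insert hi, Finset.sum_insert hi,
      (hγ i).extD_add (IsSmooth.sum hγ), ih]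

end Locality

theorem mixedCoeff_zero : mixedCoeff 0 = 0 := by
  simp [mixedCoeff, mixedPart, linPart, antiPart]

section MixedIntegral

open MeasureTheory

variable [MeasurableSpace (C2 × C2)] (μ : Measure (C2 × C2))

/-- If the coefficients of a 4-form on `ℂ² × ℂ²` have vanishing integrals, then so does the
coefficient of `dz¹ ∧ dz² ∧ dz̄³ ∧ dz̄⁴`. -/
theorem integral_mixedCoeff_eq_zero {G : C2 × C2 → (C2 × C2) [⋀^Fin 4]→L[ℝ] ℂ}
    (hG : ∀ v, Integrable (fun y => G y v) μ ∧ ∫ y, G y v ∂μ = 0) :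
    ∫ y, mixedCoeff (G y) ∂μ = 0 := by
  have hlin : ∀ (f : C2 × C2 → C2 → ℂ),
      (∀ v, Integrable (fun y => f y v) μ ∧ ∫ y, f y v ∂μ = 0) → ∀ v,
      Integrable (fun y => linPart (f y) v) μ ∧ ∫ y, linPart (f y) v ∂μ = 0 := fun f hf v => by
    refine ⟨((hf v).1.sub ((hf _).1.const_mul _)).const_mul _, ?_⟩
    simp only [linPart]
    rw [integral_const_mul, integral_sub (hf v).1 ((hf _).1.const_mul _), integral_const_mul,
      (hf _).2, (hf _).2]
    simp
  have hanti : ∀ (f : C2 × C2 → C2 → ℂ),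
      (∀ v, Integrable (fun y => f y v) μ ∧ ∫ y, f y v ∂μ = 0) → ∀ v,
      Integrable (fun y => antiPart (f y) v) μ ∧ ∫ y, antiPart (f y) v ∂μ = 0 := fun f hf v => by
    refine ⟨((hf v).1.add ((hf _).1.const_mul _)).const_mul _, ?_⟩
    simp only [antiPart]
    rw [integral_const_mul, integral_add (hf v).1 ((hf _).1.const_mul _), integral_const_mul,
      (hf _).2, (hf _).2]
    simp
  have h₄ := fun a b c => hanti (fun y d => G y ![(a, 0), (b, 0), (0, c), (0, d)]) fun d => hG _
  have h₃ := fun a b => hanti _ fun c => h₄ a b c (stdVec 1)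
  have h₂ := fun a => hlin _ fun b => h₃ a b (stdVec 0)
  have h₁ := hlin _ fun a => h₂ a (stdVec 1)
  exact (h₁ (stdVec 0)).2

end MixedIntegral

section Exactness

open Set Topology MeasureTheory

variable {S₁ : Type*} [TopologicalSpace S₁] [ChartedSpace C2 S₁]
  {S₂ : Type*} [TopologicalSpace S₂] [ChartedSpace C2 S₂]
  {α : CForm C2 S₁ 2} {β : CForm C2 S₂ 2}

theorem tsupport_formRatio_extD_subset (γ : CForm (C2 × C2) (S₁ × S₂) 3) :
    tsupport (formRatio α β (extD prodModel γ)) ⊆ tsupport γ := by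
  refine closure_minimal (fun p hp => ?_) (isClosed_tsupport γ)
  by_contra h
  refine hp ?_
  rw [formRatio, extD_eq_zero_of_notMem_tsupport h, mixedCoeff_zero, zero_div]

variable [IsManifold 𝓘(ℂ, C2) ω S₁] [IsManifold 𝓘(ℂ, C2) ω S₂]

/-- For a 3-form `γ` supported in a chart, `dγ ∧ ψ̄ = d (γ ∧ ψ̄)` because `ψ̄` is closed, so that its
integral vanishes. In coordinates: `d (f̄₁ f₂ γ)` and `f̄₁ f₂ dγ` have the same coefficient of
`dz¹ ∧ dz² ∧ dz̄³ ∧ dz̄⁴`, since `d (f̄₁ f₂)` is a combination of `dz̄¹, dz̄², dz³, dz⁴`. -/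
theorem chartIntegral_formRatio_extD [CompactSpace S₁] [CompactSpace S₂]
    [MeasurableSpace (C2 × C2)] [BorelSpace (C2 × C2)] (μ : Measure (C2 × C2))
    [μ.IsAddHaarMeasure] (hα : IsNowhereVanishingHolomorphic α)
    (hβ : IsNowhereVanishingHolomorphic β) {γ : CForm (C2 × C2) (S₁ × S₂) 3}
    (hγ : IsSmooth prodModel γ) {a : S₁ × S₂}
    (hs : tsupport γ ⊆ (chartAt (ModelProd C2 C2) a).source) :
    chartIntegral μ prodModel (prodDensity α β) a (formRatio α β (extD prodModel γ)) = 0 := by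
  have := isManifold_real ‹IsManifold 𝓘(ℂ, C2) ω S₁›
  have := isManifold_real ‹IsManifold 𝓘(ℂ, C2) ω S₂›
  have h1 := IsManifold.chart_mem_maximalAtlas (I := 𝓘(ℂ, C2)) (n := ω) a.1
  have h2 := IsManifold.chart_mem_maximalAtlas (I := 𝓘(ℂ, C2)) (n := ω) a.2
  set e := extChartAt prodModel a with he
  set b := inCoords prodModel γ e.symm with hb
  set f := fun y : C2 × C2 => localCoeff α (chartAt C2 a.1) y.1 *
    conj (localCoeff β (chartAt C2 a.2) y.2) with hf
  have hopen : IsOpen e.target := isOpen_extChartAt_target a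
  have hs' : tsupport γ ⊆ e.source := by rwa [he, extChartAt_source]
  have hK : IsCompact (e '' tsupport γ) :=
    (isClosed_tsupport γ).isCompact.image_of_continuousOn
      ((continuousOn_extChartAt a).mono hs')
  have hbK : ∀ y ∈ e.target, y ∉ e '' tsupport γ → b y = 0 := by
    intro y hy hyK
    have h0 : γ (e.symm y) = 0 := image_eq_zero_of_notMem_tsupport fun h =>
      hyK ⟨_, h, e.right_inv hy⟩
    rw [hb, inCoords, h0]
    rfl
  -- the coordinate expression of `f̄₁ f₂ γ`, extended by zero to a form on `ℂ² × ℂ²`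
  set B := e.target.indicator fun y => conj (f y) • b y with hB
  have hBt : ∀ y ∈ e.target, B =ᶠ[𝓝 y] fun y => conj (f y) • b y := fun y hy => by
    filter_upwards [hopen.mem_nhds hy] with z hz
    exact indicator_of_mem hz _
  have hBK : ∀ y ∉ e '' tsupport γ, B y = 0 := by
    intro y hy
    by_cases hyt : y ∈ e.target
    · rw [hB, indicator_of_mem hyt, hbK y hyt hy]
      ext v
      simp
    · exact indicator_of_notMem hyt _
  have hBK' : ∀ y ∉ e.target, B =ᶠ[𝓝 y] fun _ => 0 := by
    intro y hy
    have hyK : y ∉ e '' tsupport γ := by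
      rintro ⟨x, hx, rfl⟩
      exact hy (e.map_source (hs' hx))
    filter_upwards [hK.isClosed.isOpen_compl.mem_nhds hyK] with z hz
    exact hBK z hz
  have hfc : ContDiffOn ℝ ∞ f e.target := contDiffOn_prodCoeff hα.1 hβ.1 a
  have hfc' : ContDiffOn ℝ ∞ (fun y => conj (f y)) e.target :=
    (Complex.conjCLE : ℂ →L[ℝ] ℂ).contDiff.comp_contDiffOn hfc
  have hBc : ContDiff ℝ 1 B := by
    rw [contDiff_iff_contDiffAt]
    intro y
    by_cases hy : y ∈ e.target
    · refine ContDiffAt.congr_of_eventuallyEq ?_ (hBt y hy)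
      exact ((hfc'.smul (hγ a)).contDiffAt (hopen.mem_nhds hy)).of_le (by simp)
    · exact contDiffAt_const.congr_of_eventuallyEq (hBK' y hy)
  have hBs : HasCompactSupport B := HasCompactSupport.intro hK hBK
  have hint := integral_mixedCoeff_eq_zero μ fun v =>
    integral_extDeriv_eq_zero (k := 3) μ hBc hBs v
  rw [← hint, chartIntegral, ← integral_indicator hopen.measurableSet]
  congr 1
  funext y
  by_cases hy : y ∈ e.target
  · rw [indicator_of_mem hy, formRatio_chart hα hβ _ hy, ← he,
      inCoords_extD prodModel hγ hy, (hBt y hy).extDeriv_eq]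
    have hyt := hy
    rw [he, extChartAt_prod_target] at hyt
    obtain ⟨θ, hθ, hθ₁, hθ₂⟩ := hasFDerivAt_mul_conj (y := y)
      ((differentiableOn_localCoeff h1 hα.1).differentiableAt
        ((chartAt C2 a.1).open_target.mem_nhds hyt.1))
      ((differentiableOn_localCoeff h2 hβ.1).differentiableAt
        ((chartAt C2 a.2).open_target.mem_nhds hyt.2))
    have hθ' : HasFDerivAt (fun y => conj (f y)) ((Complex.conjCLE : ℂ →L[ℝ] ℂ).comp θ) y :=
      (Complex.conjCLE : ℂ →L[ℝ] ℂ).hasFDerivAt.comp y hθ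
    have hbd : DifferentiableAt ℝ b y :=
      ((hγ a).contDiffAt (hopen.mem_nhds hy)).differentiableAt (by simp)
    have hd : extDeriv (fun y => conj (f y) • b y) y = conj (f y) • extDeriv b y +
        ContinuousAlternatingMap.alternatizeUncurryFin
          (((Complex.conjCLE : ℂ →L[ℝ] ℂ).comp θ).smulRight (b y)) := by
      have hfd : HasFDerivAt (fun y => conj (f y) • b y) (conj (f y) • fderiv ℝ b y +
          ((Complex.conjCLE : ℂ →L[ℝ] ℂ).comp θ).smulRight (b y)) y := hθ'.smul hbd.hasFDerivAt
      rw [extDeriv, hfd.fderiv,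
        ContinuousAlternatingMap.alternatizeUncurryFin_add]
      congr 1
      ext v
      simp [extDeriv, ContinuousAlternatingMap.alternatizeUncurryFin_apply, Finset.mul_sum]
    rw [hd, mixedCoeff_add, mixedCoeff_smul, mixedCoeff_alternatize_smulRight, add_zero]
    · have hne1 := localCoeff_ne_zero h1 hα hyt.1
      have hne2 := localCoeff_ne_zero h2 hβ hyt.2
      have hne2' : conj (localCoeff β (chartAt C2 a.2) y.2) ≠ 0 := by simpa using hne2
      rw [Complex.real_smul, prodDensity]
      push_cast
      rw [← Complex.conj_mul', ← Complex.conj_mul', hf]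
      simp only [map_mul, Complex.conj_conj]
      field_simp
      rfl
    · intro v
      simp [hθ₁]
    · intro v
      simp [hθ₂]
  · rw [indicator_of_notMem hy, (hBK' y hy).extDeriv_eq]
    rw [extDeriv_const_zero, mixedCoeff_zero]

/-- `dγ ∧ ψ̄ = ψ ∧ ψ̄` is impossible, because the integral of the left side vanishes and that of
the right side is positive. -/
theorem not_formRatio_extD_eq_one [CompactSpace S₁] [CompactSpace S₂] [T2Space S₁] [T2Space S₂]
    [Nonempty S₁] [Nonempty S₂] (hα : IsNowhereVanishingHolomorphic α)
    (hβ : IsNowhereVanishingHolomorphic β) {γ : CForm (C2 × C2) (S₁ × S₂) 3}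
    (hγ : IsSmooth prodModel γ) : ¬ ∀ p, formRatio α β (extD prodModel γ) p = 1 := by
  intro h
  have := isManifold_real ‹IsManifold 𝓘(ℂ, C2) ω S₁›
  have := isManifold_real ‹IsManifold 𝓘(ℂ, C2) ω S₂›
  let _ : MeasurableSpace (C2 × C2) := borel _
  have : BorelSpace (C2 × C2) := ⟨rfl⟩
  obtain ⟨t, ht⟩ := isCompact_univ.elim_finite_subcover
    (fun a : S₁ × S₂ => (chartAt (ModelProd C2 C2) a).source) (fun a => (chartAt _ a).open_source)
    fun x _ => mem_iUnion.mpr ⟨x, mem_chart_source _ x⟩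
  obtain ⟨ρ, hρ⟩ := SmoothPartitionOfUnity.exists_isSubordinate prodModel isClosed_univ
    (fun a : t => (chartAt (ModelProd C2 C2) (a : S₁ × S₂)).source)
    (fun a => (chartAt _ _).open_source) fun x hx => by
      obtain ⟨a, ha, hxa⟩ := mem_iUnion₂.mp (ht hx)
      exact mem_iUnion.mpr ⟨⟨a, ha⟩, hxa⟩
  have hρ1 : ∀ x, ∑ i, ρ i x = 1 := fun x => by
    rw [← finsum_eq_sum_of_fintype]
    exact ρ.sum_eq_one (mem_univ x)
  have hsm : ∀ i, IsSmooth prodModel fun x => ρ i x • γ x := fun i =>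
    IsSmooth.real_smul (ρ i).contMDiff hγ
  have hsupp : ∀ i : t, tsupport (fun x => ρ i x • γ x)
      ⊆ (chartAt (ModelProd C2 C2) (i : S₁ × S₂)).source := fun i =>
    (tsupport_smul_subset_left (ρ i) γ).trans (hρ i)
  refine not_sum_eq_one_of_chartIntegral_eq_zero (I := prodModel) Measure.addHaar
    (isDensity_prodDensity hα hβ) (fun i : t => (i : S₁ × S₂)) (fun i => ρ i)
    (fun i => (ρ i).contMDiff.continuous) (fun i x => ρ.nonneg i x) hρ1 hρ
    (fun i => formRatio α β (extD prodModel fun x => ρ i x • γ x))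
    (fun i => continuous_formRatio_extD hα hβ (hsm i))
    (fun i => (tsupport_formRatio_extD_subset _).trans (hsupp i))
    (fun i => chartIntegral_formRatio_extD _ hα hβ (hsm i) (hsupp i)) fun p => ?_
  rw [← h p]
  have hsum : γ = ∑ i, fun x => ρ i x • γ x := by
    funext x
    rw [Finset.sum_apply, ← Finset.sum_smul, hρ1, one_smul]
  conv_rhs => rw [hsum, extD_sum hsm]
  simp only [formRatio, ← Finset.sum_div]
  congr 1
  rw [Finset.sum_apply]
  exact (map_sum (AddMonoidHom.mk' mixedCoeff mixedCoeff_add) _ _).symm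

theorem formRatio_prodForm (hα : IsNowhereVanishingHolomorphic α)
    (hβ : IsNowhereVanishingHolomorphic β) (p : S₁ × S₂) :
    formRatio α β (prodForm α β) p = 1 :=
  div_self (mixedCoeff_prodForm_ne_zero hα hβ p)

variable [CompactSpace S₁] [CompactSpace S₂] [T2Space S₁] [T2Space S₂]
    [Nonempty S₁] [Nonempty S₂]

theorem prodForm_notMem_exactForms (hα : IsNowhereVanishingHolomorphic α)
    (hβ : IsNowhereVanishingHolomorphic β) :
    prodForm α β ∉ exactForms prodModel (S₁ × S₂) 3 := by
  rintro ⟨γ, hγ, h⟩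
  exact not_formRatio_extD_eq_one hα hβ hγ fun p => by rw [h, formRatio_prodForm hα hβ]

theorem prodForm_notMem_dbarExactForms (hα : IsNowhereVanishingHolomorphic α)
    (hβ : IsNowhereVanishingHolomorphic β) :
    prodForm α β ∉ dbarExactForms prodModel (S₁ × S₂) 2 1 := by
  rintro ⟨γ, hγ, hγ', h⟩
  refine not_formRatio_extD_eq_one hα hβ hγ fun p => ?_
  rw [← formRatio_prodForm hα hβ p, ← h, formRatio, formRatio, mixedCoeff_extD_eq_dbar hγ hγ']

end Exactness

/-! ### Unitary coframes -/

section Coframe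

variable {E : Type*} [NormedAddCommGroup E] [NormedSpace ℝ E]
  {H : Type*} [TopologicalSpace H] {I : ModelWithCorners ℝ E H}
  {M : Type*} [TopologicalSpace M] [ChartedSpace H M]
  [NormedSpace ℂ E]

namespace HermitianMetric

variable (g : HermitianMetric I M) (x : M)

/-- The complex linear covector `w ↦ h(w, u)`, where `h` is the Hermitian form with real part `g`,
complex linear in its first argument. -/
def covector (u : E) : E →L[ℝ] ℂ :=
  Complex.ofRealCLM.comp (g.inner x u) +
    Complex.I • Complex.ofRealCLM.comp (g.inner x (Complex.I • u))

theorem covector_apply (u w : E) :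
    g.covector x u w = g.inner x u w + Complex.I * g.inner x (Complex.I • u) w := rfl

theorem inner_I_smul_left (u w : E) :
    g.inner x (Complex.I • u) w = -g.inner x u (Complex.I • w) := by
  have h := g.hermitian x u (Complex.I • w)
  rw [I_smul_I_smul, map_neg] at h
  linarith

theorem covector_I_smul (u w : E) :
    g.covector x u (Complex.I • w) = Complex.I * g.covector x u w := by
  have h := g.inner_I_smul_left x u w
  rw [covector_apply, covector_apply, g.hermitian, h]
  push_cast
  linear_combination (g.inner x u (Complex.I • w) : ℂ) * Complex.I_sq

theorem conj_covector (u w : E) : conj (g.covector x u w) = g.covector x w u := by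
  rw [covector_apply, covector_apply, g.inner_I_smul_left x u w, g.symm x u (Complex.I • w),
    g.symm x u w]
  simp

variable {g x}

theorem IsUnitaryFrame.covector_apply_eq_ite {u : Fin (finrank ℂ E) → E}
    (hu : g.IsUnitaryFrame x u) (a b : Fin (finrank ℂ E)) :
    g.covector x (u a) (u b) = if a = b then 1 else 0 := by
  rw [covector_apply, (hu a b).1, (hu a b).2]
  split_ifs <;> simp

variable [IsScalarTower ℝ ℂ E]

variable (g x) in
theorem covector_smul (u : E) (c : ℂ) (w : E) :
    g.covector x u (c • w) = c * g.covector x u w :=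
  smul_of_I_smul (f := g.covector x u) (map_add _) (by simp) (g.covector_I_smul x u) c w

theorem IsUnitaryFrame.sum_covector_smul [FiniteDimensional ℂ E] {u : Fin (finrank ℂ E) → E}
    (hu : g.IsUnitaryFrame x u) (w : E) : ∑ k, g.covector x (u k) w • u k = w := by
  have hcoeff : ∀ (c : Fin (finrank ℂ E) → ℂ) j, g.covector x (u j) (∑ k, c k • u k) = c j := by
    intro c j
    simp [map_sum, covector_smul, hu.covector_apply_eq_ite]
  have hli : LinearIndependent ℂ u := by
    rw [Fintype.linearIndependent_iff]
    intro c hc j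
    rw [← hcoeff c j, hc, map_zero]
  obtain ⟨c, hc⟩ : ∃ c : Fin (finrank ℂ E) → ℂ, ∑ k, c k • u k = w := by
    have hspan := hli.span_eq_top_of_card_eq_finrank' (by simp)
    exact (Submodule.mem_span_range_iff_exists_fun ℂ).mp (hspan ▸ Submodule.mem_top)
  conv_lhs => rw [← hc]
  simp only [hcoeff]
  exact hc

theorem IsUnitaryFrame.covector_eq_sum [FiniteDimensional ℂ E] {u : Fin (finrank ℂ E) → E}
    (hu : g.IsUnitaryFrame x u) (v w : E) :
    g.covector x v w = ∑ k, g.covector x v (u k) * g.covector x (u k) w := by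
  conv_lhs => rw [← hu.sum_covector_smul w]
  simp [map_sum, covector_smul, mul_comm]

variable [FiniteDimensional ℂ E] (g x)

theorem isUnitaryFrame_unitaryFrame : g.IsUnitaryFrame x (g.unitaryFrame x) :=
  (g.exists_unitaryFrame x).choose_spec

theorem sum_realFrame {G : Type*} [AddCommMonoid G] (F : E → G) :
    ∑ a, F (g.realFrame x a)
      = ∑ k, (F (g.unitaryFrame x k) + F (Complex.I • g.unitaryFrame x k)) := by
  rw [← finProdFinEquiv.sum_comp, Fintype.sum_prod_type]
  refine Finset.sum_congr rfl fun k _ => ?_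
  simp [Fin.sum_univ_two, realFrame]

/-- The expansion of a vector in the real frame. -/
theorem sum_inner_mul_realFrame (f : E →L[ℝ] ℂ) (w : E) :
    ∑ a, f (g.realFrame x a) * g.inner x w (g.realFrame x a) = f w := by
  rw [g.sum_realFrame x fun v => f v * g.inner x w v]
  conv_rhs => rw [← (g.isUnitaryFrame_unitaryFrame x).sum_covector_smul w, map_sum]
  refine Finset.sum_congr rfl fun k _ => ?_
  have h : g.covector x (g.unitaryFrame x k) w • g.unitaryFrame x k
      = g.inner x w (g.unitaryFrame x k) • g.unitaryFrame x k
        + g.inner x w (Complex.I • g.unitaryFrame x k) • Complex.I • g.unitaryFrame x k := by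
    rw [covector_apply, add_smul, mul_comm, mul_smul, real_smul_eq, real_smul_eq, g.symm x w,
      g.symm x w]
  rw [h, map_add, f.map_smul, f.map_smul, Complex.real_smul, Complex.real_smul]
  ring

end HermitianMetric

end Coframe

/-! ### A sum of products of determinants -/

section Determinant

variable {n : ℕ}

/-- A sum over all maps `a`, for the Hodge star of a wedge product of `n` covectors: expanding the
first determinant and using the multilinearity of the second one, each of the `n !` permutations of
the rows `∑ b, A j b • X b` contributes the same. -/
theorem sum_det_mul_det {N : Type*} [Fintype N] (A : Fin n → N → ℂ)
    (X : N → Fin n ⊕ Fin n → ℂ) (Y : Fin n → Fin n ⊕ Fin n → ℂ) :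
    ∑ a : Fin n → N, Matrix.det (Matrix.of fun i j => A i (a j)) *
        Matrix.det (Matrix.of (Sum.elim (fun j => X (a j)) Y))
      = (n ! : ℂ) * Matrix.det (Matrix.of (Sum.elim (fun j => ∑ b, A j b • X b) Y)) := by
  classical
  set D : MultilinearMap ℂ (fun _ : Fin n => Fin n ⊕ Fin n → ℂ) ℂ :=
    { toFun := fun f => Matrix.det (Matrix.of (Sum.elim f Y))
      map_update_add' := by
        intro _ f i p q
        have hdec : ‹DecidableEq (Fin n)› = instDecidableEqFin _ := Subsingleton.elim _ _
        subst hdec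
        rw [Sum.elim_update_left, Sum.elim_update_left, Sum.elim_update_left]
        exact Matrix.det_updateRow_add (Matrix.of (Sum.elim f Y)) _ _ _
      map_update_smul' := by
        intro _ f i c p
        have hdec : ‹DecidableEq (Fin n)› = instDecidableEqFin _ := Subsingleton.elim _ _
        subst hdec
        rw [Sum.elim_update_left, Sum.elim_update_left]
        exact Matrix.det_updateRow_smul (Matrix.of (Sum.elim f Y)) _ _ _ } with hD
  have hDa : ∀ f, Matrix.det (Matrix.of (Sum.elim f Y)) = D f := fun f => rfl
  have hperm : ∀ (f : Fin n → Fin n ⊕ Fin n → ℂ) (σ : Equiv.Perm (Fin n)),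
      D (fun j => f (σ j)) = (Equiv.Perm.sign σ : ℂ) * D f := by
    intro f σ
    have h := Matrix.det_permute (Equiv.sumCongr σ 1) (Matrix.of (Sum.elim f Y))
    rw [Equiv.Perm.sign_sumCongr, Equiv.Perm.sign_one, mul_one] at h
    rw [← hDa, ← hDa, ← h]
    congr 1
    ext (i | i) j <;> rfl
  simp only [hDa]
  calc ∑ a : Fin n → N, Matrix.det (Matrix.of fun i j => A i (a j)) * D (fun j => X (a j))
      = ∑ a : Fin n → N, ∑ σ : Equiv.Perm (Fin n), (Equiv.Perm.sign σ : ℂ) *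
          D (fun j => A (σ j) (a j) • X (a j)) := by
        refine Finset.sum_congr rfl fun a _ => ?_
        rw [Matrix.det_apply', Finset.sum_mul]
        refine Finset.sum_congr rfl fun σ _ => ?_
        rw [D.map_smul_univ, smul_eq_mul, mul_assoc]
        rfl
    _ = ∑ σ : Equiv.Perm (Fin n), (Equiv.Perm.sign σ : ℂ) *
          D (fun j => ∑ b, A (σ j) b • X b) := by
        rw [Finset.sum_comm]
        refine Finset.sum_congr rfl fun σ _ => ?_
        rw [D.map_sum, Finset.mul_sum]
    _ = ∑ σ : Equiv.Perm (Fin n), D (fun j => ∑ b, A j b • X b) := by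
        refine Finset.sum_congr rfl fun σ _ => ?_
        rw [hperm (fun j => ∑ b, A j b • X b) σ, ← mul_assoc]
        rcases Int.units_eq_one_or (Equiv.Perm.sign σ) with h | h <;> simp [h]
    _ = _ := by
        rw [Finset.sum_const, Finset.card_univ, Fintype.card_perm, Fintype.card_fin, nsmul_eq_mul]

end Determinant

/-! ### The Hodge star of a product of unitary covectors and conjugates -/

section HodgeStar

variable {E : Type*} [NormedAddCommGroup E] [NormedSpace ℝ E]
  {H : Type*} [TopologicalSpace H] {I : ModelWithCorners ℝ E H}
  {M : Type*} [TopologicalSpace M] [ChartedSpace H M]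
  [NormedSpace ℂ E] {n : ℕ}

/-- The complex conjugate of a covector. -/
def conjCovector (θ : E →L[ℝ] ℂ) : E →L[ℝ] ℂ := (Complex.conjCLE : ℂ →L[ℝ] ℂ).comp θ

/-- The matrix of the covectors `τ₁, …, τ_n, τ̄₁, …, τ̄_n`, dual to a unitary frame `u`, in the
real frame `u₁, i u₁, u₂, i u₂, …`. -/
def coframeMatrix (m : ℕ) (h : n + n = m * 2) : Matrix (Fin n ⊕ Fin n) (Fin n ⊕ Fin n) ℂ :=
  Matrix.of fun r s =>
    Sum.elim (fun k : Fin n => if Fin.cast (by omega : n = m) k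
        = (finProdFinEquiv.symm (Fin.cast h (finSumFinEquiv s))).1 then
        (if (finProdFinEquiv.symm (Fin.cast h (finSumFinEquiv s))).2 = 0 then 1 else Complex.I)
        else 0)
      (fun k : Fin n => if Fin.cast (by omega : n = m) k
        = (finProdFinEquiv.symm (Fin.cast h (finSumFinEquiv s))).1 then
        (if (finProdFinEquiv.symm (Fin.cast h (finSumFinEquiv s))).2 = 0 then 1 else -Complex.I)
        else 0) r

/-- The permutation exchanging `τ_k` and `τ̄_k` for those `k` with `c k`, where `Sum.inl k` is the
index of `τ_k` and `Sum.inr k` that of `τ̄_k`. -/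
def flipPerm (c : Fin n → Bool) : Equiv.Perm (Fin n ⊕ Fin n) :=
  Function.Involutive.toPerm
    (Sum.elim (fun k => if c k then Sum.inr k else Sum.inl k)
      (fun k => if c k then Sum.inl k else Sum.inr k)) (by
        rintro (k | k) <;> by_cases h : c k <;> simp [h])

theorem flipPerm_apply (c : Fin n → Bool) (r : Fin n ⊕ Fin n) :
    flipPerm c r = Sum.elim (fun k => if c k then Sum.inr k else Sum.inl k)
      (fun k => if c k then Sum.inl k else Sum.inr k) r := rfl

theorem swap_flipPerm (c : Fin n → Bool) (r : Fin n ⊕ Fin n) :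
    (flipPerm c r).swap = flipPerm c r.swap := by
  rcases r with k | k <;> by_cases h : c k <;> simp [flipPerm_apply, h]

namespace HermitianMetric

variable (g : HermitianMetric I M) (x : M)

/-- The covectors `τ₁, …, τ_n, τ̄₁, …, τ̄_n` defined by vectors `u₁, …, u_n`. -/
def coframe (u : Fin n → E) : Fin n ⊕ Fin n → E →L[ℝ] ℂ :=
  Sum.elim (fun k => g.covector x (u k)) fun k => conjCovector (g.covector x (u k))

theorem coframe_swap (u : Fin n → E) (r : Fin n ⊕ Fin n) (w : E) :
    g.coframe x u r.swap w = conj (g.coframe x u r w) := by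
  rcases r with k | k <;> simp [coframe, conjCovector]

variable [IsScalarTower ℝ ℂ E] [FiniteDimensional ℂ E]

/-- The real frame, indexed by two copies of `Fin n`. -/
def sumFrame (h : n + n = finrank ℂ E * 2) (s : Fin n ⊕ Fin n) : E :=
  g.realFrame x (Fin.cast h (finSumFinEquiv s))

theorem sum_sumFrame (h : n + n = finrank ℂ E * 2) {G : Type*} [AddCommMonoid G] (F : E → G) :
    ∑ s, F (g.sumFrame x h s)
      = ∑ k, (F (g.unitaryFrame x k) + F (Complex.I • g.unitaryFrame x k)) := by
  rw [← g.sum_realFrame x F]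
  exact (finSumFinEquiv.trans (finCongr h)).sum_comp fun a => F (g.realFrame x a)

variable {g x} {u : Fin n → E}

theorem sum_covector_mul_conj
    (hu : ∀ j k, g.covector x (u j) (u k) = if j = k then 1 else 0) (j k : Fin n) :
    ∑ a, g.covector x (u j) (g.unitaryFrame x a) * conj (g.covector x (u k) (g.unitaryFrame x a))
      = if j = k then 1 else 0 := by
  rw [← hu, (g.isUnitaryFrame_unitaryFrame x).covector_eq_sum (u j) (u k)]
  simp only [conj_covector]

/-- The dual pairing of the covectors `τ_k` and `τ̄_k`. -/
theorem sum_coframe_mul_coframe (h : n + n = finrank ℂ E * 2)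
    (hu : ∀ j k, g.covector x (u j) (u k) = if j = k then 1 else 0) (r r' : Fin n ⊕ Fin n) :
    ∑ s, g.coframe x u r (g.sumFrame x h s) * g.coframe x u r' (g.sumFrame x h s)
      = if r' = r.swap then 2 else 0 := by
  rw [g.sum_sumFrame x h fun w => g.coframe x u r w * g.coframe x u r' w]
  have hI : ∀ z w : ℂ, z * w + Complex.I * z * (Complex.I * w) = 0 := fun z w => by
    linear_combination z * w * Complex.I_sq
  have hI2 : ∀ z w : ℂ, z * w + Complex.I * z * (-Complex.I * w) = 2 * (z * w) := fun z w => by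
    linear_combination -z * w * Complex.I_sq
  have hI3 : ∀ z w : ℂ, z * w + -Complex.I * z * (Complex.I * w) = 2 * (z * w) := fun z w => by
    linear_combination -z * w * Complex.I_sq
  have hI4 : ∀ z w : ℂ, z * w + -Complex.I * z * (-Complex.I * w) = 0 := fun z w => by
    linear_combination z * w * Complex.I_sq
  rcases r with j | j <;> rcases r' with k | k <;>
    simp only [coframe, conjCovector, Sum.elim_inl, Sum.elim_inr, Sum.swap_inl, Sum.swap_inr,
      ContinuousLinearMap.comp_apply, covector_I_smul, ContinuousLinearEquiv.coe_coe,
      Complex.conjCLE_apply, map_mul, Complex.conj_I, hI, hI2, hI3, hI4, Finset.sum_const_zero,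
      ← Finset.mul_sum, sum_covector_mul_conj hu]
  · simp
  · by_cases hjk : j = k <;> simp [hjk, eq_comm]
  · have h2 := sum_covector_mul_conj hu k j
    simp only [mul_comm] at h2 ⊢
    rw [h2]
    by_cases hjk : k = j <;> simp [hjk]
  · simp

/-- The coframe dual to the frame used for the volume form has constant coefficients. -/
theorem coframe_unitaryFrame_sumFrame (h : n + n = finrank ℂ E * 2) (r s : Fin n ⊕ Fin n) :
    g.coframe x (fun k => g.unitaryFrame x (Fin.cast (by omega) k)) r (g.sumFrame x h s)
      = coframeMatrix _ h r s := by
  have hq := (g.isUnitaryFrame_unitaryFrame x).covector_apply_eq_ite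
  rcases r with k | k <;>
    simp only [coframe, conjCovector, coframeMatrix, Matrix.of_apply, Sum.elim_inl, Sum.elim_inr,
      sumFrame, realFrame, ContinuousLinearMap.comp_apply]
  all_goals generalize finProdFinEquiv.symm (Fin.cast h (finSumFinEquiv s)) = q
  · split_ifs <;> simp [covector_I_smul, *]
  · split_ifs <;> simp [covector_I_smul, *]

/-- The determinant of a unitary coframe and its conjugate does not depend on the coframe: a change
of coframe by a unitary matrix `U` multiplies it by `|det U|² = 1`. -/
theorem det_coframe (h : n + n = finrank ℂ E * 2)
    (hu : ∀ j k, g.covector x (u j) (u k) = if j = k then 1 else 0) :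
    Matrix.det (Matrix.of fun r s => g.coframe x u r (g.sumFrame x h s))
      = Matrix.det (coframeMatrix _ h) := by
  have hn : n = finrank ℂ E := by omega
  set U : Matrix (Fin n) (Fin n) ℂ :=
    Matrix.of fun j k => g.covector x (u j) (g.unitaryFrame x (Fin.cast hn k)) with hU
  have hUU : U * U.conjTranspose = 1 := by
    ext j k
    rw [Matrix.mul_apply, Matrix.one_apply, ← sum_covector_mul_conj hu j k]
    exact (finCongr hn).sum_comp fun a => g.covector x (u j) (g.unitaryFrame x a) *
      conj (g.covector x (u k) (g.unitaryFrame x a))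
  have hexp : ∀ j w, g.covector x (u j) w
      = ∑ k, U j k * g.covector x (g.unitaryFrame x (Fin.cast hn k)) w := fun j w => by
    rw [(g.isUnitaryFrame_unitaryFrame x).covector_eq_sum (u j) w]
    exact ((finCongr hn).sum_comp fun a => g.covector x (u j) (g.unitaryFrame x a) *
      g.covector x (g.unitaryFrame x a) w).symm
  have hmul : (Matrix.of fun r s => g.coframe x u r (g.sumFrame x h s))
      = Matrix.fromBlocks U 0 0 U.conjTranspose.transpose * coframeMatrix _ h := by
    ext r s
    rw [Matrix.mul_apply]
    simp only [← coframe_unitaryFrame_sumFrame (g := g) (x := x) h, Fintype.sum_sum_type]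
    rcases r with j | j
    · simp [coframe, hexp j]
    · simp [coframe, conjCovector, hexp j]
  have hdet : U.det * U.conjTranspose.det = 1 := by
    rw [← Matrix.det_mul, hUU, Matrix.det_one]
  rw [hmul, Matrix.det_mul, Matrix.det_fromBlocks_zero₁₂, Matrix.det_transpose, hdet, one_mul]

theorem det_coframe_ne_zero (h : n + n = finrank ℂ E * 2)
    (hu : ∀ j k, g.covector x (u j) (u k) = if j = k then 1 else 0) :
    Matrix.det (Matrix.of fun r s => g.coframe x u r (g.sumFrame x h s)) ≠ 0 := by
  set T := Matrix.of fun r s => g.coframe x u r (g.sumFrame x h s) with hT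
  have hmul : T * (T.submatrix Sum.swap id).transpose = (2 : ℂ) • 1 := by
    ext r r'
    rw [Matrix.mul_apply]
    refine (sum_coframe_mul_coframe h hu r r'.swap).trans ?_
    have hiff : r'.swap = r.swap ↔ r = r' :=
      ⟨fun h => (Sum.swap_leftInverse.injective h).symm, fun h => by rw [h]⟩
    simp [hiff, Matrix.one_apply]
  intro h0
  have h1 := congrArg Matrix.det hmul
  rw [Matrix.det_mul, h0, zero_mul, Matrix.det_smul, Matrix.det_one, mul_one] at h1
  exact pow_ne_zero _ two_ne_zero h1.symm

/-- The constant `κ` with `⋆ψ = κ ψ̄`, for `ψ` a multiple of the wedge product of the covectors `τ̄_k`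
for those `k` with `c k` and `τ_k` for the others. -/
def starConst (c : Fin n → Bool) {m : ℕ} (h : n + n = m * 2) : ℂ :=
  2 ^ n / ((Equiv.Perm.sign (flipPerm c) : ℂ) * Matrix.det (coframeMatrix _ h))

/-- If `ψ` is a multiple of a wedge product of `n` of the covectors `τ₁, …, τ_n, τ̄₁, …, τ̄_n`, one
out of each pair `τ_k, τ̄_k`, then `⋆ψ` is a constant multiple of `ψ̄`. -/
theorem hodgeStar_apply_eq_smul_conj (h : n + n = finrank ℂ E * 2)
    (hu : ∀ j k, g.covector x (u j) (u k) = if j = k then 1 else 0) (c : Fin n → Bool)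
    {α : CForm E M n} {a : ℂ}
    (hα : α x = a • covectorWedge fun j => g.coframe x u (flipPerm c (Sum.inl j))) :
    g.hodgeStar h α x = starConst c h • conjForm α x := by
  -- the covectors of `ψ̄`
  set η : Fin n → E →L[ℝ] ℂ := fun j => g.coframe x u (flipPerm c (Sum.inr j)) with hη
  have hηθ : ∀ j w, conj (g.coframe x u (flipPerm c (Sum.inl j)) w) = η j w := fun j w => by
    rw [← coframe_swap, swap_flipPerm]
    rfl
  have hconj : ∀ w, conj (α x w) = conj a * covectorWedge η w := by
    intro w
    rw [hα, ContinuousAlternatingMap.smul_apply, smul_eq_mul, map_mul, covectorWedge_apply,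
      covectorWedge_apply, RingHom.map_det]
    congr 2
    ext i j
    exact hηθ i (w j)
  set X : E → Fin n ⊕ Fin n → ℂ := fun w r => (g.inner x (g.sumFrame x h r) w : ℂ) with hX
  ext v
  have hvol : ∀ b : Fin n → Fin (finrank ℂ E * 2),
      contract (fun i => g.realFrame x (b i)) (g.volForm h x) v
      = Matrix.det (Matrix.of
          (Sum.elim (fun j => X (g.realFrame x (b j))) fun j => X (v j))) := by
    intro b
    change Matrix.det _ = _
    rw [← Matrix.det_submatrix_equiv_self finSumFinEquiv, ← Matrix.det_transpose]
    congr 1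
    ext (i | i) r
    · simp [hX, sumFrame]
    · simp only [hX, sumFrame, Matrix.transpose_apply, Matrix.submatrix_apply, Matrix.of_apply,
        finSumFinEquiv_apply_right, Fin.append_right, Sum.elim_inr]
      rfl
  have hstar : g.hodgeStar h α x v = conj a * Matrix.det (Matrix.of
      (Sum.elim (fun j r => η j (g.sumFrame x h r)) fun j => X (v j))) := by
    have h1 : g.hodgeStar h α x v = ((n ! : ℕ) : ℂ)⁻¹ * ∑ b : Fin n → Fin (finrank ℂ E * 2),
        conj (α x fun i => g.realFrame x (b i)) *
          contract (fun i => g.realFrame x (b i)) (g.volForm h x) v := by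
      simp [hodgeStar]
    rw [h1]
    simp only [hconj, hvol, mul_assoc, ← Finset.mul_sum, covectorWedge_apply]
    have h2 := sum_det_mul_det (fun j b => η j (g.realFrame x b)) (fun b => X (g.realFrame x b))
      (fun j => X (v j))
    have h3 : (fun j => ∑ b, η j (g.realFrame x b) • X (g.realFrame x b))
        = fun j r => η j (g.sumFrame x h r) := by
      funext j r
      rw [Finset.sum_apply]
      exact g.sum_inner_mul_realFrame x (η j) (g.sumFrame x h r)
    rw [h3] at h2
    rw [h2]
    have hfac : ((n ! : ℕ) : ℂ) ≠ 0 := Nat.cast_ne_zero.mpr n.factorial_ne_zero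
    field_simp
  -- The rows `η j` are dual to the conjugate covectors, so multiplication by the matrix of the coframe
  -- makes the determinant block triangular, with the matrix `2` in the first block.
  set S : Matrix (Fin n ⊕ Fin n) (Fin n ⊕ Fin n) ℂ :=
    Matrix.of fun r s => g.coframe x u (flipPerm c r) (g.sumFrame x h s) with hS
  have hSdet : S.det = (Equiv.Perm.sign (flipPerm c) : ℂ) * Matrix.det (coframeMatrix _ h) := by
    rw [← det_coframe h hu]
    exact Matrix.det_permute (flipPerm c)
      (Matrix.of fun r s => g.coframe x u r (g.sumFrame x h s))
  have hS0 : S.det ≠ 0 := by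
    rw [hSdet, ← det_coframe h hu]
    refine mul_ne_zero ?_ (det_coframe_ne_zero h hu)
    exact_mod_cast (Units.ne_zero (Equiv.Perm.sign (flipPerm c)))
  have hmul : Matrix.of (Sum.elim (fun j r => η j (g.sumFrame x h r)) fun j => X (v j))
        * S.transpose
      = Matrix.fromBlocks ((2 : ℂ) • 1) 0
          (Matrix.of fun j k => g.coframe x u (flipPerm c (Sum.inl k)) (v j))
          (Matrix.of fun j k => η k (v j)) := by
    have hexp : ∀ (f : E →L[ℝ] ℂ) (w : E), ∑ r, X w r * f (g.sumFrame x h r) = f w := by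
      intro f w
      rw [← g.sum_inner_mul_realFrame x f w,
        ← (finSumFinEquiv.trans (finCongr h)).sum_comp fun b =>
          f (g.realFrame x b) * (g.inner x w (g.realFrame x b) : ℂ)]
      refine Finset.sum_congr rfl fun r _ => ?_
      rw [mul_comm, hX, g.symm x w]
      rfl
    ext p q
    rw [Matrix.mul_apply]
    rcases p with j | j
    · refine (sum_coframe_mul_coframe h hu (flipPerm c (Sum.inr j)) (flipPerm c q)).trans ?_
      simp only [swap_flipPerm, EmbeddingLike.apply_eq_iff_eq]
      rcases q with k | k
      · simp [Matrix.one_apply, eq_comm]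
      · simp
    · rcases q with k | k
      · exact hexp _ (v j)
      · exact hexp _ (v j)
  have hdet := congrArg Matrix.det hmul
  rw [Matrix.det_mul, Matrix.det_transpose, Matrix.det_fromBlocks_zero₁₂, Matrix.det_smul,
    Matrix.det_one, mul_one, Fintype.card_fin, ← Matrix.det_transpose
      (Matrix.of fun j k => η k (v j))] at hdet
  have hrhs : (starConst c h • conjForm α x) v = starConst c h * (conj a * covectorWedge η v) := by
    rw [← hconj]
    rfl
  rw [hrhs, hstar, starConst, ← hSdet, covectorWedge_apply]
  rw [eq_div_of_mul_eq hS0 hdet]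
  have : (Matrix.of fun j k => η k (v j)).transpose = Matrix.of fun i j => η i (v j) := rfl
  rw [this]
  ring

end HermitianMetric

end HodgeStar

/-! ### Harmonicity for product metrics -/

section Harmonic

variable {S₁ : Type*} [TopologicalSpace S₁] [ChartedSpace C2 S₁]
  {S₂ : Type*} [TopologicalSpace S₂] [ChartedSpace C2 S₂]
  {α : CForm C2 S₁ 2} {β : CForm C2 S₂ 2}

namespace HermitianMetric

/-- In terms of a unitary frame of the tangent plane, a form of type `(2, 0)` on a surface is a
multiple of the wedge product of the dual covectors. -/
theorem eq_smul_covectorWedge {S : Type*} [TopologicalSpace S] [ChartedSpace C2 S]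
    (g : HermitianMetric 𝓘(ℝ, C2) S) (x : S) {u₀ u₁ : C2}
    (h₀₀ : g.covector x u₀ u₀ = 1) (h₀₁ : g.covector x u₀ u₁ = 0) (h₁₁ : g.covector x u₁ u₁ = 1)
    {γ : C2 [⋀^Fin 2]→L[ℝ] ℂ}
    (hγ : ∀ (c : ℂ) (v : Fin 2 → C2), γ (fun i => c • v i) = c ^ 2 * γ v) :
    γ = γ ![u₀, u₁] • covectorWedge ![g.covector x u₀, g.covector x u₁] := by
  set W := covectorWedge ![g.covector x u₀, g.covector x u₁] with hW
  have hWt : ∀ (c : ℂ) (v : Fin 2 → C2), W (fun i => c • v i) = c ^ 2 * W v := by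
    intro c v
    simp only [hW, covectorWedge_apply, Matrix.det_fin_two, Matrix.of_apply, Matrix.cons_val_zero,
      Matrix.cons_val_one, covector_smul]
    ring
  have hWu : W ![u₀, u₁] = 1 := by
    simp [hW, covectorWedge_apply, Matrix.det_fin_two, h₀₀, h₀₁, h₁₁]
  have h1 := eq_smul_dz12 hγ
  have h2 := eq_smul_dz12 hWt
  rw [h2, ContinuousAlternatingMap.smul_apply, smul_eq_mul] at hWu
  rw [h2, smul_smul]
  conv_lhs => rw [h1]
  congr 1
  conv_rhs => rw [h1]
  rw [ContinuousAlternatingMap.smul_apply, smul_eq_mul]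
  linear_combination -(γ ![stdVec 0, stdVec 1]) * hWu

variable {g₁ : HermitianMetric 𝓘(ℝ, C2) S₁} {g₂ : HermitianMetric 𝓘(ℝ, C2) S₂}
  {g : HermitianMetric prodModel (S₁ × S₂)}

theorem covector_prod (hg : IsProductMetric g₁ g₂ g) (p : S₁ × S₂) (v w : C2 × C2) :
    g.covector p v w = g₁.covector p.1 v.1 w.1 + g₂.covector p.2 v.2 w.2 := by
  rw [covector_apply, covector_apply, covector_apply, hg p v w, hg p (Complex.I • v) w,
    Prod.smul_fst, Prod.smul_snd]
  push_cast
  ring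

theorem hodgeStar_prodForm (hg : IsProductMetric g₁ g₂ g) (hα : IsOfType 2 0 α)
    (hβ : IsOfType 2 0 β) (h : 4 + 4 = finrank ℂ (C2 × C2) * 2) :
    g.hodgeStar h (prodForm α β)
      = starConst ![false, false, true, true] h • conjForm (prodForm α β) := by
  have hdim : finrank ℂ C2 = 2 := by simp
  funext p
  set v : Fin 2 → C2 := fun k => g₁.unitaryFrame p.1 (Fin.cast hdim.symm k) with hv
  set w : Fin 2 → C2 := fun k => g₂.unitaryFrame p.2 (Fin.cast hdim.symm k) with hw
  have hvv : ∀ j k, g₁.covector p.1 (v j) (v k) = if j = k then 1 else 0 := fun j k => by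
    rw [hv, (g₁.isUnitaryFrame_unitaryFrame p.1).covector_apply_eq_ite]
    simp
  have hww : ∀ j k, g₂.covector p.2 (w j) (w k) = if j = k then 1 else 0 := fun j k => by
    rw [hw, (g₂.isUnitaryFrame_unitaryFrame p.2).covector_apply_eq_ite]
    simp
  have h0₁ : ∀ a, g₁.covector p.1 0 a = 0 := fun a => by simp [covector_apply]
  have h0₂ : ∀ a, g₂.covector p.2 0 a = 0 := fun a => by simp [covector_apply]
  set u : Fin 4 → C2 × C2 := ![(v 0, 0), (v 1, 0), (0, w 0), (0, w 1)] with hu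
  have huu : ∀ j k, g.covector p (u j) (u k) = if j = k then 1 else 0 := by
    intro j k
    rw [covector_prod hg]
    fin_cases j <;> fin_cases k <;> simp [hu, hvv, hww, h0₁, h0₂]
  have hα' := g₁.eq_smul_covectorWedge p.1 (hvv 0 0) (hvv 0 1) (hvv 1 1) (γ := α p.1)
    fun c v => by simpa using hα p.1 c v
  have hβ' := g₂.eq_smul_covectorWedge p.2 (hww 0 0) (hww 0 1) (hww 1 1) (γ := β p.2)
    fun c v => by simpa using hβ p.2 c v
  refine g.hodgeStar_apply_eq_smul_conj h huu ![false, false, true, true]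
    (a := α p.1 ![v 0, v 1] * conj (β p.2 ![w 0, w 1])) ?_
  have hcov : (fun j => g.coframe p u (flipPerm ![false, false, true, true] (Sum.inl j)))
      = ![(g₁.covector p.1 (v 0)).comp (ContinuousLinearMap.fst ℝ C2 C2),
          (g₁.covector p.1 (v 1)).comp (ContinuousLinearMap.fst ℝ C2 C2),
          (Complex.conjCLE : ℂ →L[ℝ] ℂ).comp
            ((g₂.covector p.2 (w 0)).comp (ContinuousLinearMap.snd ℝ C2 C2)),
          (Complex.conjCLE : ℂ →L[ℝ] ℂ).comp
            ((g₂.covector p.2 (w 1)).comp (ContinuousLinearMap.snd ℝ C2 C2))] := by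
    funext j
    refine ContinuousLinearMap.ext fun z => ?_
    fin_cases j <;>
      simp [flipPerm_apply, coframe, conjCovector, covector_prod hg, hu, h0₁, h0₂]
  rw [hcov, ← wedge_fst_conj_snd, prodForm_eq, ← wedge_smul_smul]
  congr 1
  · conv_lhs => rw [hα']
    rfl
  · conv_lhs => rw [hβ']
    ext z
    simp

section

variable {E : Type*} [NormedAddCommGroup E] [NormedSpace ℝ E]
  {H : Type*} [TopologicalSpace H] {I : ModelWithCorners ℝ E H}
  {M : Type*} [TopologicalSpace M] [ChartedSpace H M]
  [NormedSpace ℂ E] [IsScalarTower ℝ ℂ E] [FiniteDimensional ℂ E] (g : HermitianMetric I M)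

theorem hodgeStar_zero {k l : ℕ} (h : k + l = finrank ℂ E * 2) :
    g.hodgeStar h (0 : CForm E M k) = 0 := by
  funext x
  ext v
  simp [hodgeStar]

theorem codiff_zero {k l : ℕ} (h : k + 1 + l = finrank ℂ E * 2) :
    g.codiff h (0 : CForm E M (k + 1)) = 0 := by
  rw [codiff, hodgeStar_zero, extD_zero, hodgeStar_zero, neg_zero]

end

end HermitianMetric

theorem conjForm_zero {E : Type*} [NormedAddCommGroup E] [NormedSpace ℝ E] {M : Type*} {k : ℕ} :
    conjForm (0 : CForm E M k) = 0 := by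
  funext x
  ext v
  simp [conjForm]

/-- `ψ` is closed, and coclosed because `⋆ψ` is a constant multiple of the closed form `ψ̄`. -/
theorem laplacian_prodForm [IsManifold 𝓘(ℂ, C2) ω S₁] [IsManifold 𝓘(ℂ, C2) ω S₂]
    {g₁ : HermitianMetric 𝓘(ℝ, C2) S₁} {g₂ : HermitianMetric 𝓘(ℝ, C2) S₂}
    {g : HermitianMetric prodModel (S₁ × S₂)} (hg : IsProductMetric g₁ g₂ g)
    (hα : IsHolomorphicForm 𝓘(ℝ, C2) α) (hβ : IsHolomorphicForm 𝓘(ℝ, C2) β) :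
    g.laplacian real_dim_prod (prodForm α β) = 0 := by
  have hd : extD prodModel (prodForm α β) = 0 := extD_prodForm hα hβ
  have hstar : ∀ h : 4 + 4 = finrank ℂ (C2 × C2) * 2,
      extD prodModel (g.hodgeStar h (prodForm α β)) = 0 := fun h => by
    rw [HermitianMetric.hodgeStar_prodForm hg hα.1 hβ.1, extD_smul,
      extD_conjForm (isSmooth_prodForm hα hβ), hd, conjForm_zero, smul_zero_form]
  have hco : ∀ h : 3 + 1 + 4 = finrank ℂ (C2 × C2) * 2,
      g.codiff (k := 3) (l := 4) h (prodForm α β) = 0 := fun h => by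
    rw [HermitianMetric.codiff, hstar, HermitianMetric.hodgeStar_zero, neg_zero]
  rw [HermitianMetric.laplacian, hd, HermitianMetric.codiff_zero, add_zero]
  exact (congrArg (extD prodModel) (hco _)).trans extD_zero

end Harmonic

end KForms

end

theorem lemma3p5
    {S₁ : Type*} [TopologicalSpace S₁] [ChartedSpace C2 S₁] (hS₁ : IsK3Surface S₁)
    {S₂ : Type*} [TopologicalSpace S₂] [ChartedSpace C2 S₂] (hS₂ : IsK3Surface S₂)
    (lam₁ : CForm C2 S₁ 2) (hlam₁ : IsNowhereVanishingHolomorphic lam₁)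
    (lam₂ : CForm C2 S₂ 2) (hlam₂ : IsNowhereVanishingHolomorphic lam₂) :
    -- the form is a smooth form of type (2, 2)
    (IsSmooth prodModel (prodForm lam₁ lam₂) ∧ IsOfType 2 2 (prodForm lam₁ lam₂)) ∧
    -- its expression in arbitrary holomorphic local coordinates of the two factors
    (∀ φ₁ ∈ IsManifold.maximalAtlas 𝓘(ℂ, C2) ω S₁, ∀ φ₂ ∈ IsManifold.maximalAtlas 𝓘(ℂ, C2) ω S₂,
      ∃ f₁ f₂ : C2 → ℂ,
        DifferentiableOn ℂ f₁ φ₁.target ∧ DifferentiableOn ℂ f₂ φ₂.target ∧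
        (∀ z ∈ φ₁.target, f₁ z ≠ 0) ∧ (∀ w ∈ φ₂.target, f₂ w ≠ 0) ∧
        (∀ z ∈ φ₁.target, inCoords 𝓘(ℝ, C2) lam₁ φ₁.symm z = f₁ z • dz12) ∧
        (∀ w ∈ φ₂.target, inCoords 𝓘(ℝ, C2) lam₂ φ₂.symm w = f₂ w • dz12) ∧
        ∀ z ∈ φ₁.target, ∀ w ∈ φ₂.target,
          inCoords prodModel (prodForm lam₁ lam₂) (fun y => (φ₁.symm y.1, φ₂.symm y.2)) (z, w)
            = (f₁ z * conj (f₂ w)) • dz12bar34) ∧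
    -- it is harmonic for every product of Hermitian metrics
    (∀ (g₁ : HermitianMetric 𝓘(ℝ, C2) S₁) (g₂ : HermitianMetric 𝓘(ℝ, C2) S₂)
      (g : HermitianMetric prodModel (S₁ × S₂)), IsProductMetric g₁ g₂ g →
        g.laplacian real_dim_prod (prodForm lam₁ lam₂) = 0) ∧
    -- its Dolbeault class in `H^{2,2}` and its de Rham class in `H⁴` are nonzero
    (∃ h : prodForm lam₁ lam₂ ∈ dbarClosedForms prodModel (S₁ × S₂) 2 2,
      Dolbeault.mk prodModel (S₁ × S₂) (p := 2) (q := 1) ⟨prodForm lam₁ lam₂, h⟩ ≠ 0) ∧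
    (∃ h : prodForm lam₁ lam₂ ∈ closedForms prodModel (S₁ × S₂) 4,
      DeRham.mk prodModel (S₁ × S₂) (k := 3) ⟨prodForm lam₁ lam₂, h⟩ ≠ 0) := by
  have := hS₁.isManifold
  have := hS₁.t2
  have := hS₁.compact
  have := hS₁.simplyConnected
  have := hS₂.isManifold
  have := hS₂.t2
  have := hS₂.compact
  have := hS₂.simplyConnected
  have hsmooth := isSmooth_prodForm hlam₁.1 hlam₂.1
  have htype := isOfType_prodForm hlam₁.1.1 hlam₂.1.1
  refine ⟨⟨hsmooth, htype⟩, fun φ₁ hφ₁ φ₂ hφ₂ => ?_, fun g₁ g₂ g hg => ?_, ?_, ?_⟩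
  · have h₁ := fun z hz => inCoords_eq_localCoeff hφ₁ hlam₁.1.1 (z := z) hz
    have h₂ := fun z hz => inCoords_eq_localCoeff hφ₂ hlam₂.1.1 (z := z) hz
    exact ⟨localCoeff lam₁ φ₁, localCoeff lam₂ φ₂, differentiableOn_localCoeff hφ₁ hlam₁.1,
      differentiableOn_localCoeff hφ₂ hlam₂.1, fun z hz => localCoeff_ne_zero hφ₁ hlam₁ hz,
      fun w hw => localCoeff_ne_zero hφ₂ hlam₂ hw, h₁, h₂, fun z hz w hw =>
      inCoords_prodForm (mdifferentiableAt_symm hφ₁ hz) (mdifferentiableAt_symm hφ₂ hw)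
        (h₁ z hz) (h₂ w hw)⟩
  · exact laplacian_prodForm hg hlam₁.1 hlam₂.1
  · refine ⟨⟨hsmooth, htype, dbar_prodForm hlam₁.1 hlam₂.1⟩, fun h => ?_⟩
    exact prodForm_notMem_dbarExactForms hlam₁ hlam₂
      ((Submodule.Quotient.mk_eq_zero _).mp (congrArg Subtype.val h))
  · refine ⟨⟨hsmooth, extD_prodForm hlam₁.1 hlam₂.1⟩, fun h => ?_⟩
    exact prodForm_notMem_exactForms hlam₁ hlam₂
      ((Submodule.Quotient.mk_eq_zero _).mp (congrArg Subtype.val h))
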